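/- Write $(x;p,q)=\prod_{r,s\ge 0}(1-p^rq^sx)$, $(x_1,\dots,x_k;p,q)=\prod_{l}(x_l;p,q)$, $(tz^{\pm1};p,q)=(tz,t/z;p,q)$ and $(uz^{\pm1}y^{\pm1};p,q)=(uzy,uz/y,uy/z,u/(zy);p,q)$. Let $G$ be a finite graph with vertex set $\{1,\dots,n\}$, possibly with multiple edges (but no loops) and with half-edges (edges with only one side attached to a vertex). Label the half-edges at the vertex $i$ by variables $t_{ri}$ ($1\le r\le R_i$) and the edges between $i$ and $j$ by variables $u_{rij}$ ($i<j$, $1\le r\le U_{ij}$). Let $F=F(p,q;t_{ri};u_{rij};z_1,\dots,z_n)$ be a function such that $$F\cdot\prod_{r,i}(t_{ri}z_i^{\pm1};p,q)\prod_{r,\,i<j}(u_{rij}z_i^{\pm1}z_j^{\pm1};p,q)$$ is holomorphic on the domain $0<|p|,|q|<1$, $z_i,t_{ri},u_{rij}\in\mathbb C^*$; that is, off the zeros of the product of Pochhammer symbols it agrees with a function holomorphic on the whole domain. Put $$\Pi=\prod_\lambda(w(\lambda);p,q)\prod_\mu(w(\mu),p\,w(\mu),q\,w(\mu),pq\,w(\mu);p,q)^2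 .$$ Here $w$ of a path is the product of the labels of its edges and half-edges with multiplicity; paths may repeat edges and vertices, and the length of a path is its number of edges and half-edges with multiplicity. The index $\lambda$ runs over all paths in $G$ of length at most $2\cdot3^{n-1}$ that start and end at a half-edge (so they contain exactly two, possibly equal, half-edges); a path and its reverse are counted separately unless the path is symmetric. The index $\mu$ runs over all closed paths of positive length at most $4\cdot3^{n-2}$, consisting of edges only; a closed path carries a starting point and a direction. (a) The function $$\Pi\int_{C^n}F\prod_{j=1}^n\frac{dz_j}{2\pi i z_j},\qquad C \text{ the unit circle},$$ defined for $|t_{ri}|<1$ and $|u_{rij}|<1$, extends uniquely to a holomorphic function $\Phi$ on the domain $0<|p|,|q|<1$, $t_{ri},u_{rij}\in\mathbb C^*$. (b) At each point of this domain with $\Pi\ne0$, and for each order of the variables, $\Phi/\Pi$ is the value of the iterated integral of $F\prod_j dz_j/(2\pi i z_j)$ in this order over contours (finite collections of closed curves) that are deformations of the unit circle, the contours of inner integrals being allowed to depend on the values of the outer variables. Such contours exist, and every choice of them, with the inner integrals continuous along the outer contours, gives this value. "Deformation of the unit circle" means the following. Let $z_i$ be a variable of integration, $S$ the set of the $m$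 variables inner to it, and fix the values of the outer variables. Treat an edge with label $u$ to a vertex $j\notin S\cup\{i\}$ as two half-edges labelled $uz_j$ and $uz_j^{-1}$. Let $A$ be the set of all $p^aq^bw$ ($a,b\ge0$), where $w$ is the weight of a path of length at most $2\cdot3^{m-1}$ (at most $1$ if $m=0$) starting with a half-edge, running through vertices of $S$ and ending when it reaches $i$, together with all square roots of $p^aq^bw$ ($a,b\ge0$), where $w$ is the weight of a closed path of length at most $2\cdot3^{m-1}$ from $i$ through vertices of $S$ up to its first return to $i$. The contour for $z_i$ avoids $0$, $A$ and $\{x^{-1}:x\in A\}$, has winding number $1$ around $0$ and around each point of $A$, and winding number $0$ around each $x^{-1}$, $x\in A$. (c) (Criterion for Fubini.) If $0<|p|,|q|<1$, $t_{ri},u_{rij}\in\mathbb C^*$, and for every path in $G$ (closed of positive length, or from a half-edge to a half-edge, of any length) the product of its labels is not in $p^{\mathbb Z_{\le0}}q^{\mathbb Z_{\le0}}$, then $\Pi\neq0$, and the iterated integrals of $F\prod_j dz_j/(2\pi i z_j)$ over deformations of the unit circle exist in every order of the variables and all have the same value. -/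

import Mathlib

/-- The elliptic Pochhammer symbol `(x; p, q) = ∏_{r, s ≥ 0} (1 - p ^ r q ^ s x)`. -/
noncomputable def ellPoch (p q x : ℂ) : ℂ :=
  ∏' k : ℕ × ℕ, (1 - p ^ k.1 * q ^ k.2 * x)

/-- A graph on the vertices `Fin n` with multiple edges and with half-edges. The half-edge `h : H`
is attached to the vertex `base h`; the edge `e : E` joins the distinct vertices `src e`, `tgt e`. -/
structure HalfEdgeGraph (n : ℕ) (H E : Type*) where
  base : H → Fin n
  src : E → Fin n
  tgt : E → Fin n
  src_ne_tgt : ∀ e, src e ≠ tgt e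

namespace HalfEdgeGraph

variable {n : ℕ} {H E : Type*}

/-- The initial vertex of an oriented edge (an edge together with one of its two directions). -/
def start (G : HalfEdgeGraph n H E) (d : E × Bool) : Fin n :=
  if d.2 then G.src d.1 else G.tgt d.1

/-- The final vertex of an oriented edge. -/
def finish (G : HalfEdgeGraph n H E) (d : E × Bool) : Fin n :=
  if d.2 then G.tgt d.1 else G.src d.1

/-- The list of oriented edges `l` is a path from the vertex `i` to the vertex `j`
(vertices and edges may be repeated). -/
def IsPath (G : HalfEdgeGraph n H E) : Fin n → List (E × Bool) → Fin n → Prop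
  | i, [], j => i = j
  | i, d :: l, j => G.start d = i ∧ G.IsPath (G.finish d) l j

/-- The product of the labels of the edges of a path. -/
def weight (u : E → ℂ) (l : List (E × Bool)) : ℂ :=
  (l.map fun d => u d.1).prod

/-- The product `∏ (t_{ri} z_i^{±1}; p, q) ∏ (u_{rij} z_i^{±1} z_j^{±1}; p, q)`. -/
noncomputable def denominator [Fintype H] [Fintype E] (G : HalfEdgeGraph n H E) (p q : ℂ)
    (t : H → ℂ) (u : E → ℂ) (z : Fin n → ℂ) : ℂ :=
  (∏ h, ellPoch p q (t h * z (G.base h)) * ellPoch p q (t h * (z (G.base h))⁻¹)) *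
    ∏ e, ellPoch p q (u e * z (G.src e) * z (G.tgt e)) *
      ellPoch p q (u e * z (G.src e) * (z (G.tgt e))⁻¹) *
      ellPoch p q (u e * (z (G.src e))⁻¹ * z (G.tgt e)) *
      ellPoch p q (u e * (z (G.src e))⁻¹ * (z (G.tgt e))⁻¹)

open Classical in
/-- The factor `∏_λ (w(λ); p, q)` over all paths of length at most `2 * 3 ^ (n - 1)` that start and
end at a half-edge. Such a path consists of two half-edges and `m` oriented edges between them and
has length `m + 2`. It is an oriented object: a path and its reverse are different unless the path
is symmetric. (If `n = 0` there are no half-edges.) -/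
noncomputable def openPathFactor [Fintype H] [Fintype E] (G : HalfEdgeGraph n H E) (p q : ℂ)
    (t : H → ℂ) (u : E → ℂ) : ℂ :=
  ∏ m ∈ Finset.range (2 * 3 ^ (n - 1) - 1), ∏ h : H, ∏ h' : H, ∏ l : Fin m → E × Bool,
    if G.IsPath (G.base h) (List.ofFn l) (G.base h') then
      ellPoch p q (t h * weight u (List.ofFn l) * t h') else 1

open Classical in
/-- The factor `∏_μ (w(μ), p w(μ), q w(μ), p q w(μ); p, q) ^ 2` over all closed paths of length at
least one and at most `4 * 3 ^ (n - 2)`; a closed path carries a starting point and a direction.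
(If `n ≤ 1` there are no edges, hence no closed paths.) -/
noncomputable def closedPathFactor [Fintype E] (G : HalfEdgeGraph n H E) (p q : ℂ)
    (u : E → ℂ) : ℂ :=
  ∏ m ∈ Finset.Icc 1 (4 * 3 ^ (n - 2)), ∏ i : Fin n, ∏ l : Fin m → E × Bool,
    if G.IsPath i (List.ofFn l) i then
      (ellPoch p q (weight u (List.ofFn l)) * ellPoch p q (p * weight u (List.ofFn l)) *
        ellPoch p q (q * weight u (List.ofFn l)) *
        ellPoch p q (p * q * weight u (List.ofFn l))) ^ 2
    else 1

/-- The prefactor of the integral. -/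
noncomputable def prefactor [Fintype H] [Fintype E] (G : HalfEdgeGraph n H E) (p q : ℂ)
    (t : H → ℂ) (u : E → ℂ) : ℂ :=
  G.openPathFactor p q t u * G.closedPathFactor p q u

/-- For no path of `G`, closed (and not empty) or between two half-edges, is the product of the
labels an element of `p ^ ℤ_{≤ 0} q ^ ℤ_{≤ 0}`. -/
def NonResonant (G : HalfEdgeGraph n H E) (p q : ℂ) (t : H → ℂ) (u : E → ℂ) : Prop :=
  (∀ (h h' : H) (l : List (E × Bool)), G.IsPath (G.base h) l (G.base h') →
    ∀ a b : ℕ, t h * weight u l * t h' ≠ (p ^ a)⁻¹ * (q ^ b)⁻¹) ∧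
  (∀ (i : Fin n) (l : List (E × Bool)), l ≠ [] → G.IsPath i l i →
    ∀ a b : ℕ, weight u l ≠ (p ^ a)⁻¹ * (q ^ b)⁻¹)

/-- Suppose that the variables `z_j` with `j` in `inner` have been integrated out, that `z_i` is the
next variable of integration, and that the remaining variables are parameters. On the remaining
vertices the graph then has the half-edges labelled `t_h`, and an edge with label `u` to a vertex
`j` that is neither `i` nor in `inner` gives two half-edges labelled `u z_j` and `u z_j⁻¹`.
`ArrivalWeight` says that `y` is the product of the labels of a path that begins with one of these
half-edges, runs through vertices of `inner`, and ends on reaching `i`, the length being at most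
`2 * 3 ^ (m - 1)` for `m = inner.length` (for `m = 0` the path is a single half-edge). -/
def ArrivalWeight (G : HalfEdgeGraph n H E) (t : H → ℂ) (u : E → ℂ) (inner : List (Fin n))
    (i : Fin n) (z : Fin n → ℂ) (y : ℂ) : Prop :=
  (∃ (h : H) (l : List (E × Bool)), G.IsPath (G.base h) l i ∧
    (∀ d ∈ l, G.start d ∈ inner) ∧ l.length + 1 ≤ 2 * 3 ^ (inner.length - 1) ∧
    y = t h * weight u l) ∨
  (∃ (d₀ : E × Bool) (l : List (E × Bool)), G.start d₀ ≠ i ∧ G.start d₀ ∉ inner ∧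
    G.IsPath (G.finish d₀) l i ∧
    (∀ d ∈ l, G.start d ∈ inner) ∧ l.length + 1 ≤ 2 * 3 ^ (inner.length - 1) ∧
    (y = z (G.start d₀) * u d₀.1 * weight u l ∨ y = (z (G.start d₀))⁻¹ * u d₀.1 * weight u l))

/-- `y` is the product of the labels of a closed path of length at most `2 * 3 ^ (m - 1)` which
starts at `i` and runs through vertices of `inner` until its first return to `i`. -/
def ReturnWeight (G : HalfEdgeGraph n H E) (u : E → ℂ) (inner : List (Fin n)) (i : Fin n)
    (y : ℂ) : Prop :=
  ∃ (d₀ : E × Bool) (l : List (E × Bool)), G.start d₀ = i ∧ G.IsPath (G.finish d₀) l i ∧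
    (∀ d ∈ l, G.start d ∈ inner) ∧ l.length + 1 ≤ 2 * 3 ^ (inner.length - 1) ∧
    y = u d₀.1 * weight u l

/-- The possible poles in `z_i` (after integration over the variables in `inner`) which lie inside
the unit circle when all labels are less than one in absolute value: the numbers `p ^ a q ^ b y`
for arrival weights `y`, and the square roots of `p ^ a q ^ b y` for return weights `y`. The other
possible poles are the reciprocals of these. -/
def innerPoles (G : HalfEdgeGraph n H E) (p q : ℂ) (t : H → ℂ) (u : E → ℂ)
    (inner : List (Fin n)) (i : Fin n) (z : Fin n → ℂ) : Set ℂ :=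
  {x | (∃ y, G.ArrivalWeight t u inner i z y ∧ ∃ a b : ℕ, x = p ^ a * q ^ b * y) ∨
    ∃ y, G.ReturnWeight u inner i y ∧ ∃ a b : ℕ, x ^ 2 = p ^ a * q ^ b * y}

end HalfEdgeGraph

/-- A continuously differentiable closed curve in `ℂ`, parametrized by `[0, 2π]`. -/
structure ClosedCurve where
  toFun : ℝ → ℂ
  contDiff : ContDiff ℝ 1 toFun
  closed : toFun 0 = toFun (2 * Real.pi)

/-- A possibly disconnected contour: a finite collection of closed curves. -/
abbrev Contour := List ClosedCurve

namespace Contour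

/-- The set of points on the contour. -/
def trace (Γ : Contour) : Set ℂ :=
  {x | ∃ γ ∈ Γ, ∃ θ ∈ Set.Icc (0 : ℝ) (2 * Real.pi), γ.toFun θ = x}

/-- The contour integral of `f`. -/
noncomputable def integral (Γ : Contour) (f : ℂ → ℂ) : ℂ :=
  (Γ.map fun γ => ∫ θ in (0 : ℝ)..(2 * Real.pi), deriv γ.toFun θ * f (γ.toFun θ)).sum

/-- The winding number of the contour around `a`, for `a` not on the contour. -/
noncomputable def winding (Γ : Contour) (a : ℂ) : ℂ :=
  (2 * Real.pi * Complex.I)⁻¹ * Γ.integral fun ζ => (ζ - a)⁻¹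

/-- The contour avoids `0`, the points of `A` and their reciprocals; it winds once around `0` and
around each point of `A`, and zero times around each reciprocal of a point of `A`. -/
def Separates (Γ : Contour) (A : Set ℂ) : Prop :=
  (0 ∉ Γ.trace ∧ Γ.winding 0 = 1) ∧
    ∀ a ∈ A, (a ∉ Γ.trace ∧ Γ.winding a = 1) ∧ (a⁻¹ ∉ Γ.trace ∧ Γ.winding a⁻¹ = 0)

end Contour

/-- `I` is a value of the iterated integral of `f` with respect to `dz / (2 π i z)` in all variables
of the list (the first one is the outermost variable), at fixed values of the other variables,
over contours which are deformations of the unit circle: the contour for each variable separates the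
possible poles coming from the inside of the unit circle from those coming from the outside.
The contours of the inner integrals may depend on the values of the outer variables, and the inner
integral is continuous along the contour of the outer one. -/
def IsDeformedIntegral {n : ℕ} {H E : Type*} (G : HalfEdgeGraph n H E) (p q : ℂ) (t : H → ℂ)
    (u : E → ℂ) (f : (Fin n → ℂ) → ℂ) : List (Fin n) → (Fin n → ℂ) → ℂ → Prop
  | [], z, I => I = f z
  | i :: inner, z, I => ∃ (Γ : Contour) (g : ℂ → ℂ),
      Γ.Separates (G.innerPoles p q t u inner i z) ∧
      ContinuousOn g Γ.trace ∧
      (∀ ζ ∈ Γ.trace, IsDeformedIntegral G p q t u f inner (Function.update z i ζ) (g ζ)) ∧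
      I = (2 * Real.pi * Complex.I)⁻¹ * Γ.integral fun ζ => ζ⁻¹ * g ζ

/-- `I` is a value of the integral of `f` over all variables, iterated in the order
`σ 0, σ 1, …` (outermost variable first), over deformations of the unit circle. The point at which
the recursion starts is immaterial, since every variable is integrated. -/
def IsFullDeformedIntegral {n : ℕ} {H E : Type*} (G : HalfEdgeGraph n H E) (p q : ℂ) (t : H → ℂ)
    (u : E → ℂ) (f : (Fin n → ℂ) → ℂ) (σ : Equiv.Perm (Fin n)) (I : ℂ) : Prop :=
  IsDeformedIntegral G p q t u f (List.ofFn σ) (fun _ => 1) I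

/-- The integral of `f` with respect to `∏ dz_j / (2 π i z_j)` over the `n`-th power of the unit
circle. -/
noncomputable def unitTorusIntegral {n : ℕ} (f : (Fin n → ℂ) → ℂ) : ℂ :=
  ((2 * Real.pi * Complex.I) ^ n)⁻¹ *
    torusIntegral (fun z => (∏ j, (z j)⁻¹) * f z) (fun _ => 0) (fun _ => 1)

/-- The tuples `(p, q, t, u)` with `0 < |p|, |q| < 1` and with nonzero labels `t`, `u`. -/
def paramDomain (H E : Type*) : Set (ℂ × ℂ × (H → ℂ) × (E → ℂ)) :=
  {x | (0 < ‖x.1‖ ∧ ‖x.1‖ < 1) ∧ (0 < ‖x.2.1‖ ∧ ‖x.2.1‖ < 1) ∧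
    (∀ h, x.2.2.1 h ≠ 0) ∧ ∀ e, x.2.2.2 e ≠ 0}

/-- The tuples `(p, q, t, u)` as above for which all labels are less than one in absolute value. -/
def smallParamDomain (H E : Type*) : Set (ℂ × ℂ × (H → ℂ) × (E → ℂ)) :=
  {x | x ∈ paramDomain H E ∧ (∀ h, ‖x.2.2.1 h‖ < 1) ∧ ∀ e, ‖x.2.2.2 e‖ < 1}

/-!
The integral is computed one variable at a time. Suppose that the variables at the vertices of `S`
have been integrated. The remaining variables and the labels are parameters, and the claim to be
carried through the induction is that the integral, multiplied by
`attachedFactor S = ∏ (w; p, q)`, extends to a holomorphic function on the whole domain. Here `w`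
runs over the monomials of bounded length of the paths through `S` which begin and end at a
half-edge, an edge that leaves `S` being regarded as two half-edges, and of the closed paths in `S`.
This is `exists_isDeformedIntegral_iff`; at the same time it shows that the integrals exist where
this factor does not vanish, and that they do not depend on the contours.

*One variable.* As a function of the variable `ζ` at the next vertex `i`, the integrand has the form
`h(ζ) / (P(ζ) P(ζ⁻¹))` with `h` holomorphic on `ℂ \ {0}`, where `P` is a product of factors
`(v ζ; p, q)` and `(w ζ²; p, q)`; the `v` are the monomials of paths from a half-edge to `i`, the `w`
those of paths from `i` back to `i`. Contours that separate the zeros of `P(ζ⁻¹)` from those of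
`P(ζ)` exist unless one of the products `v v'`, `v² w`, `w w'` is in `p^{≤0} q^{≤0}`
(`Contour.exists_separates`), and the choice of the contour is irrelevant by Cauchy's theorem for
homologous contours (`Contour.integral_eq_of_winding_eq`, proved after Dixon). The product `c` of
the Pochhammer symbols of the *distinct* monomials `v v'`, of the distinct `v² w` and of the distinct
`w w'` is, up to factors without zeros in an annulus, a combination `A(ζ) P(ζ) + B(ζ) P(ζ⁻¹)` with
holomorphic coefficients (`prod_one_sub_mem_span_pair`, `MonomialSystem.exists_bezout`). Therefore
`c` times the integrand is a sum of a term which has only the poles of `1 / P(ζ⁻¹)` and a term which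
has only those of `1 / P(ζ)`. For the former the contour may be replaced by a large circle, for the
latter by a small one, and integrals over fixed circles are holomorphic in the parameters
(`MonomialSystem.exists_residueExtension`).

*The graph.* Joining paths at `i` shows that all monomials `v v'` and `v² w` belong to paths between
half-edges through `S ∪ {i}`, and the `w` and `w w'` to closed paths. Their lengths are at most
three times, respectively twice, the previous bound, which explains the powers of `3`. None of them
is needed twice: the number of sides of edges and half-edges which are attached to `i` is `2` for
`v v'`, `4` for `v² w`, `2` for `w`, `4` for `w w'`, and `0` for the monomials kept from before
(`prod_dvd_prod_openMonomials_insert`). Once all variables are integrated, the factor that has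
accumulated divides the prefactor `Π` (`exists_prefactor_eq`).

*Comparison with the unit torus.* If all labels are less than one in absolute value, then unit
circles are admissible contours (`isDeformedIntegral_circleIter`), and the iterated integral in any
order is the integral over the torus (`circleIter_perm`). Multiplying all labels by a common nonzero
number connects every point of the domain with such labels, and the identity theorem yields
uniqueness and the independence of the order (`eqOn_paramDomain_of_eqOn_small`). If there are no
resonances, then `Π` does not vanish (`NonResonant.prefactor_ne_zero`).
-/


/-! ### Holomorphic functions on normed spaces -/

section SeveralComplexVariables

open Filter Topology Metric Set

variable {Y : Type*} [NormedAddCommGroup Y] [NormedSpace ℂ Y]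

/-- A Cauchy estimate; the factor `2` comes from bounding `f - f c`. -/
theorem norm_fderiv_le_of_norm_le {f : Y → ℂ} {c : Y} {R M : ℝ}
    (hd : DifferentiableOn ℂ f (ball c R)) (hR : 0 < R) (hM : ∀ x ∈ ball c R, ‖f x‖ ≤ M) :
    ‖fderiv ℂ f c‖ ≤ 2 * M / R := by
  refine Complex.norm_fderiv_le_div_of_mapsTo_ball hd (fun x hx => ?_) hR
  rw [mem_closedBall, dist_eq_norm]
  have := norm_sub_le (f x) (f c)
  have := hM x hx
  have := hM c (mem_ball_self hR)
  linarith

theorem norm_fderiv_sub_le {f g : Y → ℂ} {c : Y} {R M : ℝ}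
    (hf : DifferentiableOn ℂ f (ball c R)) (hg : DifferentiableOn ℂ g (ball c R)) (hR : 0 < R)
    (hM : ∀ x ∈ ball c R, ‖f x - g x‖ ≤ M) :
    ‖fderiv ℂ f c - fderiv ℂ g c‖ ≤ 2 * M / R := by
  have h := norm_fderiv_le_of_norm_le (hf.sub hg) hR hM
  have hc := ball_mem_nhds c hR
  rwa [fderiv_sub (hf.differentiableAt hc) (hg.differentiableAt hc)] at h

/-- A locally uniform limit of holomorphic functions of several variables is holomorphic: by the
Cauchy estimates the derivatives converge locally uniformly as well. -/
theorem differentiableOn_of_tendstoLocallyUniformlyOn [ProperSpace Y] {ι : Type*} {l : Filter ι}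
    [l.NeBot] {F : ι → Y → ℂ} {f : Y → ℂ} {s : Set Y} (hs : IsOpen s)
    (hF : ∀ n, DifferentiableOn ℂ (F n) s) (h : TendstoLocallyUniformlyOn F f l s) :
    DifferentiableOn ℂ f s := by
  intro x hx
  obtain ⟨r, hr, hrs⟩ := Metric.nhds_basis_closedBall.mem_iff.1 (hs.mem_nhds hx)
  have hr2 : 0 < r / 2 := by linarith
  have hU : TendstoUniformlyOn F f l (closedBall x r) :=
    (tendstoLocallyUniformlyOn_iff_forall_isCompact hs).1 h _ hrs (isCompact_closedBall x r)
  have hsub : ∀ y ∈ ball x (r / 2), ball y (r / 2) ⊆ closedBall x r := by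
    intro y hy z hz
    rw [mem_ball] at hy hz
    rw [mem_closedBall]
    linarith [dist_triangle z y x]
  have hC : UniformCauchySeqOn (fun n => fderiv ℂ (F n)) l (ball x (r / 2)) := by
    intro u hu
    obtain ⟨ε, hε, hεu⟩ := Metric.mem_uniformity_dist.1 hu
    have h1 := hU.uniformCauchySeqOn {p | dist p.1 p.2 < ε * r / 8}
      (dist_mem_uniformity (by positivity))
    filter_upwards [h1] with m hm y hy
    apply hεu
    rw [dist_eq_norm]
    have hd : ∀ n, DifferentiableOn ℂ (F n) (ball y (r / 2)) := fun n =>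
      (hF n).mono ((hsub y hy).trans hrs)
    refine (norm_fderiv_sub_le (hd _) (hd _) hr2 (M := ε * r / 8) fun z hz => ?_).trans_lt ?_
    · rw [← dist_eq_norm]
      exact (hm z (hsub y hy hz)).le
    · rw [div_lt_iff₀ hr2]
      nlinarith [mul_pos hε hr]
  have hlim : ∀ y, ∃ L, y ∈ ball x (r / 2) → Tendsto (fun n => fderiv ℂ (F n) y) l (𝓝 L) := by
    intro y
    by_cases hy : y ∈ ball x (r / 2)
    · obtain ⟨L, hL⟩ := CompleteSpace.complete (hC.cauchy_map hy)
      exact ⟨L, fun _ => hL⟩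
    · exact ⟨0, fun h => absurd h hy⟩
  choose g hg using hlim
  have hsb : ball x (r / 2) ⊆ closedBall x r := fun z hz => by
    rw [mem_ball] at hz
    rw [mem_closedBall]
    linarith
  refine (hasFDerivAt_of_tendstoUniformlyOn (f := F) (g := f) isOpen_ball
    (hC.tendstoUniformlyOn_of_tendsto fun y hy => hg y hy)
    (fun n y hy => ((hF n).differentiableAt (hs.mem_nhds (hrs (hsb hy)))).hasFDerivAt)
    (fun y hy => hU.tendsto_at (hsb hy))
    (mem_ball_self hr2)).differentiableAt.differentiableWithinAt

/-- An integral of functions depending holomorphically on several parameters is holomorphic in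
the parameters. -/
theorem differentiableOn_intervalIntegral [ProperSpace Y] {f : Y → ℝ → ℂ} {s : Set Y} {a b : ℝ}
    (hab : a ≤ b) (hs : IsOpen s) (hc : ContinuousOn (Function.uncurry f) (s ×ˢ Icc a b))
    (hd : ∀ θ ∈ Icc a b, DifferentiableOn ℂ (fun y => f y θ) s) :
    DifferentiableOn ℂ (fun y => ∫ θ in a..b, f y θ) s := by
  intro y₀ hy₀
  obtain ⟨r, hr, hrs⟩ := Metric.nhds_basis_closedBall.mem_iff.1 (hs.mem_nhds hy₀)
  have hK : IsCompact (closedBall y₀ r ×ˢ Icc a b) := (isCompact_closedBall y₀ r).prod isCompact_Icc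
  have hKs : closedBall y₀ r ×ˢ Icc a b ⊆ s ×ˢ Icc a b := prod_mono hrs subset_rfl
  obtain ⟨M, hM⟩ := hK.exists_bound_of_continuousOn (hc.mono hKs)
  have hM' : ∀ θ ∈ Icc a b, ∀ y ∈ ball y₀ r, ‖f y θ‖ ≤ M := fun θ hθ y hy =>
    hM (y, θ) ⟨ball_subset_closedBall hy, hθ⟩
  have hdb : ∀ θ ∈ Icc a b, DifferentiableOn ℂ (fun y => f y θ) (ball y₀ r) := fun θ hθ =>
    (hd θ hθ).mono (ball_subset_closedBall.trans hrs)
  have hcθ : ∀ y ∈ s, ContinuousOn (f y) (Icc a b) := fun y hy =>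
    hc.comp (f := fun θ => (y, θ)) (by fun_prop) fun θ hθ => ⟨hy, hθ⟩
  have hmeas : ∀ y ∈ s, MeasureTheory.AEStronglyMeasurable (f y)
      (MeasureTheory.volume.restrict (Ioc a b)) := fun y hy =>
    ((hcθ y hy).mono Ioc_subset_Icc_self).aestronglyMeasurable measurableSet_Ioc
  have hF' : ContinuousOn (fun θ => fderiv ℂ (fun y => f y θ) y₀) (Icc a b) := by
    rw [Metric.continuousOn_iff]
    intro θ₀ hθ₀ ε hε
    obtain ⟨δ, hδ, hδ'⟩ := Metric.uniformContinuousOn_iff.1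
      (hK.uniformContinuousOn_of_continuous (hc.mono hKs)) (ε * r / 4) (by positivity)
    refine ⟨δ, hδ, fun θ hθ hθθ₀ => ?_⟩
    rw [dist_eq_norm]
    refine (norm_fderiv_sub_le (hdb θ hθ) (hdb θ₀ hθ₀) hr (M := ε * r / 4)
      fun y hy => ?_).trans_lt ?_
    · rw [← dist_eq_norm]
      refine (hδ' (y, θ) ⟨ball_subset_closedBall hy, hθ⟩ (y, θ₀)
        ⟨ball_subset_closedBall hy, hθ₀⟩ ?_).le
      simpa [Prod.dist_eq, hδ] using hθθ₀
    · rw [div_lt_iff₀ hr]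
      nlinarith [mul_pos hε hr]
  have hae : ∀ᵐ θ ∂(MeasureTheory.volume.restrict (Ioc a b)), θ ∈ Icc a b := by
    filter_upwards [MeasureTheory.ae_restrict_mem measurableSet_Ioc] with θ hθ
    exact Ioc_subset_Icc_self hθ
  have key := hasFDerivAt_integral_of_dominated_loc_of_lip' (𝕜 := ℂ)
    (μ := MeasureTheory.volume.restrict (Ioc a b)) (F := f) (x₀ := y₀)
    (F' := fun θ => fderiv ℂ (fun y => f y θ) y₀) (bound := fun _ => 2 * M / r)
    (ball_mem_nhds y₀ hr) (fun x hx => hmeas x (hrs (ball_subset_closedBall hx)))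
    (((hcθ y₀ hy₀).integrableOn_Icc).mono_set Ioc_subset_Icc_self)
    ((hF'.mono Ioc_subset_Icc_self).aestronglyMeasurable measurableSet_Ioc)
    (by
      filter_upwards [hae] with θ hθ x hx
      rw [← dist_eq_norm, ← dist_eq_norm]
      refine Complex.dist_le_div_mul_dist_of_mapsTo_ball (hdb θ hθ) (fun x hx => ?_) hx
      rw [mem_closedBall, dist_eq_norm]
      have := norm_sub_le (f x θ) (f y₀ θ)
      have := hM' θ hθ x hx
      have := hM' θ hθ y₀ (mem_ball_self hr)
      linarith)
    (MeasureTheory.integrable_const _)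
    (by
      filter_upwards [hae] with θ hθ
      exact ((hdb θ hθ).differentiableAt (ball_mem_nhds y₀ hr)).hasFDerivAt)
  have h2 := key.2.differentiableAt
  simp only [intervalIntegral.integral_of_le hab]
  exact h2.differentiableWithinAt

end SeveralComplexVariables

/-! ### Integrals over contours -/

section Contours

open Filter Topology Metric Set

namespace ClosedCurve

theorem continuous (γ : ClosedCurve) : Continuous γ.toFun := γ.contDiff.continuous

theorem continuous_deriv (γ : ClosedCurve) : Continuous (deriv γ.toFun) :=
  γ.contDiff.continuous_deriv le_rfl

theorem hasDerivAt (γ : ClosedCurve) (θ : ℝ) : HasDerivAt γ.toFun (deriv γ.toFun θ) θ :=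
  (γ.contDiff.differentiable one_ne_zero θ).hasDerivAt

end ClosedCurve

namespace Contour

theorem two_pi_nonneg : (0 : ℝ) ≤ 2 * Real.pi := by positivity

@[simp]
theorem trace_nil : trace [] = ∅ := by simp [trace]

theorem trace_cons (γ : ClosedCurve) (Γ : Contour) :
    trace (γ :: Γ) = γ.toFun '' Icc 0 (2 * Real.pi) ∪ trace Γ := by
  ext x
  simp [trace]

theorem trace_append (Γ Γ' : Contour) : trace (Γ ++ Γ') = trace Γ ∪ trace Γ' := by
  ext x
  simp [trace, or_and_right, exists_or]

@[simp]
theorem integral_nil (f : ℂ → ℂ) : integral [] f = 0 := by simp [integral]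

theorem integral_cons (γ : ClosedCurve) (Γ : Contour) (f : ℂ → ℂ) :
    integral (γ :: Γ) f =
      (∫ θ in (0 : ℝ)..(2 * Real.pi), deriv γ.toFun θ * f (γ.toFun θ)) + integral Γ f := by
  simp [integral]

theorem integral_append (Γ Γ' : Contour) (f : ℂ → ℂ) :
    integral (Γ ++ Γ') f = integral Γ f + integral Γ' f := by
  simp [integral]

theorem isCompact_trace (Γ : Contour) : IsCompact (trace Γ) := by
  induction Γ with
  | nil => simp
  | cons γ Γ ih =>
    rw [trace_cons]
    exact (isCompact_Icc.image γ.continuous).union ih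

theorem integral_congr {Γ : Contour} {f g : ℂ → ℂ} (h : EqOn f g (trace Γ)) :
    Γ.integral f = Γ.integral g := by
  induction Γ with
  | nil => simp
  | cons γ Γ ih =>
    rw [trace_cons] at h
    rw [integral_cons, integral_cons, ih (h.mono subset_union_right)]
    congr 1
    refine intervalIntegral.integral_congr fun θ hθ => ?_
    rw [uIcc_of_le two_pi_nonneg] at hθ
    rw [h (Or.inl (mem_image_of_mem _ hθ))]

theorem integral_const_mul (Γ : Contour) (c : ℂ) (f : ℂ → ℂ) :
    (Γ.integral fun z => c * f z) = c * Γ.integral f := by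
  induction Γ with
  | nil => simp
  | cons γ Γ ih =>
    rw [integral_cons, integral_cons, ih, mul_add, ← intervalIntegral.integral_const_mul]
    congr 2
    ext θ
    ring

theorem integral_add {Γ : Contour} {f g : ℂ → ℂ} (hf : ContinuousOn f (trace Γ))
    (hg : ContinuousOn g (trace Γ)) :
    (Γ.integral fun z => f z + g z) = Γ.integral f + Γ.integral g := by
  induction Γ with
  | nil => simp
  | cons γ Γ ih =>
    rw [trace_cons] at hf hg
    have hi : ∀ f : ℂ → ℂ, ContinuousOn f (γ.toFun '' Icc 0 (2 * Real.pi) ∪ trace Γ) →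
        IntervalIntegrable (fun θ => deriv γ.toFun θ * f (γ.toFun θ)) MeasureTheory.volume
          0 (2 * Real.pi) := fun f hf => by
      refine ContinuousOn.intervalIntegrable ?_
      rw [uIcc_of_le two_pi_nonneg]
      exact γ.continuous_deriv.continuousOn.mul
        (hf.comp γ.continuous.continuousOn fun θ hθ => Or.inl (mem_image_of_mem _ hθ))
    rw [integral_cons, integral_cons, integral_cons, ih (hf.mono subset_union_right)
      (hg.mono subset_union_right)]
    simp only [mul_add]
    rw [intervalIntegral.integral_add (hi f hf) (hi g hg)]
    ring

theorem integral_sub {Γ : Contour} {f g : ℂ → ℂ} (hf : ContinuousOn f (trace Γ))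
    (hg : ContinuousOn g (trace Γ)) :
    (Γ.integral fun z => f z - g z) = Γ.integral f - Γ.integral g := by
  have := integral_add (hf) (g := fun z => (-1) * g z) (by fun_prop)
  rw [integral_const_mul] at this
  rw [sub_eq_add_neg, ← neg_one_mul (Γ.integral g), ← this]
  simp [sub_eq_add_neg]

/-- Integration over a contour is bounded by the supremum norm on its trace. -/
theorem exists_norm_integral_le (Γ : Contour) : ∃ C, 0 ≤ C ∧ ∀ (f : ℂ → ℂ) (M : ℝ),
    (∀ x ∈ trace Γ, ‖f x‖ ≤ M) → ‖Γ.integral f‖ ≤ C * M := by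
  induction Γ with
  | nil => exact ⟨0, le_rfl, fun f M _ => by simp⟩
  | cons γ Γ ih =>
    obtain ⟨C, hC, h⟩ := ih
    obtain ⟨B, hB⟩ := isCompact_Icc.exists_bound_of_continuousOn
      (s := Icc 0 (2 * Real.pi)) γ.continuous_deriv.continuousOn
    have hB0 : 0 ≤ B := (norm_nonneg _).trans (hB 0 ⟨le_rfl, two_pi_nonneg⟩)
    refine ⟨B * (2 * Real.pi) + C, by positivity, fun f M hf => ?_⟩
    rw [trace_cons] at hf
    rw [integral_cons, add_mul]
    refine norm_add_le_of_le ?_ (h f M fun x hx => hf x (Or.inr hx))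
    have := intervalIntegral.norm_integral_le_of_norm_le_const (a := 0) (b := 2 * Real.pi)
      (f := fun θ => deriv γ.toFun θ * f (γ.toFun θ)) (C := B * M) fun θ hθ => by
        rw [uIoc_of_le two_pi_nonneg] at hθ
        have hθ' := Ioc_subset_Icc_self hθ
        rw [norm_mul]
        exact mul_le_mul (hB θ hθ') (hf _ (Or.inl (mem_image_of_mem _ hθ'))) (norm_nonneg _) hB0
    rw [sub_zero, abs_of_nonneg two_pi_nonneg] at this
    linarith

/-- An integral over a fixed contour depends holomorphically on parameters in a normed space. -/
theorem differentiableOn_integral {Y : Type*} [NormedAddCommGroup Y] [NormedSpace ℂ Y]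
    [ProperSpace Y] (Γ : Contour) {f : Y → ℂ → ℂ} {s : Set Y} (hs : IsOpen s)
    (hc : ContinuousOn (Function.uncurry f) (s ×ˢ trace Γ))
    (hd : ∀ ζ ∈ trace Γ, DifferentiableOn ℂ (fun y => f y ζ) s) :
    DifferentiableOn ℂ (fun y => Γ.integral (f y)) s := by
  induction Γ with
  | nil => simp
  | cons γ Γ ih =>
    rw [trace_cons] at hc hd
    simp only [integral_cons]
    refine (differentiableOn_intervalIntegral two_pi_nonneg hs ?_ fun θ hθ => ?_).add
      (ih (hc.mono (prod_mono subset_rfl subset_union_right)) fun ζ hζ => hd ζ (Or.inr hζ))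
    · have h1 : ContinuousOn (fun x : Y × ℝ => Function.uncurry f (x.1, γ.toFun x.2))
          (s ×ˢ Icc 0 (2 * Real.pi)) :=
        hc.comp (by have := γ.continuous; fun_prop) fun x hx =>
          ⟨hx.1, Or.inl (mem_image_of_mem _ hx.2)⟩
      have h2 : Continuous fun x : Y × ℝ => deriv γ.toFun x.2 :=
        γ.continuous_deriv.comp continuous_snd
      exact h2.continuousOn.mul h1
    · exact (hd _ (Or.inl (mem_image_of_mem _ hθ))).const_mul _

/-- A logarithmic primitive: the integral of `(w - z)⁻¹ - (w - z')⁻¹` vanishes when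
`(w - z) / (w - z')` stays in the domain of the principal logarithm. -/
theorem integral_inv_sub_eq {Γ : Contour} {z z' : ℂ} (hz : z ∉ trace Γ) (hz' : z' ∉ trace Γ)
    (h : ∀ w ∈ trace Γ, (w - z) / (w - z') ∈ Complex.slitPlane) :
    (Γ.integral fun w => (w - z)⁻¹) = Γ.integral fun w => (w - z')⁻¹ := by
  have hne : ∀ {a}, a ∉ trace Γ → ∀ w ∈ trace Γ, w - a ≠ 0 := fun ha w hw h0 =>
    ha (sub_eq_zero.1 h0 ▸ hw)
  have hcont : ∀ {a}, a ∉ trace Γ → ContinuousOn (fun w => (w - a)⁻¹) (trace Γ) := fun ha =>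
    ContinuousOn.inv₀ (by fun_prop) (hne ha)
  rw [← sub_eq_zero, ← integral_sub (hcont hz) (hcont hz')]
  have key : ∀ Γ' : Contour, trace Γ' ⊆ trace Γ →
      (Γ'.integral fun w => (w - z)⁻¹ - (w - z')⁻¹) = 0 := by
    intro Γ'
    induction Γ' with
    | nil => simp
    | cons γ Γ' ih =>
      intro hΓ'
      rw [trace_cons] at hΓ'
      rw [integral_cons, ih (subset_union_right.trans hΓ'), add_zero]
      have hmem : ∀ θ ∈ Icc 0 (2 * Real.pi), γ.toFun θ ∈ trace Γ := fun θ hθ =>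
        hΓ' (Or.inl (mem_image_of_mem _ hθ))
      have hd : ∀ θ ∈ uIcc 0 (2 * Real.pi), HasDerivAt
          (fun θ => Complex.log ((γ.toFun θ - z) / (γ.toFun θ - z')))
          (deriv γ.toFun θ * ((γ.toFun θ - z)⁻¹ - (γ.toFun θ - z')⁻¹)) θ := by
        intro θ hθ
        rw [uIcc_of_le two_pi_nonneg] at hθ
        have h0 := hne hz _ (hmem θ hθ)
        have h0' := hne hz' _ (hmem θ hθ)
        have := (((γ.hasDerivAt θ).sub_const z).div ((γ.hasDerivAt θ).sub_const z') h0').clog_real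
          (h _ (hmem θ hθ))
        refine HasDerivAt.congr_deriv this ?_
        change _ / ((γ.toFun θ - z) / (γ.toFun θ - z')) = _
        field_simp
      rw [intervalIntegral.integral_eq_sub_of_hasDerivAt hd, γ.closed, sub_self]
      refine ContinuousOn.intervalIntegrable ?_
      rw [uIcc_of_le two_pi_nonneg]
      exact γ.continuous_deriv.continuousOn.mul
        (((hcont hz).sub (hcont hz')).comp γ.continuous.continuousOn hmem)
  exact key Γ subset_rfl

/-- Outside a disc that contains the contour the winding number vanishes. -/
theorem integral_inv_sub_eq_zero {Γ : Contour} {z : ℂ} {R : ℝ} (hΓ : ∀ w ∈ trace Γ, ‖w‖ < R)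
    (hz : R ≤ ‖z‖) : (Γ.integral fun w => (w - z)⁻¹) = 0 := by
  have hne : ∀ w ∈ trace Γ, w - z ≠ 0 := fun w hw h0 => by
    have := hΓ w hw
    rw [sub_eq_zero.1 h0] at this
    linarith
  have key : ∀ Γ' : Contour, trace Γ' ⊆ trace Γ → (Γ'.integral fun w => (w - z)⁻¹) = 0 := by
    intro Γ'
    induction Γ' with
    | nil => simp
    | cons γ Γ' ih =>
      intro hΓ'
      rw [trace_cons] at hΓ'
      rw [integral_cons, ih (subset_union_right.trans hΓ'), add_zero]
      have hmem : ∀ θ ∈ Icc 0 (2 * Real.pi), γ.toFun θ ∈ trace Γ := fun θ hθ =>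
        hΓ' (Or.inl (mem_image_of_mem _ hθ))
      have hd : ∀ θ ∈ uIcc 0 (2 * Real.pi), HasDerivAt
          (fun θ => Complex.log ((γ.toFun θ - z) / (-z)))
          (deriv γ.toFun θ * (γ.toFun θ - z)⁻¹) θ := by
        intro θ hθ
        rw [uIcc_of_le two_pi_nonneg] at hθ
        have h0 := hne _ (hmem θ hθ)
        have hR := hΓ _ (hmem θ hθ)
        have hz0 : z ≠ 0 := norm_pos_iff.1 (by linarith [norm_nonneg (γ.toFun θ)])
        -- `(w - z) / (-z) = 1 - w / z` is at distance less than one from `1`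
        have hsl : (γ.toFun θ - z) / (-z) ∈ Complex.slitPlane := by
          have : (γ.toFun θ - z) / (-z) = 1 + -(γ.toFun θ / z) := by
            field_simp
            ring
          rw [this]
          apply Complex.mem_slitPlane_of_norm_lt_one
          rw [norm_neg, norm_div, div_lt_one (norm_pos_iff.2 hz0)]
          linarith
        have := (((γ.hasDerivAt θ).sub_const z).div_const (-z)).clog_real hsl
        convert this using 1
        field_simp
      rw [intervalIntegral.integral_eq_sub_of_hasDerivAt hd, γ.closed, sub_self]
      refine ContinuousOn.intervalIntegrable ?_
      rw [uIcc_of_le two_pi_nonneg]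
      exact γ.continuous_deriv.continuousOn.mul ((ContinuousOn.inv₀ (f := fun w => w - z)
        (by fun_prop) hne).comp γ.continuous.continuousOn hmem)
  exact key Γ subset_rfl

end Contour

end Contours

/-! ### Cauchy's theorem for homologous contours -/

section CauchyTheorem

open Filter Topology Metric Set

/-- The divided difference of a holomorphic function is jointly continuous. -/
theorem continuousOn_uncurry_dslope {f : ℂ → ℂ} {Ω : Set ℂ} (hΩ : IsOpen Ω)
    (hf : DifferentiableOn ℂ f Ω) :
    ContinuousOn (fun x : ℂ × ℂ => dslope f x.1 x.2) (Ω ×ˢ Ω) := by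
  rintro ⟨a, b⟩ ⟨ha, hb⟩
  apply ContinuousAt.continuousWithinAt
  simp only at ha hb
  by_cases hab : b = a
  · subst hab
    have hs : HasStrictDerivAt f (deriv f b) b :=
      (hf.analyticAt (hΩ.mem_nhds hb)).hasStrictDerivAt
    have hd : ContinuousAt (deriv f) b := (hf.analyticAt (hΩ.mem_nhds hb)).deriv.continuousAt
    rw [ContinuousAt, dslope_same, Metric.tendsto_nhds]
    intro ε hε
    have h1 := (hasStrictFDerivAt_iff_isLittleO.1 hs.hasStrictFDerivAt).def (half_pos hε)
    have h2 : ∀ᶠ x : ℂ × ℂ in 𝓝 (b, b), dist (deriv f x.1) (deriv f b) < ε :=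
      (continuous_fst.tendsto (b, b)).eventually (Metric.tendsto_nhds.1 hd ε hε)
    filter_upwards [h1, h2] with x hx1 hx2
    by_cases hx : x.2 = x.1
    · rw [hx, dslope_same]
      exact hx2
    · have hx' : x.1 - x.2 ≠ 0 := sub_ne_zero.2 (Ne.symm hx)
      rw [dslope_of_ne _ hx, slope_comm, slope_def_field, dist_eq_norm]
      have e : (f x.1 - f x.2) / (x.1 - x.2) - deriv f b =
          (f x.1 - f x.2 - deriv f b * (x.1 - x.2)) / (x.1 - x.2) := by
        field_simp
      rw [e, norm_div, div_lt_iff₀ (norm_pos_iff.2 hx')]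
      have : ‖f x.1 - f x.2 - deriv f b * (x.1 - x.2)‖ ≤ ε / 2 * ‖x.1 - x.2‖ := by
        simpa [mul_comm] using hx1
      have := mul_pos hε (norm_pos_iff.2 hx')
      linarith
  · have hne : ∀ᶠ x : ℂ × ℂ in 𝓝 (a, b), x.2 ≠ x.1 :=
      (isOpen_ne_fun continuous_snd continuous_fst).mem_nhds hab
    have hc : ContinuousAt (fun x : ℂ × ℂ => (f x.2 - f x.1) / (x.2 - x.1)) (a, b) := by
      have ha' : ContinuousAt f (a, b).1 := (hf.differentiableAt (hΩ.mem_nhds ha)).continuousAt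
      have hb' : ContinuousAt f (a, b).2 := (hf.differentiableAt (hΩ.mem_nhds hb)).continuousAt
      have h1 : ContinuousAt (fun x : ℂ × ℂ => f x.1) (a, b) := ha'.comp continuousAt_fst
      have h2 : ContinuousAt (fun x : ℂ × ℂ => f x.2) (a, b) := hb'.comp continuousAt_snd
      exact (h2.sub h1).div (by fun_prop) (sub_ne_zero.2 hab)
    refine hc.congr (hne.mono fun x hx => ?_)
    simp only [dslope_of_ne _ hx, slope_def_field]

namespace Contour

theorem continuousOn_inv_sub {T : Set ℂ} {z : ℂ} (hz : z ∉ T) :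
    ContinuousOn (fun w => (w - z)⁻¹) T :=
  ContinuousOn.inv₀ (by fun_prop) fun w hw h0 => hz (sub_eq_zero.1 h0 ▸ hw)

theorem winding_eq_iff {Γ Γ' : Contour} {a : ℂ} : Γ.winding a = Γ'.winding a ↔
    (Γ.integral fun w => (w - a)⁻¹) = Γ'.integral fun w => (w - a)⁻¹ := by
  rw [winding, winding, mul_right_inj' (inv_ne_zero Complex.two_pi_I_ne_zero)]

/-- Winding numbers are locally constant. -/
theorem eventually_integral_inv_sub_eq {Γ : Contour} {z : ℂ} (hz : z ∉ trace Γ) :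
    ∀ᶠ z' in 𝓝 z, (Γ.integral fun w => (w - z')⁻¹) = Γ.integral fun w => (w - z)⁻¹ := by
  obtain ⟨r, hr, hrs⟩ := Metric.nhds_basis_ball.mem_iff.1
    (Γ.isCompact_trace.isClosed.isOpen_compl.mem_nhds hz)
  filter_upwards [ball_mem_nhds z hr] with z' hz'
  refine integral_inv_sub_eq (hrs hz') hz fun w hw => ?_
  have hwz : r ≤ ‖w - z‖ := by
    by_contra h
    exact hrs (by simpa [dist_eq_norm] using h) hw
  have h0 : w - z ≠ 0 := norm_pos_iff.1 (hr.trans_le hwz)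
  have : (w - z') / (w - z) = 1 + (z - z') / (w - z) := by
    field_simp
    ring
  rw [this]
  apply Complex.mem_slitPlane_of_norm_lt_one
  rw [norm_div, div_lt_one (norm_pos_iff.2 h0), norm_sub_rev]
  rw [mem_ball, dist_eq_norm] at hz'
  linarith

theorem integral_of_trace_eq_empty {Γ : Contour} (h : trace Γ = ∅) (f : ℂ → ℂ) :
    Γ.integral f = 0 := by
  have := integral_congr (Γ := Γ) (f := f) (g := fun z => 0 * f z) (by simp [h])
  rw [this, integral_const_mul, zero_mul]

/-- The key step of Dixon's proof of Cauchy's theorem: the integral of the divided difference of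
`f` extends to an entire function that tends to zero at infinity, hence vanishes. -/
theorem integral_dslope_eq {Γ Γ' : Contour} {Ω : Set ℂ} {f : ℂ → ℂ} (hΩ : IsOpen Ω)
    (hf : DifferentiableOn ℂ f Ω) (hΓ : trace Γ ⊆ Ω) (hΓ' : trace Γ' ⊆ Ω)
    (h : ∀ a ∉ Ω, Γ.winding a = Γ'.winding a) {z : ℂ} (hz : z ∈ Ω) :
    (Γ.integral fun w => dslope f w z) = Γ'.integral fun w => dslope f w z := by
  classical
  let L : (ℂ → ℂ) → ℂ := fun g => Γ.integral g - Γ'.integral g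
  let T := trace Γ ∪ trace Γ'
  have hT : IsCompact T := Γ.isCompact_trace.union Γ'.isCompact_trace
  have hTΩ : T ⊆ Ω := union_subset hΓ hΓ'
  have hfT : ContinuousOn f T := hf.continuousOn.mono hTΩ
  -- on `V`, which together with `Ω` covers the plane, the integral of the divided difference is a
  -- Cauchy integral of `f`, since the winding numbers of both contours agree there
  let V : Set ℂ := {z | z ∉ T ∧ L (fun w => (w - z)⁻¹) = 0}
  have hVopen : IsOpen V := by
    rw [isOpen_iff_mem_nhds]
    rintro z ⟨hz, h0⟩
    have h1 := eventually_integral_inv_sub_eq (Γ := Γ) (z := z) fun hh => hz (Or.inl hh)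
    have h2 := eventually_integral_inv_sub_eq (Γ := Γ') (z := z) fun hh => hz (Or.inr hh)
    filter_upwards [h1, h2, hT.isClosed.isOpen_compl.mem_nhds hz] with z' h1 h2 h3
    exact ⟨h3, by rw [← h0]; simp only [L]; rw [h1, h2]⟩
  have hcover : ∀ z, z ∉ Ω → z ∈ V := fun z hz =>
    ⟨fun hh => hz (hTΩ hh), sub_eq_zero.2 (winding_eq_iff.1 (h z hz))⟩
  let φ : ℂ → ℂ := fun z => if z ∈ Ω then L (fun w => dslope f w z)
    else L (fun w => f w * (w - z)⁻¹)
  have hLsub : ∀ g₁ g₂ : ℂ → ℂ, ContinuousOn g₁ T → ContinuousOn g₂ T →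
      L (fun w => g₁ w - g₂ w) = L g₁ - L g₂ := fun g₁ g₂ h₁ h₂ => by
    simp only [L]
    rw [integral_sub (h₁.mono subset_union_left) (h₂.mono subset_union_left),
      integral_sub (h₁.mono subset_union_right) (h₂.mono subset_union_right)]
    ring
  have hLmul : ∀ (c : ℂ) (g : ℂ → ℂ), L (fun w => c * g w) = c * L g := fun c g => by
    simp only [L, integral_const_mul]
    ring
  have hφV : ∀ z ∈ V, φ z = L (fun w => f w * (w - z)⁻¹) := by
    rintro z ⟨hzT, hz0⟩
    by_cases hzΩ : z ∈ Ω
    · have e : EqOn (fun w => dslope f w z)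
          (fun w => f w * (w - z)⁻¹ - f z * (w - z)⁻¹) T := fun w hw => by
        have hne : z ≠ w := fun e => hzT (e ▸ hw)
        have : w - z ≠ 0 := sub_ne_zero.2 hne.symm
        have : z - w ≠ 0 := sub_ne_zero.2 hne
        simp only
        rw [dslope_of_ne _ hne, slope_comm, slope_def_field]
        field_simp
      have : φ z = L (fun w => f w * (w - z)⁻¹ - f z * (w - z)⁻¹) := by
        simp only [φ, if_pos hzΩ, L]
        rw [integral_congr (e.mono subset_union_left), integral_congr (e.mono subset_union_right)]
      rw [this, hLsub (fun w => f w * (w - z)⁻¹) (fun w => f z * (w - z)⁻¹)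
        (hfT.mul (continuousOn_inv_sub hzT)) (continuousOn_const.mul (continuousOn_inv_sub hzT)),
        hLmul, hz0]
      ring
    · simp only [φ, if_neg hzΩ]
  have hφdiff : Differentiable ℂ φ := by
    intro z
    by_cases hzΩ : z ∈ Ω
    · have hd : ∀ Γ₀ : Contour, trace Γ₀ ⊆ Ω →
          DifferentiableOn ℂ (fun z => Γ₀.integral fun w => dslope f w z) Ω := fun Γ₀ h₀ => by
        refine differentiableOn_integral Γ₀ hΩ (f := fun z w => dslope f w z) ?_ fun w hw => ?_
        · exact (continuousOn_uncurry_dslope hΩ hf).comp (f := fun x : ℂ × ℂ => (x.2, x.1))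
            (by fun_prop) fun x hx => ⟨h₀ hx.2, hx.1⟩
        · exact (Complex.differentiableOn_dslope (hΩ.mem_nhds (h₀ hw))).2 hf
      have : DifferentiableAt ℂ (fun z => L fun w => dslope f w z) z :=
        ((hd Γ hΓ).sub (hd Γ' hΓ')).differentiableAt (hΩ.mem_nhds hzΩ)
      refine this.congr_of_eventuallyEq ?_
      filter_upwards [hΩ.mem_nhds hzΩ] with z' hz'
      simp only [φ, if_pos hz']
    · have hzV := hcover z hzΩ
      have hd : ∀ Γ₀ : Contour, trace Γ₀ ⊆ T →
          DifferentiableOn ℂ (fun z => Γ₀.integral fun w => f w * (w - z)⁻¹) V := fun Γ₀ h₀ => by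
        have hne : ∀ z ∈ V, ∀ w ∈ trace Γ₀, w - z ≠ 0 := fun z hz w hw h0 =>
          hz.1 (sub_eq_zero.1 h0 ▸ h₀ hw)
        refine differentiableOn_integral Γ₀ hVopen (f := fun z w => f w * (w - z)⁻¹) ?_
          fun w hw => ?_
        · refine ContinuousOn.mul ?_ (ContinuousOn.inv₀ (by fun_prop) fun x hx => hne _ hx.1 _ hx.2)
          exact hfT.comp (by fun_prop) fun x hx => h₀ hx.2
        · exact (DifferentiableOn.inv (by fun_prop) fun z hz => hne z hz w hw).const_mul _
      have : DifferentiableAt ℂ (fun z => L fun w => f w * (w - z)⁻¹) z :=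
        ((hd Γ subset_union_left).sub (hd Γ' subset_union_right)).differentiableAt
          (hVopen.mem_nhds hzV)
      exact this.congr_of_eventuallyEq (eventually_of_mem (hVopen.mem_nhds hzV) hφV)
  have hφlim : Tendsto φ (cocompact ℂ) (𝓝 0) := by
    obtain ⟨R, hR⟩ := hT.isBounded.exists_norm_le
    obtain ⟨M, hM⟩ := hT.exists_bound_of_continuousOn hfT
    obtain ⟨C, hC, hCΓ⟩ := Γ.exists_norm_integral_le
    obtain ⟨C', hC', hCΓ'⟩ := Γ'.exists_norm_integral_le
    rw [Metric.tendsto_nhds]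
    intro ε hε
    have hbig : ∀ᶠ z : ℂ in cocompact ℂ, max (R + 1) (R + (C + C' + 1) * (|M| + 1) / ε) < ‖z‖ :=
      (tendsto_norm_cocompact_atTop (E := ℂ)).eventually_gt_atTop _
    filter_upwards [hbig] with z hz
    have hz1 : R + 1 < ‖z‖ := (le_max_left _ _).trans_lt hz
    have hz2 : R + (C + C' + 1) * (|M| + 1) / ε < ‖z‖ := (le_max_right _ _).trans_lt hz
    have hzT : z ∉ T := fun hh => by linarith [hR z hh]
    have hwlt : ∀ w ∈ T, ‖w‖ < R + 1 := fun w hw => by linarith [hR w hw]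
    have hzV : z ∈ V := ⟨hzT, by
      simp only [L]
      rw [integral_inv_sub_eq_zero (fun w hw => hwlt w (Or.inl hw)) hz1.le,
        integral_inv_sub_eq_zero (fun w hw => hwlt w (Or.inr hw)) hz1.le, sub_zero]⟩
    rw [hφV z hzV, dist_zero_right]
    have hd : 0 < ‖z‖ - R := by linarith
    have hb : ∀ w ∈ T, ‖f w * (w - z)⁻¹‖ ≤ |M| / (‖z‖ - R) := fun w hw => by
      rw [norm_mul, norm_inv, ← div_eq_mul_inv]
      have h1 : ‖z‖ - R ≤ ‖w - z‖ := by
        have := norm_sub_norm_le z w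
        rw [norm_sub_rev]
        linarith [hR w hw]
      exact div_le_div₀ (abs_nonneg _) ((hM w hw).trans (le_abs_self _)) hd h1
    have h1 := hCΓ _ _ fun w hw => hb w (Or.inl hw)
    have h2 := hCΓ' _ _ fun w hw => hb w (Or.inr hw)
    refine (norm_sub_le _ _).trans_lt ((add_le_add h1 h2).trans_lt ?_)
    rw [← add_mul, mul_div_assoc', div_lt_iff₀ hd]
    have : (C + C' + 1) * (|M| + 1) < ε * (‖z‖ - R) := by
      have : (C + C' + 1) * (|M| + 1) / ε < ‖z‖ - R := by linarith
      rwa [div_lt_iff₀ hε, mul_comm (‖z‖ - R)] at this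
    nlinarith [abs_nonneg M]
  have h0 : φ z = 0 := hφdiff.apply_eq_of_tendsto_cocompact z hφlim
  simp only [φ, if_pos hz] at h0
  exact sub_eq_zero.1 h0

/-- **Cauchy's theorem**, homology version. -/
theorem integral_eq_of_winding_eq {Γ Γ' : Contour} {Ω : Set ℂ} {f : ℂ → ℂ} (hΩ : IsOpen Ω)
    (hf : DifferentiableOn ℂ f Ω) (hΓ : trace Γ ⊆ Ω) (hΓ' : trace Γ' ⊆ Ω)
    (h : ∀ a ∉ Ω, Γ.winding a = Γ'.winding a) : Γ.integral f = Γ'.integral f := by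
  have hT : IsCompact (trace Γ ∪ trace Γ') := Γ.isCompact_trace.union Γ'.isCompact_trace
  by_cases hex : ∃ z ∈ Ω, z ∉ trace Γ ∪ trace Γ'
  · obtain ⟨z, hzΩ, hzT⟩ := hex
    -- the divided difference of `w ↦ (w - z) * f w` with respect to `z` is `f`
    have := integral_dslope_eq (f := fun w => (w - z) * f w) hΩ (by fun_prop) hΓ hΓ' h hzΩ
    have e : ∀ w ∈ trace Γ ∪ trace Γ', dslope (fun w => (w - z) * f w) w z = f w := by
      intro w hw
      have hne : z ≠ w := fun e => hzT (e ▸ hw)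
      have : z - w ≠ 0 := sub_ne_zero.2 hne
      rw [dslope_of_ne _ hne, slope_def_field]
      field_simp
      ring
    rwa [integral_congr fun w hw => e w (Or.inl hw),
      integral_congr fun w hw => e w (Or.inr hw)] at this
  · -- otherwise `Ω` is both open and compact, hence empty
    push Not at hex
    have hΩT : Ω = trace Γ ∪ trace Γ' := Subset.antisymm hex (union_subset hΓ hΓ')
    have hcl : IsClopen Ω := ⟨hΩT ▸ hT.isClosed, hΩ⟩
    rcases isClopen_iff.1 hcl with h0 | h0
    · rw [h0] at hΓ hΓ'
      rw [integral_of_trace_eq_empty (subset_empty_iff.1 hΓ),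
        integral_of_trace_eq_empty (subset_empty_iff.1 hΓ')]
    · rw [← hΩT, h0] at hT
      exact absurd hT (noncompact_univ ℂ)

end Contour

end CauchyTheorem

/-! ### Circles and the existence of separating contours -/

section SeparatingContours

open Filter Topology Metric Set

namespace ClosedCurve

/-- The circle with centre `c` and radius `r`, run through once in the positive direction. -/
noncomputable def circle (c : ℂ) (r : ℝ) : ClosedCurve where
  toFun := circleMap c r
  contDiff := contDiff_circleMap c r
  closed := by simp [circleMap]

/-- A closed curve run through in the opposite direction. -/
noncomputable def reverse (γ : ClosedCurve) : ClosedCurve where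
  toFun θ := γ.toFun (2 * Real.pi - θ)
  contDiff := γ.contDiff.comp (by fun_prop)
  closed := by simp [γ.closed]

end ClosedCurve

namespace Contour

theorem trace_circle {c : ℂ} {r : ℝ} (hr : 0 ≤ r) :
    trace [ClosedCurve.circle c r] = sphere c r := by
  ext x
  rw [trace_cons, trace_nil, union_empty]
  constructor
  · rintro ⟨θ, -, rfl⟩
    exact circleMap_mem_sphere c hr θ
  · intro hx
    rw [← abs_of_nonneg hr, ← image_circleMap_Ioc c r] at hx
    obtain ⟨θ, hθ, rfl⟩ := hx
    exact ⟨θ, Ioc_subset_Icc_self hθ, rfl⟩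

theorem integral_circle (c : ℂ) (r : ℝ) (f : ℂ → ℂ) :
    integral [ClosedCurve.circle c r] f = ∮ z in C(c, r), f z := by
  simp [integral, circleIntegral, ClosedCurve.circle]

theorem integral_reverse (γ : ClosedCurve) (f : ℂ → ℂ) :
    integral [γ.reverse] f = -integral [γ] f := by
  have hd : ∀ θ, deriv γ.reverse.toFun θ = -deriv γ.toFun (2 * Real.pi - θ) := fun θ =>
    deriv_comp_const_sub _ _ _
  simp only [integral, List.map_cons, List.map_nil, List.sum_cons, List.sum_nil, add_zero, hd]
  have := intervalIntegral.integral_comp_sub_left (a := 0) (b := 2 * Real.pi)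
    (fun θ => deriv γ.toFun θ * f (γ.toFun θ)) (2 * Real.pi)
  rw [sub_self, sub_zero] at this
  rw [← this, ← intervalIntegral.integral_neg]
  refine intervalIntegral.integral_congr fun θ _ => ?_
  simp [ClosedCurve.reverse]

theorem trace_reverse (γ : ClosedCurve) : trace [γ.reverse] ⊆ trace [γ] := by
  rintro x ⟨γ', hγ', θ, hθ, rfl⟩
  simp only [List.mem_singleton] at hγ'
  subst hγ'
  exact ⟨γ, by simp, 2 * Real.pi - θ, ⟨by linarith [hθ.2], by linarith [hθ.1]⟩, rfl⟩

theorem winding_circle_of_lt {a c : ℂ} {r : ℝ} (h : ‖a - c‖ < r) :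
    winding [ClosedCurve.circle c r] a = 1 := by
  rw [winding, integral_circle, circleIntegral.integral_sub_inv_of_mem_ball
    (by rwa [mem_ball, dist_eq_norm]), inv_mul_cancel₀ Complex.two_pi_I_ne_zero]

theorem winding_circle_of_gt {a c : ℂ} {r : ℝ} (hr : 0 ≤ r) (h : r < ‖a - c‖) :
    winding [ClosedCurve.circle c r] a = 0 := by
  have hne : ∀ z ∈ closedBall c r, z - a ≠ 0 := fun z hz h0 => by
    rw [mem_closedBall, dist_eq_norm, sub_eq_zero.1 h0] at hz
    linarith
  rw [winding, integral_circle, Complex.circleIntegral_eq_zero_of_differentiable_on_off_countable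
    hr countable_empty, mul_zero]
  · exact ContinuousOn.inv₀ (by fun_prop) hne
  · intro z hz
    exact DifferentiableAt.inv (by fun_prop) (hne z (ball_subset_closedBall hz.1))

theorem trace_map {ι : Type*} (l : List ι) (g : ι → ClosedCurve) :
    trace (l.map g) = ⋃ i ∈ l, trace [g i] := by
  ext x
  simp [trace]

theorem integral_map {ι : Type*} (l : List ι) (g : ι → ClosedCurve) (f : ℂ → ℂ) :
    integral (l.map g) f = (l.map fun i => integral [g i] f).sum := by
  simp [integral, Function.comp_def]

theorem winding_append (Γ Γ' : Contour) (a : ℂ) :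
    winding (Γ ++ Γ') a = winding Γ a + winding Γ' a := by
  rw [winding, winding, winding, integral_append, mul_add]

theorem winding_map {ι : Type*} (l : List ι) (g : ι → ClosedCurve) (a : ℂ) :
    winding (l.map g) a = (l.map fun i => winding [g i] a).sum := by
  simp only [winding, integral_map, List.sum_map_mul_left]

theorem winding_reverse (γ : ClosedCurve) (a : ℂ) :
    winding [γ.reverse] a = -winding [γ] a := by
  rw [winding, winding, integral_reverse, mul_neg]

/-- A separating contour exists as soon as no point of `A` is the reciprocal of another one: take
a circle around the origin, add small circles around the points of `A` outside of it, and subtract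
small circles around the reciprocals inside of it. -/
theorem exists_separates {A : Set ℂ} {R : ℝ} (hR : 1 < R) (h0 : 0 ∉ A) (hA : ∀ x ∈ A, ‖x‖ < R)
    (hfin : ∀ ρ > 0, {x ∈ A | ρ ≤ ‖x‖}.Finite) (hmul : ∀ x ∈ A, ∀ y ∈ A, x * y ≠ 1) :
    ∃ Γ : Contour, Γ.Separates A ∧ Γ.trace ⊆ {ζ | R⁻¹ < ‖ζ‖ ∧ ‖ζ‖ < R} := by
  classical
  have hR0 : 0 < R := by linarith
  have hRi : 0 < R⁻¹ := inv_pos.2 hR0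
  have hne : ∀ x ∈ A, x ≠ 0 := fun x hx e => h0 (e ▸ hx)
  have hAi : ∀ x, x⁻¹ ∈ A → R⁻¹ < ‖x‖ := fun x hx => by
    have h1 := hA _ hx
    have hx0 : x ≠ 0 := fun e => hne _ hx (by rw [e, inv_zero])
    rw [norm_inv] at h1
    exact (inv_lt_comm₀ (norm_pos_iff.2 hx0) hR0).1 h1
  -- the points that the contour has to deal with individually
  let F : Set ℂ := {x | (x ∈ A ∨ x⁻¹ ∈ A) ∧ R⁻¹ ≤ ‖x‖ ∧ ‖x‖ ≤ R}
  have hF : F.Finite := by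
    refine ((hfin _ hRi).union ((hfin _ hRi).image fun x => x⁻¹)).subset ?_
    rintro x ⟨hx | hx, h1, h2⟩
    · exact Or.inl ⟨hx, h1⟩
    · refine Or.inr ⟨x⁻¹, ⟨hx, ?_⟩, inv_inv x⟩
      rw [norm_inv]
      exact inv_anti₀ (by linarith) h2
  obtain ⟨ρ, ⟨hρ1, hρ2⟩, hρF⟩ : ∃ ρ, ρ ∈ Ioo R⁻¹ R ∧ ρ ∉ norm '' F := by
    have : R⁻¹ < R := (inv_lt_one_of_one_lt₀ hR).trans hR
    obtain ⟨ρ, h1, h2⟩ := ((Ioo_infinite this).sdiff (hF.image norm)).nonempty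
    exact ⟨ρ, h1, h2⟩
  have hρ0 : 0 < ρ := hRi.trans hρ1
  obtain ⟨ε, hε0, hε1, hε2, hε3⟩ : ∃ ε > 0, (∀ x ∈ F, ‖x‖ < R → ε < R - ‖x‖) ∧
      (∀ x ∈ F, R⁻¹ < ‖x‖ → ε < ‖x‖ - R⁻¹) ∧ ∀ x ∈ F, ∀ y ∈ F, y ≠ x → ε < ‖y - x‖ := by
    have small : ∀ c : ℝ, 0 < c → ∀ᶠ ε in 𝓝[>] (0 : ℝ), ε < c := fun c hc =>
      nhdsWithin_le_nhds (Iio_mem_nhds hc)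
    have e1 : ∀ᶠ ε in 𝓝[>] (0 : ℝ), ∀ x ∈ F, ‖x‖ < R → ε < R - ‖x‖ :=
      (eventually_all_finite hF).2 fun x _ => by
        by_cases h : ‖x‖ < R
        · filter_upwards [small _ (sub_pos.2 h)] with ε hε _ using hε
        · exact Eventually.of_forall fun ε hh => absurd hh h
    have e2 : ∀ᶠ ε in 𝓝[>] (0 : ℝ), ∀ x ∈ F, R⁻¹ < ‖x‖ → ε < ‖x‖ - R⁻¹ :=
      (eventually_all_finite hF).2 fun x _ => by
        by_cases h : R⁻¹ < ‖x‖
        · filter_upwards [small _ (sub_pos.2 h)] with ε hε _ using hε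
        · exact Eventually.of_forall fun ε hh => absurd hh h
    have e3 : ∀ᶠ ε in 𝓝[>] (0 : ℝ), ∀ x ∈ F, ∀ y ∈ F, y ≠ x → ε < ‖y - x‖ :=
      (eventually_all_finite hF).2 fun x _ => (eventually_all_finite hF).2 fun y _ => by
        by_cases h : y = x
        · exact Eventually.of_forall fun ε hh => absurd h hh
        · filter_upwards [small _ (norm_pos_iff.2 (sub_ne_zero.2 h))] with ε hε _ using hε
    obtain ⟨ε, h1, h2, h3, h4⟩ := (e1.and (e2.and (e3.and self_mem_nhdsWithin))).exists
    exact ⟨ε, h4, h1, h2, h3⟩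
  have hS1 : {x ∈ A | ρ < ‖x‖}.Finite := (hfin ρ hρ0).subset fun x hx => ⟨hx.1, hx.2.le⟩
  have hS2 : {x | x⁻¹ ∈ A ∧ ‖x‖ < ρ}.Finite := hF.subset fun x hx =>
    ⟨Or.inr hx.1, (hAi x hx.1).le, by linarith [hx.2]⟩
  let S1 := hS1.toFinset
  let S2 := hS2.toFinset
  have mS1 : ∀ x, x ∈ S1 ↔ x ∈ A ∧ ρ < ‖x‖ := fun x => by simp [S1]
  have mS2 : ∀ x, x ∈ S2 ↔ x⁻¹ ∈ A ∧ ‖x‖ < ρ := fun x => by simp [S2]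
  have hSF : ∀ x, x ∈ S1 ∨ x ∈ S2 → x ∈ F ∧ R⁻¹ < ‖x‖ ∧ ‖x‖ < R := by
    rintro x (hx | hx)
    · obtain ⟨h1, h2⟩ := (mS1 x).1 hx
      exact ⟨⟨Or.inl h1, by linarith, (hA x h1).le⟩, by linarith, hA x h1⟩
    · obtain ⟨h1, h2⟩ := (mS2 x).1 hx
      exact ⟨⟨Or.inr h1, (hAi x h1).le, by linarith⟩, hAi x h1, by linarith⟩
  -- the closed discs of radius `ε` stay in the annulus
  have hann : ∀ x, x ∈ S1 ∨ x ∈ S2 → ∀ b, ‖b - x‖ ≤ ε → R⁻¹ < ‖b‖ ∧ ‖b‖ < R := by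
    intro x hx b hb
    obtain ⟨hxF, h1, h2⟩ := hSF x hx
    have := hε1 x hxF h2
    have := hε2 x hxF h1
    have := norm_sub_norm_le x b
    have := norm_sub_norm_le b x
    rw [norm_sub_rev] at hb
    constructor <;> linarith [norm_sub_rev x b]
  have hsep : ∀ b, (b = 0 ∨ b ∈ A ∨ b⁻¹ ∈ A) → ‖b‖ ≠ ρ ∧
      ∀ x, x ∈ S1 ∨ x ∈ S2 → b ≠ x → ε < ‖b - x‖ := by
    intro b hb
    have hbF : R⁻¹ ≤ ‖b‖ → ‖b‖ ≤ R → b ∈ F := fun h1 h2 => by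
      rcases hb with rfl | hb
      · rw [norm_zero] at h1
        linarith
      · exact ⟨hb, h1, h2⟩
    refine ⟨fun h => hρF ⟨b, hbF (by linarith) (by linarith), h⟩, fun x hx hbx => ?_⟩
    by_contra hlt
    have h1 := hann x hx b (not_lt.1 hlt)
    exact hlt (hε3 x (hSF x hx).1 b (hbF h1.1.le h1.2.le) hbx)
  -- `S1` are the points of `A` outside of the circle of radius `ρ`, `S2` the reciprocals inside
  let Γ : Contour := [ClosedCurve.circle 0 ρ] ++
    (S1.toList.map (fun x => ClosedCurve.circle x ε) ++
      S2.toList.map fun x => (ClosedCurve.circle x ε).reverse)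
  have htr : ∀ b ∈ Γ.trace, ‖b‖ = ρ ∨ ∃ x, (x ∈ S1 ∨ x ∈ S2) ∧ ‖b - x‖ = ε := by
    intro b hb
    rw [trace_append, trace_append, trace_circle hρ0.le, trace_map, trace_map] at hb
    simp only [Finset.mem_toList, trace_circle hε0.le, mem_union, mem_iUnion, exists_prop] at hb
    rcases hb with hb | ⟨x, hx, hb⟩ | ⟨x, hx, hb⟩
    · exact Or.inl (by simpa using hb)
    · exact Or.inr ⟨x, Or.inl hx, by simpa [dist_eq_norm] using hb⟩
    · have := trace_reverse _ hb
      rw [trace_circle hε0.le] at this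
      exact Or.inr ⟨x, Or.inr hx, by simpa [dist_eq_norm] using this⟩
  have hnot : ∀ b, (b = 0 ∨ b ∈ A ∨ b⁻¹ ∈ A) → b ∉ Γ.trace := by
    intro b hb hbΓ
    obtain ⟨h1, h2⟩ := hsep b hb
    rcases htr b hbΓ with h | ⟨x, hx, h⟩
    · exact h1 h
    · by_cases hbx : b = x
      · rw [hbx, sub_self, norm_zero] at h
        exact hε0.ne h
      · exact (h2 x hx hbx).ne' h
  have hwind : ∀ b, (b = 0 ∨ b ∈ A ∨ b⁻¹ ∈ A) → Γ.winding b =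
      (if ‖b‖ < ρ then 1 else 0) + ((if b ∈ S1 then 1 else 0) - if b ∈ S2 then 1 else 0) := by
    intro b hb
    obtain ⟨h1, h2⟩ := hsep b hb
    have e0 : winding [ClosedCurve.circle 0 ρ] b = if ‖b‖ < ρ then 1 else 0 := by
      split_ifs with h
      · exact winding_circle_of_lt (by simpa using h)
      · exact winding_circle_of_gt hρ0.le (by
          rw [sub_zero]
          exact lt_of_le_of_ne (not_lt.1 h) h1.symm)
    have e1 : ∀ x, x ∈ S1 ∨ x ∈ S2 →
        winding [ClosedCurve.circle x ε] b = if b = x then 1 else 0 := by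
      intro x hx
      split_ifs with h
      · exact winding_circle_of_lt (by simpa [h] using hε0)
      · exact winding_circle_of_gt hε0.le (h2 x hx h)
    rw [winding_append, winding_append, e0, winding_map, winding_map, Finset.sum_map_toList,
      Finset.sum_map_toList, Finset.sum_congr rfl fun x hx => e1 x (Or.inl hx),
      Finset.sum_congr rfl fun x hx => (winding_reverse _ _).trans
        (congrArg _ (e1 x (Or.inr hx))), Finset.sum_ite_eq, Finset.sum_neg_distrib,
      Finset.sum_ite_eq, ← sub_eq_add_neg]
  have hdisj : ∀ x, x ∈ A → x⁻¹ ∉ A := fun x hx hx' =>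
    hmul x hx _ hx' (mul_inv_cancel₀ (hne x hx))
  refine ⟨Γ, ⟨⟨hnot 0 (Or.inl rfl), ?_⟩, fun a ha => ⟨⟨hnot a (Or.inr (Or.inl ha)), ?_⟩,
    hnot _ (Or.inr (Or.inr ((inv_inv a).symm ▸ ha))), ?_⟩⟩, fun b hb => ?_⟩
  · rw [hwind 0 (Or.inl rfl), if_pos (by simpa using hρ0), if_neg, if_neg]
    · simp
    · rw [mS2, inv_zero]
      exact fun h => h0 h.1
    · rw [mS1]
      exact fun h => h0 h.1
  · rw [hwind a (Or.inr (Or.inl ha)), if_neg (c := a ∈ S2) fun h => hdisj a ha ((mS2 a).1 h).1]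
    rcases lt_or_gt_of_ne (hsep a (Or.inr (Or.inl ha))).1 with h | h
    · rw [if_pos h, if_neg fun h' => absurd ((mS1 a).1 h').2 (by linarith)]
      simp
    · rw [if_neg (by linarith), if_pos ((mS1 a).2 ⟨ha, h⟩)]
      simp
  · have ha' : (a⁻¹)⁻¹ ∈ A := (inv_inv a).symm ▸ ha
    rw [hwind _ (Or.inr (Or.inr ha')), if_neg (c := a⁻¹ ∈ S1) fun h =>
      hdisj a ha ((mS1 _).1 h).1]
    rcases lt_or_gt_of_ne (hsep _ (Or.inr (Or.inr ha'))).1 with h | h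
    · rw [if_pos h, if_pos ((mS2 _).2 ⟨ha', h⟩)]
      simp
    · rw [if_neg (by linarith), if_neg fun h' => absurd ((mS2 _).1 h').2 (by linarith)]
      simp
  · rcases htr b hb with h | ⟨x, hx, h⟩
    · exact ⟨by linarith, by linarith⟩
    · exact hann x hx b h.le

end Contour

end SeparatingContours

/-! ### Ideals generated by products of binomials -/

section Bezout

open Finset

variable {B : Type*} [CommRing B]

/-- Enlarging both generators of an ideal by one factor each. -/
theorem mul_mem_span_pair_mul {x y a b c g : B} (h₁ : c ∈ Ideal.span {x, y * b})
    (h₂ : c ∈ Ideal.span {x * a, y}) (hg : g ∈ Ideal.span {a, b}) :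
    g * c ∈ Ideal.span {x * a, y * b} := by
  obtain ⟨r₁, s₁, h₁⟩ := Ideal.mem_span_pair.1 h₁
  obtain ⟨r₂, s₂, h₂⟩ := Ideal.mem_span_pair.1 h₂
  obtain ⟨r, s, rfl⟩ := Ideal.mem_span_pair.1 hg
  refine Ideal.mem_span_pair.2 ⟨r * r₁ + s * b * r₂, r * a * s₁ + s * s₂, ?_⟩
  linear_combination r * a * h₁ + s * b * h₂

/-- If `f (κ i j)` is in the ideal generated by `a i` and `b j` for all pairs `(i, j)`, then the
product of `f k` over the *distinct* labels `k = κ i j` is in the ideal generated by `∏ a i` and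
`∏ b j`. Peel off the largest index `i` or the largest index `j`: the label `κ i j` occurs only at
the pair `(i, j)` of largest indices, hence neither in the product for the smaller `s` nor in the
one for the smaller `t`, and `mul_mem_span_pair_mul` puts it back once. -/
theorem prod_mem_span_pair_prod {α β K L : Type*} [DecidableEq α] [DecidableEq β] [DecidableEq K]
    [LinearOrder L] (keyα : α → L) (keyβ : β → L) (κ : α → β → K) (a : α → B) (b : β → B)
    (f : K → B) (hf : ∀ i j, f (κ i j) ∈ Ideal.span {a i, b j})
    (hκ : ∀ i i' j j', keyα i' ≤ keyα i → keyβ j' ≤ keyβ j → κ i' j' = κ i j → i' = i ∧ j' = j)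
    (N : ℕ) : ∀ (s : Finset α) (t : Finset β), s.card + t.card = N →
    ∏ k ∈ (s ×ˢ t).image (fun x => κ x.1 x.2), f k ∈
      Ideal.span {∏ i ∈ s, a i, ∏ j ∈ t, b j} := by
  induction N with
  | zero =>
    intro s t h
    rw [Finset.card_eq_zero.1 (by omega : s.card = 0), prod_empty]
    exact Ideal.mem_span_pair.2 ⟨_, 0, by rw [mul_one, zero_mul, add_zero]⟩
  | succ N ih =>
    intro s t h
    rcases s.eq_empty_or_nonempty with rfl | hs
    · rw [prod_empty (f := a)]
      exact Ideal.mem_span_pair.2 ⟨_, 0, by rw [mul_one, zero_mul, add_zero]⟩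
    rcases t.eq_empty_or_nonempty with rfl | ht
    · rw [prod_empty (f := b)]
      exact Ideal.mem_span_pair.2 ⟨0, _, by rw [mul_one, zero_mul, zero_add]⟩
    obtain ⟨i, hi, hi'⟩ := s.exists_max_image keyα hs
    obtain ⟨j, hj, hj'⟩ := t.exists_max_image keyβ ht
    have hcs := card_erase_of_mem hi
    have hct := card_erase_of_mem hj
    have hs0 := card_pos.2 hs
    have ht0 := card_pos.2 ht
    let I := (s ×ˢ t).image fun x => κ x.1 x.2
    have hmem : κ i j ∈ I := mem_image.2 ⟨(i, j), mk_mem_product hi hj, rfl⟩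
    have key : ∀ (s' : Finset α) (t' : Finset β), s' ⊆ s → t' ⊆ t → (i ∉ s' ∨ j ∉ t') →
        (s' ×ˢ t').image (fun x => κ x.1 x.2) ⊆ I.erase (κ i j) := by
      intro s' t' hs' ht' hij k hk
      obtain ⟨⟨i', j'⟩, hm, rfl⟩ := mem_image.1 hk
      obtain ⟨hi1, hj1⟩ := mem_product.1 hm
      refine mem_erase.2 ⟨fun e => ?_, mem_image.2 ⟨_, mk_mem_product (hs' hi1) (ht' hj1), rfl⟩⟩
      obtain ⟨rfl, rfl⟩ := hκ i i' j j' (hi' _ (hs' hi1)) (hj' _ (ht' hj1)) e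
      exact hij.elim (fun h => h hi1) fun h => h hj1
    have hmono : ∀ (s' : Finset α) (t' : Finset β), s' ⊆ s → t' ⊆ t → (i ∉ s' ∨ j ∉ t') →
        s'.card + t'.card = N →
        ∏ k ∈ I.erase (κ i j), f k ∈ Ideal.span {∏ i ∈ s', a i, ∏ j ∈ t', b j} := by
      intro s' t' hs' ht' hij hN
      rw [← prod_sdiff (key s' t' hs' ht' hij)]
      exact Ideal.mul_mem_left _ _ (ih s' t' hN)
    have h1 := hmono (s.erase i) t (erase_subset _ _) Subset.rfl (Or.inl (notMem_erase _ _))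
      (by omega)
    have h2 := hmono s (t.erase j) Subset.rfl (erase_subset _ _) (Or.inr (notMem_erase _ _))
      (by omega)
    rw [← mul_prod_erase I f hmem]
    rw [← prod_erase_mul t b hj] at h1 ⊢
    rw [← prod_erase_mul s a hi] at h2 ⊢
    exact mul_mem_span_pair_mul h1 h2 (hf i j)

/-- The resultant of the polynomials `∏ (1 - v x) ∏ (1 - w x²)` and `∏ (1 - v x⁻¹) ∏ (1 - w x⁻²)`,
where `v` runs over the images of the elements of `MH` and `w` over those of `ML`, without the
multiplicities: the product of all distinct factors `1 - v v'`, of all distinct factors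
`1 - v² w`, and of all distinct factors `1 - w w'` is a combination of both polynomials. No factor
has to be repeated: order the linear factors by `2 • v` and the quadratic ones by `w`; then twice
`v + v'`, and `2 • v + w` and `w + w'` themselves, are the sums of the two keys, which increase
strictly along chains of pairs. -/
theorem prod_one_sub_mem_span_pair {L : Type*} [AddCommGroup L] [LinearOrder L]
    [IsOrderedAddMonoid L] (χ : L → B) (hχ : ∀ v w, χ (v + w) = χ v * χ w) {x y : B}
    (hxy : x * y = 1) {MH ML THH THL TLL : Finset L}
    (hHH : ∀ v ∈ MH, ∀ w ∈ MH, v + w ∈ THH) (hHL : ∀ v ∈ MH, ∀ w ∈ ML, 2 • v + w ∈ THL)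
    (hLL : ∀ v ∈ ML, ∀ w ∈ ML, v + w ∈ TLL) :
    (∏ v ∈ THH, (1 - χ v)) * (∏ v ∈ THL, (1 - χ v)) * ∏ v ∈ TLL, (1 - χ v) ∈
      Ideal.span {(∏ v ∈ MH, (1 - χ v * x)) * ∏ v ∈ ML, (1 - χ v * x ^ 2),
        (∏ v ∈ MH, (1 - χ v * y)) * ∏ v ∈ ML, (1 - χ v * y ^ 2)} := by
  classical
  -- the indices are tagged: `false` for the linear factors, `true` for the quadratic ones,
  -- and the tag breaks ties between the keys of both kinds
  let key : Bool × L → L ×ₗ Bool := fun i => toLex (if i.1 then i.2 else 2 • i.2, i.1)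
  let κ : Bool × L → Bool × L → ℕ × L := fun i j =>
    (i.1.toNat + j.1.toNat,
      if i.1 = j.1 then i.2 + j.2 else if i.1 then 2 • j.2 + i.2 else 2 • i.2 + j.2)
  let a : B → Bool × L → B := fun x i => 1 - χ i.2 * if i.1 then x ^ 2 else x
  let f : ℕ × L → B := fun k => 1 - χ k.2
  let s : Finset (Bool × L) := ({false} ×ˢ MH) ∪ ({true} ×ˢ ML)
  have hprod : ∀ x : B, ∏ i ∈ s, a x i =
      (∏ v ∈ MH, (1 - χ v * x)) * ∏ v ∈ ML, (1 - χ v * x ^ 2) := by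
    intro x
    rw [prod_union, prod_product, prod_product, prod_singleton, prod_singleton]
    · simp [a]
    · rw [disjoint_left]
      rintro ⟨i, v⟩ h1 h2
      simp only [mem_product, mem_singleton] at h1 h2
      exact absurd (h1.1.symm.trans h2.1) (by simp)
  have h2 : ∀ v : L, χ (2 • v) = χ v ^ 2 := fun v => by rw [two_nsmul, hχ, sq]
  have hmain := prod_mem_span_pair_prod key key κ (a x) (a y) f ?_ ?_ _ s s rfl
  · rw [hprod, hprod] at hmain
    let U : Finset (ℕ × L) := ({0} ×ˢ THH) ∪ ({1} ×ˢ THL) ∪ ({2} ×ˢ TLL)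
    have hsub : (s ×ˢ s).image (fun x => κ x.1 x.2) ⊆ U := by
      intro k hk
      obtain ⟨⟨⟨i, v⟩, ⟨j, w⟩⟩, hm, rfl⟩ := mem_image.1 hk
      obtain ⟨hi, hj⟩ := mem_product.1 hm
      cases i <;> cases j <;> simp [s] at hi hj <;> simp [κ, U]
      · exact hHH v hi w hj
      · exact hHL v hi w hj
      · exact hHL w hj v hi
      · exact hLL v hi w hj
    have hU : ∏ k ∈ U, f k =
        (∏ v ∈ THH, (1 - χ v)) * (∏ v ∈ THL, (1 - χ v)) * ∏ v ∈ TLL, (1 - χ v) := by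
      rw [prod_union, prod_union, prod_product, prod_product, prod_product, prod_singleton,
        prod_singleton, prod_singleton]
      · rw [disjoint_left]
        rintro ⟨i, v⟩ h1 h2
        simp only [mem_product, mem_singleton] at h1 h2
        exact absurd (h1.1.symm.trans h2.1) (by simp)
      · rw [disjoint_left]
        rintro ⟨i, v⟩ h1 h2
        simp only [mem_product, mem_singleton, mem_union] at h1 h2
        rcases h1 with h1 | h1 <;> exact absurd (h1.1.symm.trans h2.1) (by simp)
    rw [← hU, ← prod_sdiff hsub]
    exact Ideal.mul_mem_left _ _ hmain
  · rintro ⟨i, v⟩ ⟨j, w⟩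
    refine Ideal.mem_span_pair.2 ?_
    cases i <;> cases j
    · refine ⟨1, χ v * x, ?_⟩
      simp only [f, κ, a, hχ, if_true, Bool.false_eq_true, if_false]
      linear_combination (-χ v * χ w) * hxy
    · refine ⟨1 + χ v * x, (χ v * x) ^ 2, ?_⟩
      simp only [f, κ, a, hχ, h2, if_true, Bool.false_eq_true, if_false]
      linear_combination (-χ v ^ 2 * χ w) * (x * y + 1) * hxy
    · refine ⟨(χ w * y) ^ 2, 1 + χ w * y, ?_⟩
      simp only [f, κ, a, hχ, h2, if_true, Bool.false_eq_true, if_false,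
        Bool.true_eq_false]
      linear_combination (-χ w ^ 2 * χ v) * (x * y + 1) * hxy
    · refine ⟨1, χ v * x ^ 2, ?_⟩
      simp only [f, κ, a, hχ, if_true]
      linear_combination (-χ v * χ w) * (x * y + 1) * hxy
  · rintro ⟨i, v⟩ ⟨i', v'⟩ ⟨j, w⟩ ⟨j', w'⟩ hi hj he
    have hinj : ∀ v w : L, 2 • v = 2 • w → v = w := fun v w h => by
      rcases lt_trichotomy v w with h' | h' | h'
      · rw [two_nsmul, two_nsmul] at h
        exact absurd h (add_lt_add h' h').ne
      · exact h'
      · rw [two_nsmul, two_nsmul] at h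
        exact absurd h (add_lt_add h' h').ne'
    have hle : ∀ p q : Bool × L, key p ≤ key q →
        (if p.1 then p.2 else 2 • p.2) < (if q.1 then q.2 else 2 • q.2) ∨
        (if p.1 then p.2 else 2 • p.2) = (if q.1 then q.2 else 2 • q.2) ∧ p.1 ≤ q.1 :=
      fun p q h => Prod.Lex.toLex_le_toLex.1 h
    have hle1 := hle _ _ hi
    have hle2 := hle _ _ hj
    have he1 := congrArg Prod.fst he
    have he2 := congrArg Prod.snd he
    simp only [κ] at he1 he2
    -- in all cases twice the label is the sum of both keys, or the label itself is
    have hsum : (if i' then v' else 2 • v') + (if j' then w' else 2 • w') =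
        (if i then v else 2 • v) + (if j then w else 2 • w) := by
      cases i <;> cases j <;> cases i' <;> cases j' <;> simp at he1 he2 ⊢ <;>
        first
        | exact he2
        | rw [← smul_add, ← smul_add, he2]
        | (rw [add_comm v' , he2]; try rw [add_comm])
        | (rw [he2, add_comm])
    have hk1 : (if i' then v' else 2 • v') = (if i then v else 2 • v) ∧
        (if j' then w' else 2 • w') = (if j then w else 2 • w) := by
      rcases hle1 with h | ⟨h, -⟩
      · rcases hle2 with h' | ⟨h', -⟩
        · exact absurd hsum (add_lt_add h h').ne
        · exact absurd hsum (add_lt_add_of_lt_of_le h h'.le).ne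
      · exact ⟨h, by simp only at h; rw [h] at hsum; exact add_left_cancel hsum⟩
    have ht1 : i' ≤ i := hle1.elim (fun h => absurd hk1.1 h.ne) fun h => h.2
    have ht2 : j' ≤ j := hle2.elim (fun h => absurd hk1.2 h.ne) fun h => h.2
    have hij : i' = i ∧ j' = j := by
      revert he1 ht1 ht2
      cases i <;> cases j <;> cases i' <;> cases j' <;> simp
    obtain ⟨rfl, rfl⟩ := hij
    obtain ⟨h1, h2⟩ := hk1
    constructor
    · cases i' <;> simp at h1 ⊢
      · exact hinj _ _ (by simpa using h1)
      · exact h1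
    · cases j' <;> simp at h2 ⊢
      · exact hinj _ _ (by simpa using h2)
      · exact h2

end Bezout

/-! ### Elliptic Pochhammer symbols -/

section Pochhammer

open Filter Topology Metric Set

theorem differentiableOn_prod {Y ι : Type*} [NormedAddCommGroup Y] [NormedSpace ℂ Y]
    (u : Finset ι) {f : ι → Y → ℂ} {s : Set Y} (h : ∀ i ∈ u, DifferentiableOn ℂ (f i) s) :
    DifferentiableOn ℂ (fun y => ∏ i ∈ u, f i y) s := by
  classical
  induction u using Finset.induction_on with
  | empty => simp
  | insert i u hi ih =>
    simp only [Finset.prod_insert hi]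
    exact (h i (Finset.mem_insert_self i u)).mul
      (ih fun j hj => h j (Finset.mem_insert_of_mem hj))

/-- The elliptic Pochhammer symbol without the factors indexed by the finite set `T`. -/
noncomputable def pochTail (T : Finset (ℕ × ℕ)) (p q x : ℂ) : ℂ :=
  ∏' k : ℕ × ℕ, (1 + if k ∈ T then 0 else -(p ^ k.1 * q ^ k.2 * x))

theorem summable_pow_mul_pow {r s : ℝ} (hr : 0 ≤ r) (hr1 : r < 1) (hs : 0 ≤ s) (hs1 : s < 1) :
    Summable fun k : ℕ × ℕ => r ^ k.1 * s ^ k.2 :=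
  (summable_geometric_of_lt_one hr hr1).mul_of_nonneg (summable_geometric_of_lt_one hs hs1)
    (fun n => pow_nonneg hr n) fun n => pow_nonneg hs n

theorem summable_norm_pochTail (T : Finset (ℕ × ℕ)) {p q : ℂ} (hp : ‖p‖ < 1) (hq : ‖q‖ < 1)
    (x : ℂ) : Summable fun k : ℕ × ℕ => ‖if k ∈ T then 0 else -(p ^ k.1 * q ^ k.2 * x)‖ := by
  refine Summable.of_nonneg_of_le (fun k => norm_nonneg _) (fun k => ?_)
    ((summable_pow_mul_pow (norm_nonneg p) hp (norm_nonneg q) hq).mul_right ‖x‖)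
  split_ifs
  · rw [norm_zero]
    positivity
  · simp

theorem ellPoch_eq_prod_mul_pochTail (T : Finset (ℕ × ℕ)) {p q : ℂ} (hp : ‖p‖ < 1)
    (hq : ‖q‖ < 1) (x : ℂ) :
    ellPoch p q x = (∏ k ∈ T, (1 - p ^ k.1 * q ^ k.2 * x)) * pochTail T p q x := by
  have h1 : ∏ k ∈ T, (1 - p ^ k.1 * q ^ k.2 * x) =
      ∏' k : ℕ × ℕ, if k ∈ T then 1 - p ^ k.1 * q ^ k.2 * x else 1 := by
    rw [tprod_eq_prod (s := T) fun k hk => if_neg hk]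
    exact Finset.prod_congr rfl fun k hk => (if_pos hk).symm
  rw [h1, pochTail, ← Multipliable.tprod_mul]
  · refine tprod_congr fun k => ?_
    split_ifs <;> ring
  · refine multipliable_of_hasFiniteMulSupport (T.finite_toSet.subset fun k hk => ?_)
    by_contra h
    exact hk (if_neg h)
  · exact multipliable_one_add_of_summable (summable_norm_pochTail T hp hq x)

theorem pochTail_ne_zero {T : Finset (ℕ × ℕ)} {p q : ℂ} (hp : ‖p‖ < 1) (hq : ‖q‖ < 1) {x : ℂ}
    (h : ∀ k ∉ T, p ^ k.1 * q ^ k.2 * x ≠ 1) : pochTail T p q x ≠ 0 := by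
  refine tprod_one_add_ne_zero_of_summable (fun k => ?_) (summable_norm_pochTail T hp hq x)
  split_ifs with hk
  · simp
  · intro h0
    exact h k hk (by linear_combination -h0)

theorem ellPoch_eq_pochTail {p q : ℂ} (hp : ‖p‖ < 1) (hq : ‖q‖ < 1) (x : ℂ) :
    ellPoch p q x = pochTail ∅ p q x := by
  simpa using ellPoch_eq_prod_mul_pochTail ∅ hp hq x

theorem ellPoch_ne_zero_iff {p q : ℂ} (hp : ‖p‖ < 1) (hq : ‖q‖ < 1) {x : ℂ} :
    ellPoch p q x ≠ 0 ↔ ∀ a b : ℕ, p ^ a * q ^ b * x ≠ 1 := by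
  constructor
  · intro h a b hab
    rw [ellPoch_eq_prod_mul_pochTail {(a, b)} hp hq, Finset.prod_singleton] at h
    simp only [hab, sub_self, zero_mul, ne_eq, not_true_eq_false] at h
  · intro h
    rw [ellPoch_eq_pochTail hp hq]
    exact pochTail_ne_zero hp hq fun k _ => h k.1 k.2

theorem differentiableOn_pochTail (T : Finset (ℕ × ℕ)) :
    DifferentiableOn ℂ (fun x : ℂ × ℂ × ℂ => pochTail T x.1 x.2.1 x.2.2)
      {x | ‖x.1‖ < 1 ∧ ‖x.2.1‖ < 1} := by
  rintro ⟨p, q, x⟩ ⟨hp, hq⟩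
  obtain ⟨ρ, hρ, hρ1⟩ := exists_between (max_lt hp hq)
  have hρ0 : 0 ≤ ρ := (norm_nonneg p).trans ((le_max_left _ _).trans hρ.le)
  let V : Set (ℂ × ℂ × ℂ) := {y | ‖y.1‖ < ρ ∧ ‖y.2.1‖ < ρ ∧ ‖y.2.2‖ < ‖x‖ + 1}
  have hV : IsOpen V := by
    refine IsOpen.and ?_ (IsOpen.and ?_ ?_) <;> exact isOpen_lt (by fun_prop) (by fun_prop)
  have hmem : (p, q, x) ∈ V :=
    ⟨(le_max_left _ _).trans_lt hρ, (le_max_right _ _).trans_lt hρ, lt_add_one _⟩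
  have hd : ∀ k : ℕ × ℕ, Differentiable ℂ fun y : ℂ × ℂ × ℂ =>
      if k ∈ T then 0 else -(y.1 ^ k.1 * y.2.1 ^ k.2 * y.2.2) := fun k => by
    split_ifs <;> fun_prop
  have hprod := Summable.hasProdLocallyUniformlyOn_one_add
    (f := fun (k : ℕ × ℕ) (y : ℂ × ℂ × ℂ) =>
      if k ∈ T then 0 else -(y.1 ^ k.1 * y.2.1 ^ k.2 * y.2.2))
    hV (u := fun k : ℕ × ℕ => ρ ^ k.1 * ρ ^ k.2 * (‖x‖ + 1))
    ((summable_pow_mul_pow hρ0 hρ1 hρ0 hρ1).mul_right (‖x‖ + 1))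
    (Eventually.of_forall fun k y hy => by
      have h0 : 0 ≤ ρ ^ k.1 * ρ ^ k.2 * (‖x‖ + 1) := by positivity
      split_ifs
      · simpa using h0
      · rw [norm_neg, norm_mul, norm_mul, norm_pow, norm_pow]
        obtain ⟨h1, h2, h3⟩ := hy
        gcongr)
    fun k => (hd k).continuous.continuousOn
  have := differentiableOn_of_tendstoLocallyUniformlyOn hV
    (fun s => differentiableOn_prod s (f := fun (k : ℕ × ℕ) (y : ℂ × ℂ × ℂ) =>
      1 + if k ∈ T then 0 else -(y.1 ^ k.1 * y.2.1 ^ k.2 * y.2.2))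
      fun k _ => ((hd k).const_add 1).differentiableOn) hprod
  exact (this.differentiableAt (hV.mem_nhds hmem)).differentiableWithinAt

/-- Composition of the Pochhammer symbol with holomorphic functions of several variables. -/
theorem differentiableOn_pochTail_comp {Y : Type*} [NormedAddCommGroup Y] [NormedSpace ℂ Y]
    {s : Set Y} {p q x : Y → ℂ} (T : Finset (ℕ × ℕ)) (hp : DifferentiableOn ℂ p s)
    (hq : DifferentiableOn ℂ q s) (hx : DifferentiableOn ℂ x s) (hp1 : ∀ y ∈ s, ‖p y‖ < 1)
    (hq1 : ∀ y ∈ s, ‖q y‖ < 1) : DifferentiableOn ℂ (fun y => pochTail T (p y) (q y) (x y)) s :=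
  DifferentiableOn.comp (f := fun y => (p y, q y, x y)) (differentiableOn_pochTail T)
    (hp.prodMk (hq.prodMk hx)) fun y hy => ⟨hp1 y hy, hq1 y hy⟩

theorem differentiableOn_ellPoch_comp {Y : Type*} [NormedAddCommGroup Y] [NormedSpace ℂ Y]
    {s : Set Y} {p q x : Y → ℂ} (hp : DifferentiableOn ℂ p s)
    (hq : DifferentiableOn ℂ q s) (hx : DifferentiableOn ℂ x s) (hp1 : ∀ y ∈ s, ‖p y‖ < 1)
    (hq1 : ∀ y ∈ s, ‖q y‖ < 1) : DifferentiableOn ℂ (fun y => ellPoch (p y) (q y) (x y)) s :=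
  (differentiableOn_pochTail_comp ∅ hp hq hx hp1 hq1).congr fun y hy =>
    ellPoch_eq_pochTail (hp1 y hy) (hq1 y hy) _

end Pochhammer

/-! ### Systems of holomorphic monomials -/

section MonomialSystems

open Filter Topology Metric Set

/-- A holomorphic function on a dense subset that extends locally extends globally. -/
theorem exists_differentiableOn_of_local {Y : Type*} [NormedAddCommGroup Y] [NormedSpace ℂ Y]
    {s S : Set Y} {g : Y → ℂ} (hSs : S ⊆ s) (hS : s ⊆ closure S)
    (h : ∀ w ∈ s, ∃ N ∈ 𝓝 w, ∃ Ψ : Y → ℂ, DifferentiableOn ℂ Ψ N ∧ ∀ y ∈ N ∩ S, Ψ y = g y) :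
    ∃ Φ : Y → ℂ, DifferentiableOn ℂ Φ s ∧ ∀ y ∈ S, Φ y = g y := by
  have h' : ∀ w, ∃ N : Set Y, ∃ Ψ : Y → ℂ, w ∈ s → IsOpen N ∧ w ∈ N ∧ DifferentiableOn ℂ Ψ N ∧
      ∀ y ∈ N ∩ S, Ψ y = g y := by
    intro w
    by_cases hw : w ∈ s
    · obtain ⟨N, hN, Ψ, hΨ, hg⟩ := h w hw
      exact ⟨interior N, Ψ, fun _ => ⟨isOpen_interior, mem_interior_iff_mem_nhds.2 hN,
        hΨ.mono interior_subset, fun y hy => hg y ⟨interior_subset hy.1, hy.2⟩⟩⟩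
    · exact ⟨∅, g, fun hw' => absurd hw' hw⟩
  choose N Ψ hΨ using h'
  refine ⟨fun w => Ψ w w, fun w hw => ?_, fun y hy => ?_⟩
  · obtain ⟨hN, hwN, hd, hg⟩ := hΨ w hw
    refine ((hd w hwN).mono_of_mem_nhdsWithin
      (nhdsWithin_le_nhds (hN.mem_nhds hwN))).congr_of_eventuallyEq
      ?_ rfl
    filter_upwards [nhdsWithin_le_nhds (hN.mem_nhds hwN), self_mem_nhdsWithin] with y hy hys
    obtain ⟨hN', hyN', hd', hg'⟩ := hΨ y hys
    have : (𝓝[S] y).NeBot := mem_closure_iff_nhdsWithin_neBot.1 (hS hys)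
    have t1 : Tendsto (Ψ y) (𝓝[S] y) (𝓝 (Ψ y y)) :=
      (hd'.differentiableAt (hN'.mem_nhds hyN')).continuousAt.mono_left nhdsWithin_le_nhds
    have t2 : Tendsto (Ψ w) (𝓝[S] y) (𝓝 (Ψ w y)) :=
      (hd.differentiableAt (hN.mem_nhds hy)).continuousAt.mono_left nhdsWithin_le_nhds
    refine tendsto_nhds_unique t1 (t2.congr' ?_)
    filter_upwards [nhdsWithin_le_nhds (hN.mem_nhds hy), nhdsWithin_le_nhds (hN'.mem_nhds hyN'),
      self_mem_nhdsWithin] with x h1 h2 h3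
    rw [hg x ⟨h1, h3⟩, hg' x ⟨h2, h3⟩]
  · obtain ⟨hN, hwN, hd, hg⟩ := hΨ y (hSs hy)
    exact hg y ⟨hwN, hy⟩

/-- The ring of functions on `s` that are restrictions of functions holomorphic on `s`. -/
def holomorphicSubring {Z : Type*} [NormedAddCommGroup Z] [NormedSpace ℂ Z] (s : Set Z) :
    Subring (s → ℂ) where
  carrier := {f | ∃ F : Z → ℂ, DifferentiableOn ℂ F s ∧ ∀ x : s, f x = F x}
  mul_mem' := by
    rintro f g ⟨F, hF, hf⟩ ⟨G, hG, hg⟩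
    exact ⟨_, hF.mul hG, fun x => by simp [hf, hg]⟩
  one_mem' := ⟨fun _ => 1, by fun_prop, fun x => rfl⟩
  add_mem' := by
    rintro f g ⟨F, hF, hf⟩ ⟨G, hG, hg⟩
    exact ⟨_, hF.add hG, fun x => by simp [hf, hg]⟩
  zero_mem' := ⟨fun _ => 0, by fun_prop, fun x => rfl⟩
  neg_mem' := by
    rintro f ⟨F, hF, hf⟩
    exact ⟨_, hF.neg, fun x => by simp [hf]⟩

theorem holomorphicSubring_prod_apply {Z ι : Type*} [NormedAddCommGroup Z] [NormedSpace ℂ Z]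
    {s : Set Z} (t : Finset ι) (g : ι → holomorphicSubring s) (x : s) :
    (∏ i ∈ t, g i).1 x = ∏ i ∈ t, (g i).1 x := by
  rw [← Finset.prod_apply]
  exact congrFun (map_prod (holomorphicSubring s).subtype g t) x

/-- Holomorphic functions `p`, `q` with values in the punctured unit disc and a family `χ` of
nowhere vanishing holomorphic functions on an open set, indexed by an additive group of exponents
(formal monomials). -/
structure MonomialSystem (Y Λ : Type*) [NormedAddCommGroup Y] [NormedSpace ℂ Y]
    [AddCommGroup Λ] where
  dom : Set Y
  isOpen_dom : IsOpen dom
  p : Y → ℂ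
  q : Y → ℂ
  χ : Λ → Y → ℂ
  differentiableOn_p : DifferentiableOn ℂ p dom
  differentiableOn_q : DifferentiableOn ℂ q dom
  differentiableOn_χ : ∀ v, DifferentiableOn ℂ (χ v) dom
  p_ne_zero : ∀ y ∈ dom, p y ≠ 0
  q_ne_zero : ∀ y ∈ dom, q y ≠ 0
  norm_p_lt_one : ∀ y ∈ dom, ‖p y‖ < 1
  norm_q_lt_one : ∀ y ∈ dom, ‖q y‖ < 1
  χ_ne_zero : ∀ v, ∀ y ∈ dom, χ v y ≠ 0
  χ_add : ∀ v w, ∀ y ∈ dom, χ (v + w) y = χ v y * χ w y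

namespace MonomialSystem

variable {Y Λ : Type*} [NormedAddCommGroup Y] [NormedSpace ℂ Y] [AddCommGroup Λ]
  (M : MonomialSystem Y Λ)

/-- The Pochhammer symbol of a monomial. -/
noncomputable def poch (v : Λ) (y : Y) : ℂ := ellPoch (M.p y) (M.q y) (M.χ v y)

/-- The finite set of pairs of exponents less than `K`. -/
def box (K : ℕ) : Finset (ℕ × ℕ) := Finset.range K ×ˢ Finset.range K

/-- The product of the factors of the Pochhammer symbol of `v` with exponents in `box K`. -/
noncomputable def pochHead (K : ℕ) (v : Λ) (y : Y) : ℂ :=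
  ∏ k ∈ box K, (1 - M.p y ^ k.1 * M.q y ^ k.2 * M.χ v y)

/-- The product `∏ (v ζ; p, q) ∏ (w ζ²; p, q)` over `v ∈ H` and `w ∈ L`. -/
noncomputable def factor (H L : Finset Λ) (y : Y) (ζ : ℂ) : ℂ :=
  (∏ v ∈ H, ellPoch (M.p y) (M.q y) (M.χ v y * ζ)) *
    ∏ v ∈ L, ellPoch (M.p y) (M.q y) (M.χ v y * ζ ^ 2)

/-- The part of `factor` with exponents in `box K`. -/
noncomputable def headFactor (K : ℕ) (H L : Finset Λ) (y : Y) (ζ : ℂ) : ℂ :=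
  (∏ v ∈ H, ∏ k ∈ box K, (1 - M.p y ^ k.1 * M.q y ^ k.2 * (M.χ v y * ζ))) *
    ∏ v ∈ L, ∏ k ∈ box K, (1 - M.p y ^ k.1 * M.q y ^ k.2 * (M.χ v y * ζ ^ 2))

/-- The part of `factor` with exponents outside of `T`. -/
noncomputable def tailFactor (T : Finset (ℕ × ℕ)) (H L : Finset Λ) (y : Y) (ζ : ℂ) : ℂ :=
  (∏ v ∈ H, pochTail T (M.p y) (M.q y) (M.χ v y * ζ)) *
    ∏ v ∈ L, pochTail T (M.p y) (M.q y) (M.χ v y * ζ ^ 2)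

variable {M} {H L : Finset Λ} {y : Y}

theorem factor_eq_headFactor_mul (K : ℕ) (hy : y ∈ M.dom) (ζ : ℂ) :
    M.factor H L y ζ = M.headFactor K H L y ζ * M.tailFactor (box K) H L y ζ := by
  simp only [factor, headFactor, tailFactor, ellPoch_eq_prod_mul_pochTail (box K)
    (M.norm_p_lt_one y hy) (M.norm_q_lt_one y hy), Finset.prod_mul_distrib]
  ring

theorem factor_eq_tailFactor (hy : y ∈ M.dom) (ζ : ℂ) :
    M.factor H L y ζ = M.tailFactor ∅ H L y ζ := by
  simp only [factor, tailFactor, ellPoch_eq_pochTail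
    (M.norm_p_lt_one y hy) (M.norm_q_lt_one y hy)]

theorem poch_eq_pochHead_mul (K : ℕ) (hy : y ∈ M.dom) (v : Λ) :
    M.poch v y = M.pochHead K v y * pochTail (box K) (M.p y) (M.q y) (M.χ v y) :=
  ellPoch_eq_prod_mul_pochTail (box K) (M.norm_p_lt_one y hy) (M.norm_q_lt_one y hy) _

theorem differentiableOn_poch (v : Λ) : DifferentiableOn ℂ (M.poch v) M.dom :=
  differentiableOn_ellPoch_comp M.differentiableOn_p M.differentiableOn_q (M.differentiableOn_χ v)
    M.norm_p_lt_one M.norm_q_lt_one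

theorem poch_ne_zero_iff (hy : y ∈ M.dom) {v : Λ} :
    M.poch v y ≠ 0 ↔ ∀ a b : ℕ, M.p y ^ a * M.q y ^ b * M.χ v y ≠ 1 :=
  ellPoch_ne_zero_iff (M.norm_p_lt_one y hy) (M.norm_q_lt_one y hy)

theorem differentiableOn_tailFactor (T : Finset (ℕ × ℕ)) (H L : Finset Λ) :
    DifferentiableOn ℂ (Function.uncurry (M.tailFactor T H L)) (M.dom ×ˢ univ) := by
  have hm : MapsTo Prod.fst (M.dom ×ˢ (univ : Set ℂ)) M.dom := fun x hx => hx.1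
  have hp := M.differentiableOn_p.comp differentiableOn_fst hm
  have hq := M.differentiableOn_q.comp differentiableOn_fst hm
  refine DifferentiableOn.mul ?_ ?_ <;> refine differentiableOn_prod _ fun v _ => ?_
  · exact differentiableOn_pochTail_comp T hp hq
      (((M.differentiableOn_χ v).comp differentiableOn_fst hm).mul differentiableOn_snd)
      (fun x hx => M.norm_p_lt_one _ hx.1) fun x hx => M.norm_q_lt_one _ hx.1
  · exact differentiableOn_pochTail_comp T hp hq
      (((M.differentiableOn_χ v).comp differentiableOn_fst hm).mul (differentiableOn_snd.pow 2))
      (fun x hx => M.norm_p_lt_one _ hx.1) fun x hx => M.norm_q_lt_one _ hx.1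

theorem differentiableOn_factor (H L : Finset Λ) :
    DifferentiableOn ℂ (Function.uncurry (M.factor H L)) (M.dom ×ˢ univ) :=
  (differentiableOn_tailFactor ∅ H L).congr fun x hx => factor_eq_tailFactor hx.1 x.2

/-- The zeros of `ζ ↦ factor H L y ζ⁻¹`, stated without division. -/
def poleSet (M : MonomialSystem Y Λ) (H L : Finset Λ) (y : Y) : Set ℂ :=
  {x | (∃ v ∈ H, ∃ a b : ℕ, x = M.p y ^ a * M.q y ^ b * M.χ v y) ∨
    ∃ v ∈ L, ∃ a b : ℕ, x ^ 2 = M.p y ^ a * M.q y ^ b * M.χ v y}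

theorem factor_ne_zero (hy : y ∈ M.dom) {ζ : ℂ} (hζ : ζ ≠ 0) (h : ζ⁻¹ ∉ M.poleSet H L y) :
    M.factor H L y ζ ≠ 0 := by
  have hp := M.norm_p_lt_one y hy
  have hq := M.norm_q_lt_one y hy
  refine mul_ne_zero (Finset.prod_ne_zero_iff.2 fun v hv => ?_)
    (Finset.prod_ne_zero_iff.2 fun v hv => ?_)
  · refine (ellPoch_ne_zero_iff hp hq).2 fun a b e => h (Or.inl ⟨v, hv, a, b, ?_⟩)
    field_simp
    linear_combination -e
  · refine (ellPoch_ne_zero_iff hp hq).2 fun a b e => h (Or.inr ⟨v, hv, a, b, ?_⟩)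
    field_simp
    linear_combination -e

theorem zero_notMem_poleSet (hy : y ∈ M.dom) : (0 : ℂ) ∉ M.poleSet H L y := by
  have h : ∀ v (a b : ℕ), M.p y ^ a * M.q y ^ b * M.χ v y ≠ 0 := fun v a b =>
    mul_ne_zero (mul_ne_zero (pow_ne_zero _ (M.p_ne_zero y hy))
      (pow_ne_zero _ (M.q_ne_zero y hy))) (M.χ_ne_zero v y hy)
  rintro (⟨v, -, a, b, e⟩ | ⟨v, -, a, b, e⟩)
  · exact h v a b e.symm
  · exact h v a b (by rw [← e]; ring)

theorem finite_poleSet (hy : y ∈ M.dom) {ρ : ℝ} (hρ : 0 < ρ) :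
    {x ∈ M.poleSet H L y | ρ ≤ ‖x‖}.Finite := by
  have hfin : ∀ v, ∀ r > 0, {x | r ≤ ‖x‖ ∧ ∃ a b : ℕ,
      x = M.p y ^ a * M.q y ^ b * M.χ v y}.Finite := by
    intro v r hr
    have hs := ((summable_pow_mul_pow (norm_nonneg (M.p y)) (M.norm_p_lt_one y hy)
      (norm_nonneg (M.q y)) (M.norm_q_lt_one y hy)).mul_right ‖M.χ v y‖).tendsto_cofinite_zero
    have hf := hs.eventually (gt_mem_nhds hr)
    rw [eventually_cofinite] at hf
    refine (hf.image fun k : ℕ × ℕ => M.p y ^ k.1 * M.q y ^ k.2 * M.χ v y).subset ?_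
    rintro x ⟨hx, a, b, rfl⟩
    exact ⟨(a, b), by simpa using hx, rfl⟩
  have hsq : ∀ c : ℂ, {x : ℂ | x ^ 2 = c}.Finite := fun c => by
    rcases ({x : ℂ | x ^ 2 = c}).eq_empty_or_nonempty with h | ⟨s, hs⟩
    · rw [h]
      exact finite_empty
    · refine (Set.toFinite {s, -s}).subset fun x hx => ?_
      exact sq_eq_sq_iff_eq_or_eq_neg.1 (hx.trans hs.symm)
  refine ((H.finite_toSet.biUnion fun v _ => hfin v ρ hρ).union (L.finite_toSet.biUnion fun v _ =>
    (hfin v (ρ ^ 2) (by positivity)).biUnion fun c _ => hsq c)).subset ?_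
  rintro x ⟨⟨v, hv, a, b, e⟩ | ⟨v, hv, a, b, e⟩, hx⟩
  · exact Or.inl (mem_biUnion hv ⟨hx, a, b, e⟩)
  · refine Or.inr (mem_biUnion hv (mem_biUnion (x := x ^ 2) ⟨?_, a, b, e⟩ rfl))
    rw [norm_pow]
    gcongr

theorem χ_two_nsmul (hy : y ∈ M.dom) (v : Λ) : M.χ (2 • v) y = M.χ v y ^ 2 := by
  rw [two_nsmul, M.χ_add _ _ y hy, sq]

/-- If none of the products `v v'`, `v² w`, `w w'` gives rise to a pinch, then no point of the pole
set is the reciprocal of another one. -/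
theorem mul_ne_one_of_mem_poleSet (hy : y ∈ M.dom)
    (hHH : ∀ v ∈ H, ∀ w ∈ H, M.poch (v + w) y ≠ 0)
    (hHL : ∀ v ∈ H, ∀ w ∈ L, M.poch (2 • v + w) y ≠ 0)
    (hLL : ∀ v ∈ L, ∀ w ∈ L, M.poch (v + w) y ≠ 0) {x x' : ℂ} (hx : x ∈ M.poleSet H L y)
    (hx' : x' ∈ M.poleSet H L y) : x * x' ≠ 1 := by
  intro e
  have e2 : x ^ 2 * x' ^ 2 = 1 := by rw [← mul_pow, e, one_pow]
  rcases hx with ⟨v, hv, a, b, h⟩ | ⟨v, hv, a, b, h⟩ <;>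
    rcases hx' with ⟨w, hw, a', b', h'⟩ | ⟨w, hw, a', b', h'⟩
  · refine (poch_ne_zero_iff hy).1 (hHH v hv w hw) (a + a') (b + b') ?_
    rw [M.χ_add _ _ y hy, ← e, h, h']
    ring
  · refine (poch_ne_zero_iff hy).1 (hHL v hv w hw) (2 * a + a') (2 * b + b') ?_
    rw [M.χ_add _ _ y hy, χ_two_nsmul hy, ← e2, h, h']
    ring
  · refine (poch_ne_zero_iff hy).1 (hHL w hw v hv) (2 * a' + a) (2 * b' + b) ?_
    rw [M.χ_add _ _ y hy, χ_two_nsmul hy, ← e2, h, h']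
    ring
  · refine (poch_ne_zero_iff hy).1 (hLL v hv w hw) (a + a') (b + b') ?_
    rw [M.χ_add _ _ y hy, ← e2, h, h']
    ring

/-- The combination of the finite parts of `factor` at `ζ` and at `ζ⁻¹` whose value does not depend
on `ζ`. It is an instance of `prod_one_sub_mem_span_pair` in the ring of holomorphic functions on
`M.dom ×ˢ {0}ᶜ`, the powers of `p` and `q` being part of the formal monomials. The exponents of a
product `v² w` stay below `3 * K` when those of `v` and `w` are below `K`. -/
theorem exists_bezout [LinearOrder Λ] [IsOrderedAddMonoid Λ] (M : MonomialSystem Y Λ)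
    {H L THH THL TLL : Finset Λ} (hHH : ∀ v ∈ H, ∀ w ∈ H, v + w ∈ THH)
    (hHL : ∀ v ∈ H, ∀ w ∈ L, 2 • v + w ∈ THL) (hLL : ∀ v ∈ L, ∀ w ∈ L, v + w ∈ TLL) (K : ℕ) :
    ∃ A B : Y × ℂ → ℂ, DifferentiableOn ℂ A (M.dom ×ˢ {0}ᶜ) ∧
      DifferentiableOn ℂ B (M.dom ×ˢ {0}ᶜ) ∧ ∀ y ∈ M.dom, ∀ ζ ≠ 0,
      A (y, ζ) * M.headFactor K H L y ζ + B (y, ζ) * M.headFactor K H L y ζ⁻¹ =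
        (∏ v ∈ THH, M.pochHead (3 * K) v y) * (∏ v ∈ THL, M.pochHead (3 * K) v y) *
          ∏ v ∈ TLL, M.pochHead (3 * K) v y := by
  classical
  let s : Set (Y × ℂ) := M.dom ×ˢ {0}ᶜ
  have hm : MapsTo Prod.fst s M.dom := fun x hx => hx.1
  have hp := M.differentiableOn_p.comp differentiableOn_fst hm
  have hq := M.differentiableOn_q.comp differentiableOn_fst hm
  let χ' : Λ ×ₗ (ℤ ×ₗ ℤ) → holomorphicSubring s := fun v =>
    ⟨fun x => M.χ (ofLex v).1 x.1.1 * (M.p x.1.1 ^ (ofLex (ofLex v).2).1 *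
      M.q x.1.1 ^ (ofLex (ofLex v).2).2),
      ⟨fun x => M.χ (ofLex v).1 x.1 * (M.p x.1 ^ (ofLex (ofLex v).2).1 *
        M.q x.1 ^ (ofLex (ofLex v).2).2),
        ((M.differentiableOn_χ _).comp differentiableOn_fst hm).mul
          ((hp.zpow (Or.inl fun x hx => M.p_ne_zero _ hx.1)).mul
            (hq.zpow (Or.inl fun x hx => M.q_ne_zero _ hx.1))), fun x => rfl⟩⟩
  let X : holomorphicSubring s := ⟨fun x => x.1.2,
    ⟨fun x => x.2, differentiableOn_snd, fun x => rfl⟩⟩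
  let X' : holomorphicSubring s := ⟨fun x => (x.1.2)⁻¹, ⟨fun x => (x.2)⁻¹,
    differentiableOn_snd.inv fun x hx => hx.2, fun x => rfl⟩⟩
  let e : Λ × ℕ × ℕ → Λ ×ₗ (ℤ ×ₗ ℤ) := fun k => toLex (k.1, toLex ((k.2.1 : ℤ), (k.2.2 : ℤ)))
  have he : Function.Injective e := by
    rintro ⟨v, a, b⟩ ⟨w, a', b'⟩ h
    have h := toLex.injective h
    simp only [Prod.mk.injEq] at h
    have h2 := toLex.injective h.2
    simp only [Prod.mk.injEq, Nat.cast_inj] at h2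
    simp [h.1, h2.1, h2.2]
  have headd : ∀ v w a b a' b', e (v, a, b) + e (w, a', b') = e (v + w, a + a', b + b') := by
    intro v w a b a' b'
    simp only [e, Nat.cast_add]
    rfl
  let D : Finset Λ → ℕ → Finset (Λ ×ₗ (ℤ ×ₗ ℤ)) := fun S K => (S ×ˢ box K).image e
  have hD : ∀ {S : Finset Λ} {K : ℕ} {v a b}, e (v, a, b) ∈ D S K ↔ v ∈ S ∧ a < K ∧ b < K := by
    intro S K v a b
    simp only [D, Finset.mem_image, he.eq_iff, exists_eq_right, Finset.mem_product, box,
      Finset.mem_range]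
  have hD' : ∀ {S : Finset Λ} {K : ℕ} {u}, u ∈ D S K → ∃ v a b, u = e (v, a, b) := by
    intro S K u hu
    obtain ⟨⟨v, a, b⟩, -, rfl⟩ := Finset.mem_image.1 hu
    exact ⟨v, a, b, rfl⟩
  have hχ' : ∀ v w, χ' (v + w) = χ' v * χ' w := by
    intro v w
    ext x
    obtain ⟨⟨y, ζ⟩, hy, hζ⟩ := x
    simp only [χ', Subring.coe_mul, Pi.mul_apply]
    have e1 : ofLex (v + w) = ofLex v + ofLex w := rfl
    have e2 : ofLex (ofLex v + ofLex w).2 = ofLex (ofLex v).2 + ofLex (ofLex w).2 := rfl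
    rw [e1, e2, Prod.fst_add, Prod.fst_add, Prod.snd_add, M.χ_add _ _ y hy,
      zpow_add₀ (M.p_ne_zero y hy), zpow_add₀ (M.q_ne_zero y hy)]
    ring
  have hXX' : X * X' = 1 := by
    ext x
    obtain ⟨⟨y, ζ⟩, hy, hζ⟩ := x
    exact mul_inv_cancel₀ hζ
  have hmem := prod_one_sub_mem_span_pair χ' hχ' hXX' (MH := D H K) (ML := D L K)
    (THH := D THH (3 * K)) (THL := D THL (3 * K)) (TLL := D TLL (3 * K)) ?_ ?_ ?_
  · obtain ⟨⟨a, A, hA, ha⟩, ⟨b, B, hB, hb⟩, hab⟩ := Ideal.mem_span_pair.1 hmem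
    refine ⟨A, B, hA, hB, fun y hy ζ hζ => ?_⟩
    have h := congrFun (congrArg Subtype.val hab) ⟨(y, ζ), hy, hζ⟩
    have hcoe : ∀ (S : Finset Λ) (K : ℕ) (f : Λ ×ₗ (ℤ ×ₗ ℤ) → holomorphicSubring s) (x : s),
        (∏ v ∈ D S K, f v : holomorphicSubring s).1 x =
          ∏ v ∈ S, ∏ k ∈ box K, (f (e (v, k))).1 x := by
      intro S K f x
      rw [Finset.prod_image he.injOn, Finset.prod_product]
      rw [holomorphicSubring_prod_apply]
      exact Finset.prod_congr rfl fun v _ => holomorphicSubring_prod_apply _ _ _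
    simp only [Subring.coe_add, Subring.coe_mul, Pi.add_apply, Pi.mul_apply] at h
    simp only [hcoe] at h
    rw [ha, hb] at h
    have hterm : ∀ (v : Λ) (k : ℕ × ℕ) (x : ℂ),
        1 - M.χ v y * (M.p y ^ (k.1 : ℤ) * M.q y ^ (k.2 : ℤ)) * x =
        1 - M.p y ^ k.1 * M.q y ^ k.2 * (M.χ v y * x) := fun v k x => by
      rw [zpow_natCast, zpow_natCast]
      ring
    have hterm' : ∀ (v : Λ) (k : ℕ × ℕ), 1 - M.χ v y * (M.p y ^ (k.1 : ℤ) * M.q y ^ (k.2 : ℤ)) =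
        1 - M.p y ^ k.1 * M.q y ^ k.2 * M.χ v y := fun v k => by
      rw [zpow_natCast, zpow_natCast]
      ring
    simp only [headFactor, pochHead, ← hterm, ← hterm']
    exact h
  · intro u hu u' hu'
    obtain ⟨v, a, b, rfl⟩ := hD' hu
    obtain ⟨w, a', b', rfl⟩ := hD' hu'
    rw [hD] at hu hu'
    rw [headd, hD]
    exact ⟨hHH v hu.1 w hu'.1, by omega, by omega⟩
  · intro u hu u' hu'
    obtain ⟨v, a, b, rfl⟩ := hD' hu
    obtain ⟨w, a', b', rfl⟩ := hD' hu'
    rw [hD] at hu hu'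
    rw [two_nsmul, headd, headd, hD, ← two_nsmul]
    exact ⟨hHL v hu.1 w hu'.1, by omega, by omega⟩
  · intro u hu u' hu'
    obtain ⟨v, a, b, rfl⟩ := hD' hu
    obtain ⟨w, a', b', rfl⟩ := hD' hu'
    rw [hD] at hu hu'
    rw [headd, hD]
    exact ⟨hLL v hu.1 w hu'.1, by omega, by omega⟩

end MonomialSystem

end MonomialSystems

/-! ### Poles of the integrand and independence of the contour -/

section ResidueExtension

open Filter Topology Metric Set

namespace MonomialSystem

variable {Y Λ : Type*} [NormedAddCommGroup Y] [NormedSpace ℂ Y] [AddCommGroup Λ]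
  {M : MonomialSystem Y Λ} {H L : Finset Λ} {y : Y}

/-- The points of a separating contour are neither zero nor poles. -/
theorem _root_.Contour.Separates.inv_notMem {Γ : Contour} {A : Set ℂ} (hΓ : Γ.Separates A) {ζ : ℂ}
    (hζ : ζ ∈ Γ.trace) : ζ ≠ 0 ∧ ζ ∉ A ∧ ζ⁻¹ ∉ A :=
  ⟨fun e => hΓ.1.1 (e ▸ hζ), fun h => (hΓ.2 ζ h).1.1 hζ,
    fun h => (hΓ.2 _ h).2.1 (by rwa [inv_inv])⟩

theorem differentiable_factor_right (hy : y ∈ M.dom) :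
    Differentiable ℂ (M.factor H L y) := by
  rw [← differentiableOn_univ]
  exact (differentiableOn_factor H L).comp (f := fun ζ => (y, ζ)) (by fun_prop)
    fun ζ _ => ⟨hy, mem_univ ζ⟩

/-- The integral over a separating contour does not depend on the contour: the winding numbers
around the singularities of the integrand, which are zero, the pole set and its reciprocals, are
prescribed. -/
theorem integral_eq_of_separates (hy : y ∈ M.dom) {h : ℂ → ℂ} (hh : DifferentiableOn ℂ h {0}ᶜ)
    {Γ Γ' : Contour} (hΓ : Γ.Separates (M.poleSet H L y)) (hΓ' : Γ'.Separates (M.poleSet H L y)) :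
    (Γ.integral fun ζ => ζ⁻¹ * (h ζ / (M.factor H L y ζ * M.factor H L y ζ⁻¹))) =
      Γ'.integral fun ζ => ζ⁻¹ * (h ζ / (M.factor H L y ζ * M.factor H L y ζ⁻¹)) := by
  classical
  let A := M.poleSet H L y
  let Ω : Set ℂ := {ζ | ζ ≠ 0 ∧ M.factor H L y ζ ≠ 0} ∩ {ζ | ζ ≠ 0 ∧ M.factor H L y ζ⁻¹ ≠ 0}
  have hF := differentiable_factor_right (H := H) (L := L) hy
  have hFi : DifferentiableOn ℂ (fun ζ => M.factor H L y ζ⁻¹) {0}ᶜ :=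
    hF.differentiableOn.comp (t := univ) (differentiableOn_inv) fun _ _ => mem_univ _
  have hΩ : IsOpen Ω := by
    refine IsOpen.inter ?_ ?_
    · exact isOpen_ne.inter (hF.continuous.isOpen_preimage _ isOpen_ne)
    · exact hFi.continuousOn.isOpen_inter_preimage isOpen_compl_singleton isOpen_ne
  have hsub : ∀ Γ : Contour, Γ.Separates A → Γ.trace ⊆ Ω := fun Γ hΓ ζ hζ => by
    obtain ⟨h1, h2, h3⟩ := hΓ.inv_notMem hζ
    exact ⟨⟨h1, factor_ne_zero hy h1 h3⟩, h1,
      factor_ne_zero hy (inv_ne_zero h1) (by rwa [inv_inv])⟩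
  -- every point outside of `Ω` is zero, a point of `A` or the reciprocal of one
  have hw : ∀ Γ : Contour, Γ.Separates A → ∀ a ∉ Ω, Γ.winding a = if a⁻¹ ∈ A then 0 else 1 := by
    intro Γ hΓ a ha
    split_ifs with ha'
    · have := (hΓ.2 _ ha').2.2
      rwa [inv_inv] at this
    · by_cases h0 : a = 0
      · rw [h0]
        exact hΓ.1.2
      · refine (hΓ.2 a ?_).1.2
        by_contra haA
        exact ha ⟨⟨h0, factor_ne_zero hy h0 ha'⟩, h0,
          factor_ne_zero hy (inv_ne_zero h0) (by rwa [inv_inv])⟩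
  refine Contour.integral_eq_of_winding_eq hΩ ?_ (hsub Γ hΓ) (hsub Γ' hΓ') fun a ha => by
    rw [hw Γ hΓ a ha, hw Γ' hΓ' a ha]
  have h0 : Ω ⊆ {0}ᶜ := fun ζ hζ => hζ.1.1
  exact (differentiableOn_inv.mono h0).mul ((hh.mono h0).div (hF.differentiableOn.mul (hFi.mono h0))
    fun ζ hζ => mul_ne_zero hζ.1.2 hζ.2.2)

/-- In a neighbourhood of a given point, the poles stay in a fixed disc, and outside of a suitable
box of exponents the factors have no zeros in a larger disc. -/
theorem exists_radius (M : MonomialSystem Y Λ) (H L : Finset Λ) {w : Y} (hw : w ∈ M.dom) :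
    ∃ R : ℝ, 1 < R ∧ ∃ N : Set Y, IsOpen N ∧ w ∈ N ∧ N ⊆ M.dom ∧
      (∀ y ∈ N, ∀ x ∈ M.poleSet H L y, ‖x‖ < R) ∧
      ∃ K : ℕ, ∀ y ∈ N, ∀ ζ : ℂ, ‖ζ‖ < 2 * R → M.tailFactor (box K) H L y ζ ≠ 0 := by
  classical
  obtain ⟨ρ, hρ, hρ1⟩ := exists_between (max_lt (M.norm_p_lt_one w hw) (M.norm_q_lt_one w hw))
  have hρ0 : 0 ≤ ρ := (norm_nonneg _).trans ((le_max_left _ _).trans hρ.le)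
  obtain ⟨R, hR1, hR⟩ : ∃ R : ℝ, 1 < R ∧ ∀ v ∈ H ∪ L, ‖M.χ v w‖ < R := by
    refine ⟨∑ v ∈ H ∪ L, ‖M.χ v w‖ + 2, ?_, fun v hv => ?_⟩
    · have : 0 ≤ ∑ v ∈ H ∪ L, ‖M.χ v w‖ := Finset.sum_nonneg fun v _ => norm_nonneg _
      linarith
    · have := Finset.single_le_sum (f := fun v => ‖M.χ v w‖) (fun v _ => norm_nonneg _) hv
      linarith
  have hev : ∀ᶠ y in 𝓝 w, y ∈ M.dom ∧ ‖M.p y‖ < ρ ∧ ‖M.q y‖ < ρ ∧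
      ∀ v ∈ H ∪ L, ‖M.χ v y‖ < R := by
    have hn := M.isOpen_dom.mem_nhds hw
    have hc : ∀ f : Y → ℂ, DifferentiableOn ℂ f M.dom → ∀ r, ‖f w‖ < r → ∀ᶠ y in 𝓝 w, ‖f y‖ < r :=
      fun f hf r hr => (hf.differentiableAt hn).continuousAt.norm.eventually_lt_const hr
    refine (eventually_mem_set.2 hn).and ((hc _ M.differentiableOn_p _
      ((le_max_left _ _).trans_lt hρ)).and ((hc _ M.differentiableOn_q _
      ((le_max_right _ _).trans_lt hρ)).and ?_))
    exact (Finset.eventually_all _).2 fun v hv => hc _ (M.differentiableOn_χ v) _ (hR v hv)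
  obtain ⟨N, hN, hNo, hwN⟩ := _root_.eventually_nhds_iff.1 hev
  have hR0 : 0 < R := by linarith
  obtain ⟨K, hK⟩ := exists_pow_lt_of_lt_one (show 0 < (R * (2 * R) ^ 2)⁻¹ by positivity) hρ1
  refine ⟨R, hR1, N, hNo, hwN, fun y hy => (hN y hy).1, fun y hy x hx => ?_, K, fun y hy ζ hζ => ?_⟩
  · obtain ⟨-, hp, hq, hχ⟩ := hN y hy
    have hle : ∀ (v : Λ) (a b : ℕ), ‖M.p y ^ a * M.q y ^ b * M.χ v y‖ ≤ ‖M.χ v y‖ := by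
      intro v a b
      rw [norm_mul, norm_mul, norm_pow, norm_pow]
      have h1 := pow_le_one₀ (n := a) (norm_nonneg (M.p y)) (by linarith)
      have h2 := pow_le_one₀ (n := b) (norm_nonneg (M.q y)) (by linarith)
      exact mul_le_of_le_one_left (norm_nonneg _) (mul_le_one₀ h1 (by positivity) h2)
    rcases hx with ⟨v, hv, a, b, rfl⟩ | ⟨v, hv, a, b, e⟩
    · exact (hle v a b).trans_lt (hχ v (Finset.mem_union_left _ hv))
    · have h1 : ‖x‖ ^ 2 < R := by
        rw [← norm_pow, e]
        exact (hle v a b).trans_lt (hχ v (Finset.mem_union_right _ hv))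
      by_contra h
      nlinarith [not_lt.1 h]
  · obtain ⟨hyd, hp, hq, hχ⟩ := hN y hy
    have hK' : ρ ^ K * (R * (2 * R) ^ 2) < 1 := by
      have hpos : 0 < R * (2 * R) ^ 2 := by positivity
      have := mul_lt_mul_of_pos_right hK hpos
      rwa [inv_mul_cancel₀ hpos.ne'] at this
    have hsmall : ∀ v ∈ H ∪ L, ∀ k ∉ box K, ∀ x : ℂ, ‖x‖ ≤ (2 * R) ^ 2 →
        M.p y ^ k.1 * M.q y ^ k.2 * (M.χ v y * x) ≠ 1 := by
      intro v hv k hk x hx e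
      have h1 : ‖M.p y ^ k.1 * M.q y ^ k.2‖ ≤ ρ ^ K := by
        have hpow : ∀ {m : ℕ} {z : ℂ}, ‖z‖ < ρ → ‖z ^ m‖ ≤ ρ ^ m := fun hz => by
          rw [norm_pow]
          gcongr
        have hpow1 : ∀ {m : ℕ} {z : ℂ}, ‖z‖ < ρ → ‖z ^ m‖ ≤ 1 := fun hz =>
          (hpow hz).trans (pow_le_one₀ hρ0 hρ1.le)
        have hk' : K ≤ k.1 ∨ K ≤ k.2 := by
          simp only [box, Finset.mem_product, Finset.mem_range] at hk
          omega
        rw [norm_mul]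
        rcases hk' with hk' | hk'
        · exact (mul_le_of_le_one_right (norm_nonneg _) (hpow1 hq)).trans
            ((hpow hp).trans (pow_le_pow_of_le_one hρ0 hρ1.le hk'))
        · exact (mul_le_of_le_one_left (norm_nonneg _) (hpow1 hp)).trans
            ((hpow hq).trans (pow_le_pow_of_le_one hρ0 hρ1.le hk'))
      have h2 : ‖M.p y ^ k.1 * M.q y ^ k.2 * (M.χ v y * x)‖ ≤ ρ ^ K * (R * (2 * R) ^ 2) := by
        rw [norm_mul, norm_mul (M.χ v y)]
        have := (hχ v hv).le
        gcongr
      rw [e, norm_one] at h2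
      linarith
    have hζ1 : ‖ζ‖ ≤ (2 * R) ^ 2 := by nlinarith
    have hζ2 : ‖ζ ^ 2‖ ≤ (2 * R) ^ 2 := by
      rw [norm_pow]
      gcongr
    refine mul_ne_zero (Finset.prod_ne_zero_iff.2 fun v hv => ?_)
      (Finset.prod_ne_zero_iff.2 fun v hv => ?_) <;>
      refine pochTail_ne_zero (by linarith) (by linarith) fun k hk => ?_
    · exact hsmall v (Finset.mem_union_left _ hv) k hk _ hζ1
    · exact hsmall v (Finset.mem_union_right _ hv) k hk _ hζ2

/-- The first of the two terms into which the integrand is split: all its poles in the annulus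
`(2 * R)⁻¹ < ‖ζ‖ < 2 * R` are in the pole set, so that a separating contour in the annulus may be
replaced by a large circle. -/
theorem integral_eq_of_large_circle (hy : y ∈ M.dom) {R : ℝ} (hR : 1 < R) {g : ℂ → ℂ}
    (hA : ∀ x ∈ M.poleSet H L y, ‖x‖ < R)
    (hg : DifferentiableOn ℂ g {ζ | ζ ≠ 0 ∧ ‖ζ‖ < 2 * R ∧ M.factor H L y ζ⁻¹ ≠ 0})
    {Γ : Contour} (hΓ : Γ.Separates (M.poleSet H L y))
    (hΓR : Γ.trace ⊆ {ζ | R⁻¹ < ‖ζ‖ ∧ ‖ζ‖ < R}) :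
    Γ.integral g = Contour.integral [ClosedCurve.circle 0 R] g := by
  have hR0 : 0 < R := by linarith
  have hF := differentiable_factor_right (H := H) (L := L) hy
  have hFi : ContinuousOn (fun ζ => M.factor H L y ζ⁻¹) {0}ᶜ :=
    (hF.differentiableOn.comp (t := univ) (differentiableOn_inv) fun _ _ => mem_univ _).continuousOn
  refine Contour.integral_eq_of_winding_eq ?_ hg ?_ ?_ ?_
  · have h1 := hFi.isOpen_inter_preimage isOpen_compl_singleton (isOpen_ne (x := 0))
    have h2 : IsOpen {ζ : ℂ | ‖ζ‖ < 2 * R} := isOpen_lt continuous_norm continuous_const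
    convert h1.inter h2 using 1
    ext ζ
    simp only [mem_ofPred_eq, mem_inter_iff, mem_compl_iff, mem_singleton_iff, mem_preimage]
    tauto
  · intro ζ hζ
    obtain ⟨h1, h2, h3⟩ := hΓ.inv_notMem hζ
    exact ⟨h1, by linarith [(hΓR hζ).2], factor_ne_zero hy (inv_ne_zero h1) (by rwa [inv_inv])⟩
  · intro ζ hζ
    rw [Contour.trace_circle hR0.le, mem_sphere_zero_iff_norm] at hζ
    have h0 : ζ ≠ 0 := norm_pos_iff.1 (by linarith)
    refine ⟨h0, by linarith, factor_ne_zero hy (inv_ne_zero h0) fun h => ?_⟩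
    rw [inv_inv] at h
    linarith [hA ζ h]
  · intro a ha
    by_cases h2R : 2 * R ≤ ‖a‖
    · rw [Contour.winding_circle_of_gt hR0.le (by rw [sub_zero]; linarith), Contour.winding,
        Contour.integral_inv_sub_eq_zero (R := 2 * R)
          (fun w hw => by linarith [(hΓR hw).2]) h2R, mul_zero]
    · by_cases h0 : a = 0
      · rw [h0, hΓ.1.2, Contour.winding_circle_of_lt (by simpa using hR0)]
      · have haA : a ∈ M.poleSet H L y := by
          by_contra h
          exact ha ⟨h0, not_le.1 h2R, factor_ne_zero hy (inv_ne_zero h0) (by rwa [inv_inv])⟩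
        rw [(hΓ.2 a haA).1.2, Contour.winding_circle_of_lt (by simpa using hA a haA)]

/-- The second term has the reciprocals of the pole set as poles, and the contour may be replaced
by a small circle. -/
theorem integral_eq_of_small_circle (hy : y ∈ M.dom) {R : ℝ} (hR : 1 < R) {g : ℂ → ℂ}
    (hA : ∀ x ∈ M.poleSet H L y, ‖x‖ < R)
    (hg : DifferentiableOn ℂ g {ζ | (2 * R)⁻¹ < ‖ζ‖ ∧ M.factor H L y ζ ≠ 0})
    {Γ : Contour} (hΓ : Γ.Separates (M.poleSet H L y))
    (hΓR : Γ.trace ⊆ {ζ | R⁻¹ < ‖ζ‖ ∧ ‖ζ‖ < R}) :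
    Γ.integral g = Contour.integral [ClosedCurve.circle 0 R⁻¹] g := by
  have hR0 : 0 < R := by linarith
  have hRi : 0 < R⁻¹ := inv_pos.2 hR0
  have hRR : (2 * R)⁻¹ < R⁻¹ := inv_strictAnti₀ hR0 (by linarith)
  have hF := differentiable_factor_right (H := H) (L := L) hy
  have hinv : ∀ x, x⁻¹ ∈ M.poleSet H L y → R⁻¹ < ‖x‖ := fun x hx => by
    have h1 := hA _ hx
    have hx0 : x ≠ 0 := fun e => zero_notMem_poleSet hy (by rwa [e, inv_zero] at hx)
    rw [norm_inv] at h1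
    exact (inv_lt_comm₀ (norm_pos_iff.2 hx0) hR0).1 h1
  refine Contour.integral_eq_of_winding_eq ?_ hg ?_ ?_ ?_
  · exact (isOpen_lt continuous_const continuous_norm).inter
      (hF.continuous.isOpen_preimage _ isOpen_ne)
  · intro ζ hζ
    obtain ⟨h1, h2, h3⟩ := hΓ.inv_notMem hζ
    exact ⟨by linarith [(hΓR hζ).1], factor_ne_zero hy h1 h3⟩
  · intro ζ hζ
    rw [Contour.trace_circle hRi.le, mem_sphere_zero_iff_norm] at hζ
    have h0 : ζ ≠ 0 := norm_pos_iff.1 (by linarith)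
    refine ⟨by linarith, factor_ne_zero hy h0 fun h => ?_⟩
    linarith [hinv ζ h]
  · intro a ha
    by_cases h2R : ‖a‖ ≤ (2 * R)⁻¹
    · -- near the origin the winding number of `Γ` is the one around zero
      have hlt : ‖a‖ < R⁻¹ := by linarith
      rw [Contour.winding_circle_of_lt (by simpa using hlt), ← hΓ.1.2, Contour.winding,
        Contour.winding]
      congr 1
      refine Contour.integral_inv_sub_eq (fun h => by linarith [(hΓR h).1]) hΓ.1.1 fun w hw => ?_
      have hw1 := (hΓR hw).1
      have hw0 : w ≠ 0 := norm_pos_iff.1 (by linarith)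
      have : (w - a) / (w - 0) = 1 + -(a / w) := by
        field_simp
        ring
      rw [this]
      apply Complex.mem_slitPlane_of_norm_lt_one
      rw [norm_neg, norm_div, div_lt_one (norm_pos_iff.2 hw0)]
      linarith
    · have h0 : a ≠ 0 := norm_pos_iff.1 ((by positivity : 0 < (2 * R)⁻¹).trans (not_le.1 h2R))
      have haA : a⁻¹ ∈ M.poleSet H L y := by
        by_contra h
        exact ha ⟨not_le.1 h2R, factor_ne_zero hy h0 h⟩
      have := (hΓ.2 _ haA).2.2
      rw [inv_inv] at this
      rw [this, Contour.winding_circle_of_gt hRi.le (by simpa using hinv a haA)]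

end MonomialSystem

end ResidueExtension

/-! ### Integration over one variable -/

section ResidueExtension

open Filter Topology Metric Set

namespace MonomialSystem

variable {Y Λ : Type*} [NormedAddCommGroup Y] [NormedSpace ℂ Y] [AddCommGroup Λ]
  {M : MonomialSystem Y Λ} {H L THH THL TLL : Finset Λ} {y : Y}

/-- The product of the Pochhammer symbols of the monomials at which contours get pinched. -/
noncomputable def pinchFactor (M : MonomialSystem Y Λ) (THH THL TLL : Finset Λ) (y : Y) : ℂ :=
  (∏ v ∈ THH, M.poch v y) * (∏ v ∈ THL, M.poch v y) * ∏ v ∈ TLL, M.poch v y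

/-- Where nothing is pinched, separating contours exist. -/
theorem exists_separates_poleSet (hy : y ∈ M.dom)
    (hHH : ∀ v ∈ H, ∀ w ∈ H, v + w ∈ THH) (hHL : ∀ v ∈ H, ∀ w ∈ L, 2 • v + w ∈ THL)
    (hLL : ∀ v ∈ L, ∀ w ∈ L, v + w ∈ TLL) (hc : M.pinchFactor THH THL TLL y ≠ 0) {R : ℝ}
    (hR : 1 < R) (hA : ∀ x ∈ M.poleSet H L y, ‖x‖ < R) :
    ∃ Γ : Contour, Γ.Separates (M.poleSet H L y) ∧ Γ.trace ⊆ {ζ | R⁻¹ < ‖ζ‖ ∧ ‖ζ‖ < R} := by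
  rw [pinchFactor, mul_ne_zero_iff, mul_ne_zero_iff, Finset.prod_ne_zero_iff,
    Finset.prod_ne_zero_iff, Finset.prod_ne_zero_iff] at hc
  exact Contour.exists_separates hR (zero_notMem_poleSet hy) hA
    (fun ρ hρ => finite_poleSet hy hρ) fun x hx x' hx' => mul_ne_one_of_mem_poleSet hy
      (fun v hv w hw => hc.1.1 _ (hHH v hv w hw)) (fun v hv w hw => hc.1.2 _ (hHL v hv w hw))
      (fun v hv w hw => hc.2 _ (hLL v hv w hw)) hx hx'

/-- Integration over one variable: if `h` is holomorphic, the integral of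
`h / (factor ζ * factor ζ⁻¹)` over separating contours, multiplied by the Pochhammer symbols of the
pinches, extends to a holomorphic function of the parameters. Near a given point of the domain,
`exists_bezout` splits the integrand into two terms, of which the first has no poles at the
reciprocals of the pole set and the second none at the pole set, as far as an annulus is
concerned. Their contours may be replaced by fixed circles, so that the integrals are holomorphic
even where the contours for the original integrand get pinched. The embedding `φ` into an ordered
group only serves to order the monomials. -/
theorem exists_residueExtension [ProperSpace Y] {Λ' : Type*} [AddCommGroup Λ'] [LinearOrder Λ']
    [IsOrderedAddMonoid Λ'] {φ : Λ →+ Λ'} (hφ : Function.Injective φ) (M : MonomialSystem Y Λ)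
    (hHH : ∀ v ∈ H, ∀ w ∈ H, v + w ∈ THH)
    (hHL : ∀ v ∈ H, ∀ w ∈ L, 2 • v + w ∈ THL) (hLL : ∀ v ∈ L, ∀ w ∈ L, v + w ∈ TLL)
    {h : Y → ℂ → ℂ} (hh : DifferentiableOn ℂ (Function.uncurry h) (M.dom ×ˢ {0}ᶜ))
    (hdense : M.dom ⊆ closure {y ∈ M.dom | M.pinchFactor THH THL TLL y ≠ 0}) :
    ∃ Ψ : Y → ℂ, DifferentiableOn ℂ Ψ M.dom ∧ ∀ y ∈ M.dom, M.pinchFactor THH THL TLL y ≠ 0 →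
      ∀ Γ : Contour, Γ.Separates (M.poleSet H L y) →
        M.pinchFactor THH THL TLL y * ((2 * Real.pi * Complex.I)⁻¹ *
          Γ.integral fun ζ => ζ⁻¹ * (h y ζ / (M.factor H L y ζ * M.factor H L y ζ⁻¹))) = Ψ y := by
  classical
  let _ : LinearOrder Λ := LinearOrder.lift' φ hφ
  have : IsOrderedAddMonoid Λ :=
    Function.Injective.isOrderedAddMonoid φ (map_add φ) Iff.rfl
  let S : Set Y := {y ∈ M.dom | M.pinchFactor THH THL TLL y ≠ 0}
  have hh' : ∀ y ∈ M.dom, DifferentiableOn ℂ (h y) {0}ᶜ := fun y hy =>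
    hh.comp (f := fun ζ => (y, ζ)) (by fun_prop) fun ζ hζ => ⟨hy, hζ⟩
  let J : Y → ℂ → ℂ := fun y ζ => ζ⁻¹ * (h y ζ / (M.factor H L y ζ * M.factor H L y ζ⁻¹))
  -- the common value for all separating contours, if there are any
  let val : Y → ℂ := fun y =>
    if hex : ∃ Γ : Contour, Γ.Separates (M.poleSet H L y) then
      M.pinchFactor THH THL TLL y * ((2 * Real.pi * Complex.I)⁻¹ * hex.choose.integral (J y))
    else 0
  have hval : ∀ y ∈ M.dom, ∀ Γ : Contour, Γ.Separates (M.poleSet H L y) →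
      M.pinchFactor THH THL TLL y * ((2 * Real.pi * Complex.I)⁻¹ * Γ.integral (J y)) = val y := by
    intro y hy Γ hΓ
    have hex : ∃ Γ : Contour, Γ.Separates (M.poleSet H L y) := ⟨Γ, hΓ⟩
    simp only [val, dif_pos hex]
    rw [show Γ.integral (J y) = hex.choose.integral (J y) from
      integral_eq_of_separates hy (hh' y hy) hΓ hex.choose_spec]
  suffices hloc : ∀ w ∈ M.dom, ∃ N ∈ 𝓝 w, ∃ Ψ : Y → ℂ, DifferentiableOn ℂ Ψ N ∧
      ∀ y ∈ N ∩ S, Ψ y = val y by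
    obtain ⟨Ψ, hΨ, hΨS⟩ := exists_differentiableOn_of_local (s := M.dom) (S := S) (g := val)
      (fun y hy => hy.1) hdense hloc
    exact ⟨Ψ, hΨ, fun y hy hc Γ hΓ => (hval y hy Γ hΓ).trans (hΨS y ⟨hy, hc⟩).symm⟩
  intro w hw
  obtain ⟨R, hR, N, hNo, hwN, hNd, hNA, K, hK⟩ := exists_radius M H L hw
  obtain ⟨A, B, hA, hB, hAB⟩ := exists_bezout M hHH hHL hLL K
  have hR0 : 0 < R := by linarith
  have hRi : 0 < R⁻¹ := inv_pos.2 hR0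
  have hRi1 : R⁻¹ < 1 := inv_lt_one_of_one_lt₀ hR
  let T := M.tailFactor (box K) H L
  let Q := M.factor H L
  -- up to factors that do not depend on `ζ`, the integrand is `g₁ + g₂`
  let g₁ : Y → ℂ → ℂ := fun y ζ => ζ⁻¹ * (h y ζ * A (y, ζ) / (T y ζ * Q y ζ⁻¹))
  let g₂ : Y → ℂ → ℂ := fun y ζ => ζ⁻¹ * (h y ζ * B (y, ζ) / (Q y ζ * T y ζ⁻¹))
  let S₁ : Set (Y × ℂ) := {x | x.1 ∈ N ∧ x.2 ≠ 0 ∧ ‖x.2‖ < 2 * R ∧ Q x.1 x.2⁻¹ ≠ 0}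
  let S₂ : Set (Y × ℂ) := {x | x.1 ∈ N ∧ (2 * R)⁻¹ < ‖x.2‖ ∧ Q x.1 x.2 ≠ 0}
  have h2R : 0 < (2 * R)⁻¹ := by positivity
  have hne₂ : ∀ ζ : ℂ, (2 * R)⁻¹ < ‖ζ‖ → ζ ≠ 0 ∧ ‖ζ⁻¹‖ < 2 * R := fun ζ hζ => by
    have h0 : 0 < ‖ζ‖ := h2R.trans hζ
    refine ⟨norm_pos_iff.1 h0, ?_⟩
    rw [norm_inv]
    exact (inv_lt_comm₀ h0 (by positivity)).2 hζ
  have hsub₁ : S₁ ⊆ M.dom ×ˢ {0}ᶜ := fun x hx => ⟨hNd hx.1, hx.2.1⟩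
  have hsub₂ : S₂ ⊆ M.dom ×ˢ {0}ᶜ := fun x hx => ⟨hNd hx.1, (hne₂ _ hx.2.1).1⟩
  have hu : M.dom ×ˢ ({0}ᶜ : Set ℂ) ⊆ M.dom ×ˢ univ := prod_mono subset_rfl (subset_univ _)
  have hinv : DifferentiableOn ℂ (fun x : Y × ℂ => (x.2)⁻¹) (M.dom ×ˢ {0}ᶜ) :=
    differentiableOn_snd.inv fun x hx => hx.2
  have hflip : MapsTo (fun x : Y × ℂ => (x.1, x.2⁻¹)) (M.dom ×ˢ {0}ᶜ) (M.dom ×ˢ univ) :=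
    fun x hx => ⟨hx.1, mem_univ _⟩
  have hTd : DifferentiableOn ℂ (fun x : Y × ℂ => T x.1 x.2) (M.dom ×ˢ {0}ᶜ) :=
    (differentiableOn_tailFactor (box K) H L).mono hu
  have hQd : DifferentiableOn ℂ (fun x : Y × ℂ => Q x.1 x.2) (M.dom ×ˢ {0}ᶜ) :=
    (differentiableOn_factor H L).mono hu
  have hTi : DifferentiableOn ℂ (fun x : Y × ℂ => T x.1 x.2⁻¹) (M.dom ×ˢ {0}ᶜ) :=
    (differentiableOn_tailFactor (box K) H L).comp (differentiableOn_fst.prodMk hinv) hflip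
  have hQi : DifferentiableOn ℂ (fun x : Y × ℂ => Q x.1 x.2⁻¹) (M.dom ×ˢ {0}ᶜ) :=
    (differentiableOn_factor H L).comp (differentiableOn_fst.prodMk hinv) hflip
  have hnum₁ : DifferentiableOn ℂ (fun x : Y × ℂ => h x.1 x.2 * A (x.1, x.2)) S₁ :=
    (hh.mono hsub₁).mul (hA.mono hsub₁)
  have hden₁ : DifferentiableOn ℂ (fun x : Y × ℂ => T x.1 x.2 * Q x.1 x.2⁻¹) S₁ :=
    (hTd.mono hsub₁).mul (hQi.mono hsub₁)
  have hden0₁ : ∀ x ∈ S₁, T x.1 x.2 * Q x.1 x.2⁻¹ ≠ 0 := fun x hx =>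
    mul_ne_zero (hK _ hx.1 _ hx.2.2.1) hx.2.2.2
  have hquot₁ : DifferentiableOn ℂ (fun x : Y × ℂ => h x.1 x.2 * A (x.1, x.2) /
      (T x.1 x.2 * Q x.1 x.2⁻¹)) S₁ :=
    (hnum₁.mul (hden₁.inv hden0₁)).congr fun x _ => div_eq_mul_inv _ _
  have hg₁ : DifferentiableOn ℂ (fun x : Y × ℂ => g₁ x.1 x.2) S₁ := (hinv.mono hsub₁).mul hquot₁
  have hnum₂ : DifferentiableOn ℂ (fun x : Y × ℂ => h x.1 x.2 * B (x.1, x.2)) S₂ :=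
    (hh.mono hsub₂).mul (hB.mono hsub₂)
  have hden₂ : DifferentiableOn ℂ (fun x : Y × ℂ => Q x.1 x.2 * T x.1 x.2⁻¹) S₂ :=
    (hQd.mono hsub₂).mul (hTi.mono hsub₂)
  have hden0₂ : ∀ x ∈ S₂, Q x.1 x.2 * T x.1 x.2⁻¹ ≠ 0 := fun x hx =>
    mul_ne_zero hx.2.2 (hK _ hx.1 _ (hne₂ _ hx.2.1).2)
  have hquot₂ : DifferentiableOn ℂ (fun x : Y × ℂ => h x.1 x.2 * B (x.1, x.2) /
      (Q x.1 x.2 * T x.1 x.2⁻¹)) S₂ :=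
    (hnum₂.mul (hden₂.inv hden0₂)).congr fun x _ => div_eq_mul_inv _ _
  have hg₂ : DifferentiableOn ℂ (fun x : Y × ℂ => g₂ x.1 x.2) S₂ := (hinv.mono hsub₂).mul hquot₂
  have hcirc₁ : ∀ y ∈ N, ∀ ζ ∈ Contour.trace [ClosedCurve.circle 0 R], (y, ζ) ∈ S₁ := by
    intro y hy ζ hζ
    rw [Contour.trace_circle hR0.le, mem_sphere_zero_iff_norm] at hζ
    have h0 : ζ ≠ 0 := norm_pos_iff.1 (by linarith)
    refine ⟨hy, h0, by simp only; linarith, factor_ne_zero (hNd hy) (inv_ne_zero h0) fun h => ?_⟩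
    rw [inv_inv] at h
    linarith [hNA y hy ζ h]
  have hcirc₂ : ∀ y ∈ N, ∀ ζ ∈ Contour.trace [ClosedCurve.circle 0 R⁻¹], (y, ζ) ∈ S₂ := by
    intro y hy ζ hζ
    rw [Contour.trace_circle hRi.le, mem_sphere_zero_iff_norm] at hζ
    have h0 : ζ ≠ 0 := norm_pos_iff.1 (by linarith)
    refine ⟨hy, ?_, factor_ne_zero (hNd hy) h0 fun h => ?_⟩
    · simp only [hζ]
      exact inv_strictAnti₀ hR0 (by linarith)
    · have := hNA y hy _ h
      rw [norm_inv, hζ, inv_inv] at this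
      linarith
  have hint : ∀ (g : Y → ℂ → ℂ) (S' : Set (Y × ℂ)) (Γ : Contour),
      DifferentiableOn ℂ (fun x : Y × ℂ => g x.1 x.2) S' → (∀ y ∈ N, ∀ ζ ∈ Γ.trace, (y, ζ) ∈ S') →
      DifferentiableOn ℂ (fun y => Γ.integral (g y)) N := by
    intro g S' Γ hg hS'
    refine Contour.differentiableOn_integral Γ hNo (hg.continuousOn.mono ?_) fun ζ hζ => ?_
    · exact fun x hx => hS' _ hx.1 _ hx.2
    · exact hg.comp (f := fun y => (y, ζ)) (by fun_prop) fun y hy => hS' y hy ζ hζ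
  -- the part of the pinch factor which is not contained in the combination of `A` and `B`
  let tl : Λ → Y → ℂ := fun v y => pochTail (box (3 * K)) (M.p y) (M.q y) (M.χ v y)
  let cT : Y → ℂ := fun y => (∏ v ∈ THH, tl v y) * (∏ v ∈ THL, tl v y) * ∏ v ∈ TLL, tl v y
  have htl : ∀ v, DifferentiableOn ℂ (tl v) M.dom := fun v =>
    differentiableOn_pochTail_comp _ M.differentiableOn_p M.differentiableOn_q
      (M.differentiableOn_χ v) M.norm_p_lt_one M.norm_q_lt_one
  have hcT : DifferentiableOn ℂ cT M.dom :=
    ((differentiableOn_prod _ fun v _ => htl v).mul (differentiableOn_prod _ fun v _ => htl v)).mul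
      (differentiableOn_prod _ fun v _ => htl v)
  refine ⟨N, hNo.mem_nhds hwN, fun y => cT y * ((2 * Real.pi * Complex.I)⁻¹ *
    (Contour.integral [ClosedCurve.circle 0 R] (g₁ y) +
      Contour.integral [ClosedCurve.circle 0 R⁻¹] (g₂ y))), ?_, ?_⟩
  · exact (hcT.mono hNd).mul (((hint g₁ S₁ _ hg₁ hcirc₁).add (hint g₂ S₂ _ hg₂ hcirc₂)).const_mul _)
  · rintro y ⟨hyN, hy, hc⟩
    obtain ⟨Γ, hΓ, hΓR⟩ := exists_separates_poleSet hy hHH hHL hLL hc hR (hNA y hyN)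
    rw [← hval y hy Γ hΓ]
    have hm₁ : ∀ ζ, ζ ≠ 0 ∧ ‖ζ‖ < 2 * R ∧ Q y ζ⁻¹ ≠ 0 → (y, ζ) ∈ S₁ := fun ζ hζ => ⟨hyN, hζ⟩
    have hm₂ : ∀ ζ, (2 * R)⁻¹ < ‖ζ‖ ∧ Q y ζ ≠ 0 → (y, ζ) ∈ S₂ := fun ζ hζ => ⟨hyN, hζ⟩
    have hd₁ : DifferentiableOn ℂ (g₁ y) {ζ | ζ ≠ 0 ∧ ‖ζ‖ < 2 * R ∧ Q y ζ⁻¹ ≠ 0} :=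
      hg₁.comp (f := fun ζ => (y, ζ)) (by fun_prop) hm₁
    have hd₂ : DifferentiableOn ℂ (g₂ y) {ζ | (2 * R)⁻¹ < ‖ζ‖ ∧ Q y ζ ≠ 0} :=
      hg₂.comp (f := fun ζ => (y, ζ)) (by fun_prop) hm₂
    have hΓ₁ : ∀ ζ ∈ Γ.trace, ζ ≠ 0 ∧ ‖ζ‖ < 2 * R ∧ Q y ζ⁻¹ ≠ 0 := fun ζ hζ => by
      obtain ⟨h1, h2, h3⟩ := hΓ.inv_notMem hζ
      exact ⟨h1, by linarith [(hΓR hζ).2], factor_ne_zero hy (inv_ne_zero h1) (by rwa [inv_inv])⟩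
    have hΓ₂ : ∀ ζ ∈ Γ.trace, (2 * R)⁻¹ < ‖ζ‖ ∧ Q y ζ ≠ 0 := fun ζ hζ => by
      obtain ⟨h1, h2, h3⟩ := hΓ.inv_notMem hζ
      have : (2 * R)⁻¹ < R⁻¹ := inv_strictAnti₀ hR0 (by linarith)
      exact ⟨by linarith [(hΓR hζ).1], factor_ne_zero hy h1 h3⟩
    beta_reduce
    rw [← integral_eq_of_large_circle hy hR (hNA y hyN) hd₁ hΓ hΓR,
      ← integral_eq_of_small_circle hy hR (hNA y hyN) hd₂ hΓ hΓR,
      ← Contour.integral_add (hd₁.continuousOn.mono hΓ₁) (hd₂.continuousOn.mono hΓ₂)]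
    let cH : ℂ := (∏ v ∈ THH, M.pochHead (3 * K) v y) * (∏ v ∈ THL, M.pochHead (3 * K) v y) *
      ∏ v ∈ TLL, M.pochHead (3 * K) v y
    have hcc : M.pinchFactor THH THL TLL y = cT y * cH := by
      simp only [pinchFactor, cT, cH, tl, poch_eq_pochHead_mul (3 * K) hy, Finset.prod_mul_distrib]
      ring
    have e : EqOn (fun ζ => g₁ y ζ + g₂ y ζ) (fun ζ => cH * J y ζ) Γ.trace := by
      intro ζ hζ
      obtain ⟨h0, h1, h2⟩ := hΓ₁ ζ hζ
      obtain ⟨h3, h4⟩ := hΓ₂ ζ hζ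
      have hAB' := hAB y hy ζ h0
      have hT1 : T y ζ ≠ 0 := hK y hyN ζ h1
      have hT2 : T y ζ⁻¹ ≠ 0 := hK y hyN _ (hne₂ ζ h3).2
      have hf1 := factor_eq_headFactor_mul (H := H) (L := L) K hy ζ
      have hf2 := factor_eq_headFactor_mul (H := H) (L := L) K hy ζ⁻¹
      change Q y ζ = _ * T y ζ at hf1
      change Q y ζ⁻¹ = _ * T y ζ⁻¹ at hf2
      have hc : cH = A (y, ζ) * M.headFactor K H L y ζ + B (y, ζ) * M.headFactor K H L y ζ⁻¹ :=
        hAB'.symm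
      have ha : M.headFactor K H L y ζ ≠ 0 := fun h => h4 (by rw [hf1, h, zero_mul])
      have hb : M.headFactor K H L y ζ⁻¹ ≠ 0 := fun h => h2 (by rw [hf2, h, zero_mul])
      have hJ : J y ζ = ζ⁻¹ * (h y ζ / (Q y ζ * Q y ζ⁻¹)) := rfl
      simp only [g₁, g₂]
      rw [hJ, hc, hf1, hf2]
      generalize M.headFactor K H L y ζ = a at *
      generalize M.headFactor K H L y ζ⁻¹ = b at *
      generalize T y ζ⁻¹ = t at *
      generalize T y ζ = t' at *
      generalize A (y, ζ) = x at *
      generalize B (y, ζ) = x' at *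
      field_simp
    rw [Contour.integral_congr e, Contour.integral_const_mul, hcc]
    ring

end MonomialSystem

end ResidueExtension

/-! ### Path monomials -/

section PathMonomials

namespace HalfEdgeGraph

/-- Exponent vectors of Laurent monomials in the labels of the half-edges, the labels of the edges
and the variables at the vertices. -/
abbrev Monomial (n : ℕ) (H E : Type*) : Type _ := H ⊕ E ⊕ Fin n → ℤ

variable {n : ℕ} {H E : Type*} {G : HalfEdgeGraph n H E}

open Classical in
/-- The label of a half-edge as a formal monomial. -/
noncomputable def halfMon (n : ℕ) (E : Type*) {H : Type*} (h : H) : Monomial n H E :=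
  Pi.single (Sum.inl h) 1

open Classical in
/-- The label of an edge as a formal monomial. -/
noncomputable def edgeMon (n : ℕ) (H : Type*) {E : Type*} (e : E) : Monomial n H E :=
  Pi.single (Sum.inr (Sum.inl e)) 1

open Classical in
/-- The variable at a vertex as a formal monomial. -/
noncomputable def vertMon (H E : Type*) {n : ℕ} (k : Fin n) : Monomial n H E :=
  Pi.single (Sum.inr (Sum.inr k)) 1

/-- The monomial of a list of oriented edges. -/
noncomputable def listMon (n : ℕ) (H : Type*) {E : Type*} (l : List (E × Bool)) :
    Monomial n H E :=
  (l.map fun d => edgeMon n H d.1).sum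

/-- `y` is the monomial of a path of length `ℓ` which begins with a half-edge, runs through
vertices of `S` and arrives at a vertex. Besides the half-edges of the graph, an edge
coming from a vertex `k` outside of `T` counts as two half-edges, whose labels are multiplied by
the variable at `k` and its reciprocal. -/
inductive Arrival (G : HalfEdgeGraph n H E) (S T : Finset (Fin n)) :
    Fin n → ℕ → Monomial n H E → Prop
  | half (h : H) : Arrival G S T (G.base h) 1 (halfMon n E h)
  | edge (d : E × Bool) (s : ℤ) (hs : s = 1 ∨ s = -1) (hd : G.start d ∉ T) :
      Arrival G S T (G.finish d) 1 (s • vertMon H E (G.start d) + edgeMon n H d.1)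
  | step (d : E × Bool) {k : Fin n} {ℓ : ℕ} {y : Monomial n H E} (h : Arrival G S T k ℓ y)
      (hk : k ∈ S) (hd : G.start d = k) : Arrival G S T (G.finish d) (ℓ + 1) (y + edgeMon n H d.1)

/-- `w` is the monomial of a path of `ℓ ≥ 1` edges from `a` to another vertex whose intermediate
vertices belong to `S`. -/
inductive Walk (G : HalfEdgeGraph n H E) (S : Finset (Fin n)) (a : Fin n) :
    Fin n → ℕ → Monomial n H E → Prop
  | edge (d : E × Bool) (hd : G.start d = a) : Walk G S a (G.finish d) 1 (edgeMon n H d.1)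
  | step (d : E × Bool) {k : Fin n} {ℓ : ℕ} {w : Monomial n H E} (h : Walk G S a k ℓ w)
      (hk : k ∈ S) (hd : G.start d = k) : Walk G S a (G.finish d) (ℓ + 1) (w + edgeMon n H d.1)

/-- `v` is the monomial of a path of length `L` between two half-edges which runs through vertices
of `S`, an edge to a vertex outside of `S` being regarded as two half-edges (if the path does not
pass through a vertex of `S`, then `v` is one of the monomials in the denominator). -/
def OpenSegment (G : HalfEdgeGraph n H E) (S : Finset (Fin n)) (L : ℕ) (v : Monomial n H E) :
    Prop :=
  (∃ k y, ∃ s : ℤ, k ∉ S ∧ (s = 1 ∨ s = -1) ∧ G.Arrival S S k L y ∧ v = y + s • vertMon H E k) ∨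
    ∃ h ℓ y, G.base h ∈ S ∧ G.Arrival S S (G.base h) ℓ y ∧ L = ℓ + 1 ∧ v = y + halfMon n E h

/-- The same oriented edge traversed backwards. -/
def flip (d : E × Bool) : E × Bool := (d.1, !d.2)

theorem start_flip (d : E × Bool) : G.start (flip d) = G.finish d := by
  rcases d with ⟨e, _ | _⟩ <;> rfl

theorem finish_flip (d : E × Bool) : G.finish (flip d) = G.start d := by
  rcases d with ⟨e, _ | _⟩ <;> rfl

theorem start_ne_finish (d : E × Bool) : G.start d ≠ G.finish d := by
  rcases d with ⟨e, _ | _⟩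
  · exact (G.src_ne_tgt e).symm
  · exact G.src_ne_tgt e

variable {S S' T T' : Finset (Fin n)} {i k a b : Fin n} {ℓ ℓ' : ℕ} {y y' w w' : Monomial n H E}

theorem Arrival.mono (h : G.Arrival S T k ℓ y) (hS : S ⊆ S') (hT : T' ⊆ T) :
    G.Arrival S' T' k ℓ y := by
  induction h with
  | half h => exact .half h
  | edge d s hs hd => exact .edge d s hs fun h => hd (hT h)
  | step d _ hk hd ih => exact .step d ih (hS hk) hd

theorem Walk.mono (h : G.Walk S a k ℓ w) (hS : S ⊆ S') : G.Walk S' a k ℓ w := by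
  induction h with
  | edge d hd => exact .edge d hd
  | step d _ hk hd ih => exact .step d ih (hS hk) hd

/-- Following an edge backwards. -/
theorem Arrival.step_back (d : E × Bool) (h : G.Arrival S T (G.finish d) ℓ y)
    (hk : G.finish d ∈ S) : G.Arrival S T (G.start d) (ℓ + 1) (y + edgeMon n H d.1) := by
  have := Arrival.step (flip d) h hk (start_flip d)
  rwa [finish_flip] at this

theorem Arrival.edge_back (d : E × Bool) (s : ℤ) (hs : s = 1 ∨ s = -1) (hd : G.finish d ∉ T) :
    G.Arrival S T (G.start d) 1 (s • vertMon H E (G.finish d) + edgeMon n H d.1) := by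
  have := Arrival.edge (G := G) (S := S) (T := T) (flip d) s hs (by rwa [start_flip])
  rwa [finish_flip, start_flip] at this

theorem Arrival.follow (h : G.Arrival S T a ℓ y) (ha : a ∈ S) (hw : G.Walk S a k ℓ' w) :
    G.Arrival S T k (ℓ + ℓ') (y + w) := by
  induction hw with
  | edge d hd => exact .step d h ha hd
  | step d _ hk hd ih =>
    rw [← add_assoc, ← add_assoc]
    exact .step d ih hk hd

theorem Walk.trans (h : G.Walk S a b ℓ w) (hb : b ∈ S) (h' : G.Walk S b k ℓ' w') :
    G.Walk S a k (ℓ + ℓ') (w + w') := by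
  induction h' with
  | edge d hd => exact .step d h hb hd
  | step d _ hk hd ih =>
    rw [← add_assoc, ← add_assoc]
    exact .step d ih hk hd

/-- Following a walk backwards. -/
theorem Arrival.follow_back (hw : G.Walk S a k ℓ' w) (hk : k ∈ S) (h : G.Arrival S T k ℓ y) :
    G.Arrival S T a (ℓ + ℓ') (y + w) := by
  induction hw generalizing ℓ y with
  | edge d hd =>
    subst hd
    exact h.step_back d hk
  | step d _ hk' hd ih =>
    have := ih hk' (by
      have := h.step_back d hk
      rwa [hd] at this)
    convert this using 1
    · ring
    · abel

/-- The reverse of a walk which leaves `T` at the end. -/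
theorem Walk.arrival_back (hw : G.Walk S a k ℓ w) (hk : k ∉ T) {s : ℤ} (hs : s = 1 ∨ s = -1) :
    G.Arrival S T a ℓ (s • vertMon H E k + w) := by
  cases hw with
  | edge d hd =>
    subst hd
    exact .edge_back d s hs hk
  | @step d k ℓ w hw hk' hd =>
    subst hd
    have := Arrival.follow_back hw hk' (.edge_back d s hs hk)
    convert this using 1
    · ring
    · abel

/-- Two paths arriving at the same vertex of `S` can be joined. -/
theorem Arrival.join (h : G.Arrival S S k ℓ y) (hk : k ∈ S) (h' : G.Arrival S S k ℓ' y') :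
    G.OpenSegment S (ℓ + ℓ') (y + y') := by
  induction h' generalizing ℓ y with
  | half h' => exact Or.inr ⟨h', ℓ, y, hk, h, rfl, rfl⟩
  | edge d s hs hd => exact Or.inl ⟨_, _, s, hd, hs, h.step_back d hk, by abel⟩
  | step d _ hk' hd ih =>
    have := ih (by
      have := h.step_back d hk
      rwa [hd] at this) hk'
    convert this using 1
    · ring
    · abel

/-- If the vertex `i` is no longer regarded as an outer one, then the paths coming from `i` are not
among the arrivals any more. -/
theorem Arrival.cases_insert (h : G.Arrival S T k ℓ y) :
    G.Arrival S (insert i T) k ℓ y ∨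
      ∃ w, ∃ s : ℤ, (s = 1 ∨ s = -1) ∧ G.Walk S i k ℓ w ∧ y = s • vertMon H E i + w := by
  induction h with
  | half h => exact Or.inl (.half h)
  | edge d s hs hd =>
    by_cases hi : G.start d = i
    · exact Or.inr ⟨_, s, hs, .edge d hi, by rw [hi]⟩
    · exact Or.inl (.edge d s hs (by simp [hi, hd]))
  | step d _ hk hd ih =>
    rcases ih with ih | ⟨w, s, hs, hw, rfl⟩
    · exact Or.inl (.step d ih hk hd)
    · exact Or.inr ⟨_, s, hs, .step d hw hk hd, by abel⟩

/-- What becomes of the open segments through `S` when `i` is to be integrated next. -/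
theorem OpenSegment.cases_insert (h : G.OpenSegment S ℓ y) :
    ((∃ k x, ∃ s : ℤ, k ∉ insert i S ∧ (s = 1 ∨ s = -1) ∧ G.Arrival S (insert i S) k ℓ x ∧
        y = x + s • vertMon H E k) ∨
      ∃ h ℓ' x, G.base h ∈ S ∧ G.Arrival S (insert i S) (G.base h) ℓ' x ∧ ℓ = ℓ' + 1 ∧
        y = x + halfMon n E h) ∨
    (∃ x, ∃ s : ℤ, (s = 1 ∨ s = -1) ∧ G.Arrival S (insert i S) i ℓ x ∧
      y = x + s • vertMon H E i) ∨
    ∃ x, ∃ s : ℤ, (s = 2 ∨ s = -2 ∨ s = 0) ∧ G.Walk S i i ℓ x ∧ y = x + s • vertMon H E i := by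
  rcases h with ⟨k, x, s, hk, hs, hx, rfl⟩ | ⟨h, ℓ', x, hh, hx, rfl, rfl⟩
  · rcases hx.cases_insert (i := i) with hx | ⟨w, s', hs', hw, rfl⟩
    · by_cases hki : k = i
      · subst hki
        exact Or.inr (Or.inl ⟨x, s, hs, hx, rfl⟩)
      · exact Or.inl (Or.inl ⟨k, x, s, by simp [hki, hk], hs, hx, rfl⟩)
    · by_cases hki : k = i
      · subst hki
        refine Or.inr (Or.inr ⟨w, s' + s, ?_, hw, by rw [add_smul]; abel⟩)
        omega
      · exact Or.inr (Or.inl ⟨_, s', hs', hw.arrival_back (by simp [hki, hk]) hs, by abel⟩)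
  · rcases hx.cases_insert (i := i) with hx | ⟨w, s', hs', hw, rfl⟩
    · exact Or.inl (Or.inr ⟨h, ℓ', x, hh, hx, rfl, rfl⟩)
    · refine Or.inr (Or.inl ⟨halfMon n E h + w, s', hs', ?_, ?_⟩)
      · exact (add_comm 1 ℓ') ▸ Arrival.follow_back hw hh (.half h)
      · abel

/-- A walk contains an edge from a vertex to a different one, so that the closed walks have
intermediate vertices. -/
theorem Walk.nonempty_of_closed (h : G.Walk S a a ℓ w) : S.Nonempty := by
  rcases S.eq_empty_or_nonempty with rfl | hS
  · exfalso
    generalize hk : a = k at h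
    have h : G.Walk ∅ a k ℓ w := hk ▸ h
    cases h with
    | edge d hd => exact start_ne_finish d (hd.trans hk)
    | step d _ hk' => simp at hk'
  · exact hS

section Degrees

variable [Fintype H] [Fintype E]

open Classical in
/-- The number of sides of edges and half-edges in a monomial which are attached to the vertex
`i`. -/
noncomputable def degAt (G : HalfEdgeGraph n H E) (i : Fin n) : Monomial n H E →+ ℤ where
  toFun v := ∑ h, (if G.base h = i then v (Sum.inl h) else 0) +
    ∑ e, ((if G.src e = i then v (Sum.inr (Sum.inl e)) else 0) +
      if G.tgt e = i then v (Sum.inr (Sum.inl e)) else 0)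
  map_zero' := by simp
  map_add' v w := by
    simp only [Pi.add_apply, Finset.sum_add_distrib, ite_add_zero]
    ring

/-- The length of a monomial: its degree in the labels. -/
noncomputable def labelDeg (n : ℕ) (H E : Type*) [Fintype H] [Fintype E] :
    Monomial n H E →+ ℤ where
  toFun v := ∑ h, v (Sum.inl h) + ∑ e, v (Sum.inr (Sum.inl e))
  map_zero' := by simp
  map_add' v w := by
    simp only [Pi.add_apply, Finset.sum_add_distrib]
    ring

open Classical in
theorem degAt_halfMon (h : H) : G.degAt i (halfMon n E h) = if G.base h = i then 1 else 0 := by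
  simp only [degAt, halfMon, Pi.single_apply, AddMonoidHom.coe_mk, ZeroHom.coe_mk, Sum.inl.injEq,
    reduceCtorEq, if_false, ite_self, add_zero, Finset.sum_const_zero]
  rw [Finset.sum_eq_single h (fun b _ hb => by simp [hb]) (by simp), if_pos rfl]

open Classical in
theorem degAt_edgeMon (d : E × Bool) : G.degAt i (edgeMon n H d.1) =
    (if G.start d = i then 1 else 0) + if G.finish d = i then 1 else 0 := by
  rcases d with ⟨e, _ | _⟩ <;>
    simp [degAt, edgeMon, Pi.single_apply, start, finish, Finset.sum_add_distrib, add_comm,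
      Finset.sum_ite]

theorem degAt_vertMon (k : Fin n) : G.degAt i (vertMon H E k) = 0 := by
  simp [degAt, vertMon]

theorem labelDeg_halfMon (h : H) : labelDeg n H E (halfMon n E h) = 1 := by
  classical
  simp only [labelDeg, halfMon, Pi.single_apply, AddMonoidHom.coe_mk, ZeroHom.coe_mk, Sum.inl.injEq,
    reduceCtorEq, if_false, add_zero, Finset.sum_const_zero]
  rw [Finset.sum_eq_single h (fun b _ hb => by simp [hb]) (by simp), if_pos rfl]

theorem labelDeg_edgeMon (e : E) : labelDeg n H E (edgeMon n H e) = 1 := by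
  classical
  simp only [labelDeg, edgeMon, Pi.single_apply, AddMonoidHom.coe_mk, ZeroHom.coe_mk,
    Sum.inl.injEq, Sum.inr.injEq, reduceCtorEq, if_false, zero_add, Finset.sum_const_zero]
  rw [Finset.sum_eq_single e (fun b _ hb => by simp [hb]) (by simp), if_pos rfl]

theorem labelDeg_vertMon (k : Fin n) : labelDeg n H E (vertMon H E k) = 0 := by
  simp [labelDeg, vertMon]

open Classical in
/-- An arrival whose inner vertices differ from `i` and which does not come from `i` touches `i` at
most at its end. -/
theorem Arrival.degAt_eq (h : G.Arrival S T k ℓ y) (hS : i ∉ S) (hT : i ∈ T) :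
    G.degAt i y = if k = i then 1 else 0 := by
  induction h with
  | half h => exact degAt_halfMon h
  | edge d s hs hd =>
    have : G.start d ≠ i := fun e => hd (e ▸ hT)
    rw [map_add, map_zsmul, degAt_vertMon, smul_zero, zero_add, degAt_edgeMon, if_neg this,
      zero_add]
  | step d _ hk hd ih =>
    have : G.start d ≠ i := fun e => hS (e ▸ hd ▸ hk)
    rw [map_add, ih, ← hd, degAt_edgeMon, if_neg this, zero_add, zero_add]

open Classical in
/-- A walk whose inner vertices differ from `i` touches `i` at most at its two ends. -/
theorem Walk.degAt_eq (h : G.Walk S a k ℓ w) (hS : i ∉ S) :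
    G.degAt i w = (if a = i then 1 else 0) + if k = i then 1 else 0 := by
  induction h with
  | edge d hd => rw [degAt_edgeMon, hd]
  | step d _ hk hd ih =>
    have : G.start d ≠ i := fun e => hS (e ▸ hd ▸ hk)
    rw [map_add, ih, ← hd, degAt_edgeMon, if_neg this, zero_add, add_zero]

theorem Arrival.labelDeg_eq (h : G.Arrival S T k ℓ y) : labelDeg n H E y = ℓ := by
  induction h with
  | half h => simp [labelDeg_halfMon]
  | edge d s hs hd => rw [map_add, map_zsmul, labelDeg_vertMon, labelDeg_edgeMon]; simp
  | step d _ hk hd ih => simp [ih, labelDeg_edgeMon]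

theorem Walk.labelDeg_eq (h : G.Walk S a k ℓ w) : labelDeg n H E w = ℓ := by
  induction h with
  | edge d hd => simp [labelDeg_edgeMon]
  | step d _ hk hd ih => simp [ih, labelDeg_edgeMon]

theorem OpenSegment.labelDeg_eq (h : G.OpenSegment S ℓ y) : labelDeg n H E y = ℓ := by
  rcases h with ⟨k, x, s, hk, hs, hx, rfl⟩ | ⟨h, ℓ', x, hh, hx, rfl, rfl⟩
  · rw [map_add, map_zsmul, hx.labelDeg_eq, labelDeg_vertMon, smul_zero, add_zero]
  · simp [hx.labelDeg_eq, labelDeg_halfMon]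

end Degrees

theorem Arrival.one_le (h : G.Arrival S T k ℓ y) : 1 ≤ ℓ := by
  cases h <;> omega

theorem Walk.one_le (h : G.Walk S a k ℓ w) : 1 ≤ ℓ := by
  cases h <;> omega

theorem OpenSegment.one_le (h : G.OpenSegment S ℓ y) : 1 ≤ ℓ := by
  rcases h with ⟨k, x, s, hk, hs, hx, rfl⟩ | ⟨h, ℓ', x, hh, hx, rfl, rfl⟩
  · exact hx.one_le
  · omega

theorem halfMon_apply_vert (h : H) : halfMon n E h (Sum.inr (Sum.inr i)) = 0 := by
  simp [halfMon]

theorem edgeMon_apply_vert (e : E) : edgeMon n H e (Sum.inr (Sum.inr i)) = 0 := by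
  simp [edgeMon]

open Classical in
theorem vertMon_apply_vert (k : Fin n) :
    vertMon H E k (Sum.inr (Sum.inr i)) = if i = k then 1 else 0 := by
  simp [vertMon, Pi.single_apply]

/-- The variable at `i ∈ T` does not occur in arrivals. -/
theorem Arrival.apply_vert (h : G.Arrival S T k ℓ y) (hT : i ∈ T) :
    y (Sum.inr (Sum.inr i)) = 0 := by
  induction h with
  | half h => exact halfMon_apply_vert h
  | edge d s hs hd =>
    have : i ≠ G.start d := fun e => hd (e ▸ hT)
    simp [vertMon_apply_vert, this, edgeMon_apply_vert]
  | step d _ hk hd ih => simp [ih, edgeMon_apply_vert]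

theorem Walk.apply_vert (h : G.Walk S a k ℓ w) : w (Sum.inr (Sum.inr i)) = 0 := by
  induction h with
  | edge d hd => exact edgeMon_apply_vert _
  | step d _ hk hd ih => simp [ih, edgeMon_apply_vert]

/-! ### Lists of oriented edges -/

theorem isPath_concat (l : List (E × Bool)) (d : E × Bool) :
    G.IsPath a (l ++ [d]) b ↔ G.IsPath a l (G.start d) ∧ G.finish d = b := by
  induction l generalizing a with
  | nil => simp [IsPath, eq_comm]
  | cons c l ih => simp [IsPath, ih, and_assoc]

theorem forall_start_mem_concat {l : List (E × Bool)} {c : E × Bool} :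
    (∀ d ∈ l ++ [c], G.start d ∈ S) ↔ (∀ d ∈ l, G.start d ∈ S) ∧ G.start c ∈ S := by
  rw [List.forall_mem_append, List.forall_mem_singleton]

theorem listMon_concat (l : List (E × Bool)) (d : E × Bool) :
    listMon n H (l ++ [d]) = listMon n H l + edgeMon n H d.1 := by
  simp [listMon]

/-- The inductive description of arrivals in terms of lists of oriented edges. -/
theorem arrival_iff : G.Arrival S T k ℓ y ↔
    (∃ h l, G.IsPath (G.base h) l k ∧ (∀ d ∈ l, G.start d ∈ S) ∧ ℓ = l.length + 1 ∧
      y = halfMon n E h + listMon n H l) ∨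
    ∃ d l, ∃ s : ℤ, (s = 1 ∨ s = -1) ∧ G.start d ∉ T ∧ G.IsPath (G.finish d) l k ∧
      (∀ d ∈ l, G.start d ∈ S) ∧ ℓ = l.length + 1 ∧
      y = s • vertMon H E (G.start d) + edgeMon n H d.1 + listMon n H l := by
  constructor
  · intro h
    induction h with
    | half h => exact Or.inl ⟨h, [], rfl, by simp, rfl, by simp [listMon]⟩
    | edge d s hs hd => exact Or.inr ⟨d, [], s, hs, hd, rfl, by simp, rfl, by simp [listMon]⟩
    | step d _ hk hd ih =>
      rcases ih with ⟨h, l, hl, hS, rfl, rfl⟩ | ⟨d', l, s, hs, hT, hl, hS, rfl, rfl⟩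
      · refine Or.inl ⟨h, l ++ [d], (isPath_concat _ _).2 ⟨hd ▸ hl, rfl⟩, ?_, by simp, ?_⟩
        · exact forall_start_mem_concat.2 ⟨hS, hd ▸ hk⟩
        · rw [listMon_concat, add_assoc]
      · refine Or.inr ⟨d', l ++ [d], s, hs, hT, (isPath_concat _ _).2 ⟨hd ▸ hl, rfl⟩, ?_, by simp,
          ?_⟩
        · exact forall_start_mem_concat.2 ⟨hS, hd ▸ hk⟩
        · rw [listMon_concat, add_assoc]
  · rintro (⟨h, l, hl, hS, rfl, rfl⟩ | ⟨d, l, s, hs, hT, hl, hS, rfl, rfl⟩)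
    · induction l using List.reverseRecOn generalizing k with
      | nil =>
        obtain rfl : G.base h = k := hl
        simpa [listMon] using Arrival.half (G := G) (S := S) (T := T) h
      | append_singleton l d ih =>
        obtain ⟨h1, rfl⟩ := (isPath_concat _ _).1 hl
        rw [listMon_concat, ← add_assoc, List.length_append]
        exact .step d (ih h1 fun d hd => hS d (by simp [hd])) (hS d (by simp)) rfl
    · induction l using List.reverseRecOn generalizing k with
      | nil =>
        obtain rfl : G.finish d = k := hl
        simpa [listMon] using Arrival.edge (G := G) (S := S) (T := T) d s hs hT
      | append_singleton l d ih =>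
        obtain ⟨h1, rfl⟩ := (isPath_concat _ _).1 hl
        rw [listMon_concat, ← add_assoc, List.length_append]
        exact .step d (ih h1 fun d hd => hS d (by simp [hd])) (hS d (by simp)) rfl

/-- The inductive description of walks in terms of lists of oriented edges. -/
theorem walk_iff : G.Walk S a k ℓ w ↔
    ∃ d l, G.start d = a ∧ G.IsPath (G.finish d) l k ∧ (∀ d ∈ l, G.start d ∈ S) ∧
      ℓ = l.length + 1 ∧ w = edgeMon n H d.1 + listMon n H l := by
  constructor
  · intro h
    induction h with
    | edge d hd => exact ⟨d, [], hd, rfl, by simp, rfl, by simp [listMon]⟩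
    | step d _ hk hd ih =>
      obtain ⟨d', l, hT, hl, hS, rfl, rfl⟩ := ih
      refine ⟨d', l ++ [d], hT, (isPath_concat _ _).2 ⟨hd ▸ hl, rfl⟩, ?_, by simp, ?_⟩
      · exact forall_start_mem_concat.2 ⟨hS, hd ▸ hk⟩
      · rw [listMon_concat, add_assoc]
  · rintro ⟨d, l, hT, hl, hS, rfl, rfl⟩
    induction l using List.reverseRecOn generalizing k with
    | nil =>
      obtain rfl : G.finish d = k := hl
      simpa [listMon] using Walk.edge (G := G) (S := S) d hT
    | append_singleton l d ih =>
      obtain ⟨h1, rfl⟩ := (isPath_concat _ _).1 hl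
      rw [listMon_concat, ← add_assoc, List.length_append]
      exact .step d (ih h1 fun d hd => hS d (by simp [hd])) (hS d (by simp)) rfl

/-! ### Finiteness -/

theorem abs_halfMon_le (h : H) (x) : |halfMon n E h x| ≤ 1 := by
  classical
  unfold halfMon
  rw [Pi.single_apply]
  split_ifs <;> simp

theorem abs_edgeMon_le (e : E) (x) : |edgeMon n H e x| ≤ 1 := by
  classical
  unfold edgeMon
  rw [Pi.single_apply]
  split_ifs <;> simp

theorem abs_vertMon_le {s : ℤ} (hs : s = 1 ∨ s = -1) (k : Fin n) (x) :
    |(s • vertMon H E k) x| ≤ 1 := by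
  classical
  rw [Pi.smul_apply, vertMon, Pi.single_apply]
  rcases hs with rfl | rfl <;> split_ifs <;> simp

/-- A generous bound: the exponents of the labels are at most `ℓ`, and those of the variables are at
most `1` in absolute value. -/
theorem Arrival.abs_apply_le (h : G.Arrival S T k ℓ y) (x) : |y x| ≤ 2 * ℓ := by
  induction h with
  | half h => exact (abs_halfMon_le h x).trans (by norm_num)
  | edge d s hs hd =>
    refine (abs_add_le _ _).trans ?_
    have := abs_vertMon_le (H := H) (E := E) hs (G.start d) x
    have := abs_edgeMon_le (n := n) (H := H) d.1 x
    push_cast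
    linarith
  | step d _ hk hd ih =>
    refine (abs_add_le _ _).trans ?_
    have := abs_edgeMon_le (n := n) (H := H) d.1 x
    push_cast
    linarith

theorem Walk.abs_apply_le (h : G.Walk S a k ℓ w) (x) : |w x| ≤ 2 * ℓ := by
  induction h with
  | edge d hd => exact (abs_edgeMon_le d.1 x).trans (by norm_num)
  | step d _ hk hd ih =>
    refine (abs_add_le _ _).trans ?_
    have := abs_edgeMon_le (n := n) (H := H) d.1 x
    push_cast
    linarith

theorem OpenSegment.abs_apply_le (h : G.OpenSegment S ℓ y) (x) : |y x| ≤ 2 * ℓ + 1 := by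
  rcases h with ⟨k, y, s, hk, hs, hx, rfl⟩ | ⟨h, ℓ', y, hh, hx, rfl, rfl⟩
  · refine (abs_add_le _ _).trans ?_
    have := abs_vertMon_le (H := H) (E := E) hs k x
    have := hx.abs_apply_le x
    linarith
  · refine (abs_add_le _ _).trans ?_
    have := abs_halfMon_le (n := n) (E := E) h x
    have := hx.abs_apply_le x
    push_cast
    linarith

theorem finite_of_abs_apply_le [Finite H] [Finite E] {A : Set (Monomial n H E)} (C : ℤ)
    (h : ∀ v ∈ A, ∀ x, |v x| ≤ C) : A.Finite := by
  have := Fintype.ofFinite H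
  have := Fintype.ofFinite E
  classical
  exact (Set.finite_Icc (fun _ => -C) (fun _ => C)).subset fun v hv =>
    ⟨fun x => (abs_le.1 (h v hv x)).1, fun x => (abs_le.1 (h v hv x)).2⟩

end HalfEdgeGraph

end PathMonomials

/-! ### Finite sets of path monomials -/

section MonomialSets

/-- Removing repetitions from a product leaves a divisor. -/
theorem Finset.prod_image_dvd_prod {ι κ R : Type*} [CommMonoid R] [DecidableEq κ] (s : Finset ι)
    (g : ι → κ) (f : κ → R) : ∏ x ∈ s.image g, f x ∣ ∏ x ∈ s, f (g x) := by
  classical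
  obtain ⟨s', hs', hinj, him⟩ := Finset.exists_subset_injOn_image_eq_of_surjOn (f := g) s
    (s.image g)
    (by rw [Finset.coe_image]; exact Set.surjOn_image g s)
  rw [← him, Finset.prod_image hinj]
  exact Finset.prod_dvd_prod_of_subset _ _ _ hs'

theorem Finset.prod_union_dvd_mul {κ R : Type*} [CommMonoid R] [DecidableEq κ] (s t : Finset κ)
    (f : κ → R) : ∏ x ∈ s ∪ t, f x ∣ (∏ x ∈ s, f x) * ∏ x ∈ t, f x :=
  Dvd.intro _ (Finset.prod_union_inter)

namespace HalfEdgeGraph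

variable {n : ℕ} {H E : Type*} [Finite H] [Finite E] (G : HalfEdgeGraph n H E)
  {S : Finset (Fin n)} {i : Fin n} {v w : Monomial n H E}

/-- The bound for the length of the paths through `m` vertices. Without such vertices a path has
length `1`. When a vertex is added, two paths that arrive at it are joined, if need be with a closed
path in between. The bound therefore triples, except that it only doubles at the first vertex, where
there are no closed paths. -/
def lengthBound : ℕ → ℕ
  | 0 => 1
  | m + 1 => 2 * 3 ^ m

theorem one_le_lengthBound (m : ℕ) : 1 ≤ lengthBound m := by
  cases m with
  | zero => exact le_rfl
  | succ m => exact Nat.mul_pos two_pos (by positivity)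

theorem two_mul_lengthBound_le (m : ℕ) : 2 * lengthBound m ≤ lengthBound (m + 1) := by
  cases m with
  | zero => simp [lengthBound]
  | succ m =>
    simp only [lengthBound, pow_succ]
    omega

theorem three_mul_lengthBound_le {m : ℕ} (hm : m ≠ 0) :
    3 * lengthBound m ≤ lengthBound (m + 1) := by
  cases m with
  | zero => exact absurd rfl hm
  | succ m =>
    simp only [lengthBound, pow_succ]
    omega

theorem two_mul_lengthBound_le_four {m : ℕ} (hm : m ≠ 0) :
    2 * lengthBound m ≤ 4 * 3 ^ (m + 1 - 2) := by
  cases m with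
  | zero => exact absurd rfl hm
  | succ m =>
    simp only [lengthBound, show m + 1 + 1 - 2 = m by omega]
    omega

theorem finite_openMonomials (S : Finset (Fin n)) (C : ℕ) :
    {v | ∃ L ≤ C, G.OpenSegment S L v}.Finite :=
  finite_of_abs_apply_le (2 * C + 1) fun v ⟨L, hL, hv⟩ x => (hv.abs_apply_le x).trans (by gcongr)

theorem finite_closedMonomials (S : Finset (Fin n)) (C : ℕ) :
    {v | ∃ a ∈ S, ∃ ℓ ≤ C, G.Walk S a a ℓ v}.Finite :=
  finite_of_abs_apply_le (2 * C) fun v ⟨a, _, L, hL, hv⟩ x =>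
    (hv.abs_apply_le x).trans (by gcongr)

theorem finite_arrivalMonomials (S : Finset (Fin n)) (i : Fin n) (C : ℕ) :
    {v | ∃ ℓ ≤ C, G.Arrival S (insert i S) i ℓ v}.Finite :=
  finite_of_abs_apply_le (2 * C) fun v ⟨L, hL, hv⟩ x => (hv.abs_apply_le x).trans (by gcongr)

theorem finite_returnMonomials (S : Finset (Fin n)) (i : Fin n) (C : ℕ) :
    {v | ∃ ℓ ≤ C, G.Walk S i i ℓ v}.Finite :=
  finite_of_abs_apply_le (2 * C) fun v ⟨L, hL, hv⟩ x => (hv.abs_apply_le x).trans (by gcongr)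

/-- The monomials of the open segments through `S`, up to the bound for the length. -/
noncomputable def openMonomials (S : Finset (Fin n)) : Finset (Monomial n H E) :=
  (G.finite_openMonomials S (lengthBound S.card)).toFinset

/-- The monomials of the closed walks in `S`. They come from joining two returns, so that their
length is at most `2 * lengthBound m = 4 * 3 ^ (m - 1)`, where `m + 1` is the number of
vertices. -/
noncomputable def closedMonomials (S : Finset (Fin n)) : Finset (Monomial n H E) :=
  (G.finite_closedMonomials S (4 * 3 ^ (S.card - 2))).toFinset

/-- The monomials of the paths through `S` which arrive at `i`. -/
noncomputable def arrivalMonomials (S : Finset (Fin n)) (i : Fin n) : Finset (Monomial n H E) :=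
  (G.finite_arrivalMonomials S i (lengthBound S.card)).toFinset

/-- The monomials of the paths from `i` through `S` back to `i`. -/
noncomputable def returnMonomials (S : Finset (Fin n)) (i : Fin n) : Finset (Monomial n H E) :=
  (G.finite_returnMonomials S i (lengthBound S.card)).toFinset

open Classical in
/-- The monomials of the open segments through `S` which do not touch `i`. -/
noncomputable def avoidingMonomials (S : Finset (Fin n)) (i : Fin n) : Finset (Monomial n H E) :=
  {v ∈ G.openMonomials (insert i S) |
    (∃ k y, ∃ s : ℤ, ∃ ℓ, k ∉ insert i S ∧ (s = 1 ∨ s = -1) ∧ G.Arrival S (insert i S) k ℓ y ∧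
      v = y + s • vertMon H E k) ∨
    ∃ h ℓ y, G.base h ∈ S ∧ G.Arrival S (insert i S) (G.base h) ℓ y ∧ v = y + halfMon n E h}

open Classical in
/-- The products of two arrivals. -/
noncomputable def arrivalPairs (S : Finset (Fin n)) (i : Fin n) : Finset (Monomial n H E) :=
  (G.arrivalMonomials S i ×ˢ G.arrivalMonomials S i).image fun x => x.1 + x.2

open Classical in
/-- The products of the square of an arrival and a return. -/
noncomputable def arrivalReturnPairs (S : Finset (Fin n)) (i : Fin n) : Finset (Monomial n H E) :=
  (G.arrivalMonomials S i ×ˢ G.returnMonomials S i).image fun x => 2 • x.1 + x.2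

open Classical in
/-- The products of two returns. -/
noncomputable def returnPairs (S : Finset (Fin n)) (i : Fin n) : Finset (Monomial n H E) :=
  (G.returnMonomials S i ×ˢ G.returnMonomials S i).image fun x => x.1 + x.2

variable {G}

theorem mem_openMonomials :
    v ∈ G.openMonomials S ↔ ∃ L ≤ lengthBound S.card, G.OpenSegment S L v := by
  simp [openMonomials]

theorem mem_closedMonomials :
    v ∈ G.closedMonomials S ↔ ∃ a ∈ S, ∃ ℓ ≤ 4 * 3 ^ (S.card - 2), G.Walk S a a ℓ v := by
  simp [closedMonomials]

theorem mem_arrivalMonomials :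
    v ∈ G.arrivalMonomials S i ↔ ∃ ℓ ≤ lengthBound S.card, G.Arrival S (insert i S) i ℓ v := by
  simp [arrivalMonomials]

theorem mem_returnMonomials :
    v ∈ G.returnMonomials S i ↔ ∃ ℓ ≤ lengthBound S.card, G.Walk S i i ℓ v := by
  simp [returnMonomials]

theorem mem_avoidingMonomials : v ∈ G.avoidingMonomials S i ↔ v ∈ G.openMonomials (insert i S) ∧
    ((∃ k y, ∃ s : ℤ, ∃ ℓ, k ∉ insert i S ∧ (s = 1 ∨ s = -1) ∧ G.Arrival S (insert i S) k ℓ y ∧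
      v = y + s • vertMon H E k) ∨
    ∃ h ℓ y, G.base h ∈ S ∧ G.Arrival S (insert i S) (G.base h) ℓ y ∧ v = y + halfMon n E h) := by
  simp only [avoidingMonomials, Finset.mem_filter]

theorem mem_arrivalPairs {u : Monomial n H E} : u ∈ G.arrivalPairs S i ↔
    ∃ v ∈ G.arrivalMonomials S i, ∃ w ∈ G.arrivalMonomials S i, v + w = u := by
  simp [arrivalPairs, and_assoc]

theorem mem_arrivalReturnPairs {u : Monomial n H E} : u ∈ G.arrivalReturnPairs S i ↔
    ∃ v ∈ G.arrivalMonomials S i, ∃ w ∈ G.returnMonomials S i, 2 • v + w = u := by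
  simp [arrivalReturnPairs, and_assoc]

theorem mem_returnPairs {u : Monomial n H E} : u ∈ G.returnPairs S i ↔
    ∃ v ∈ G.returnMonomials S i, ∃ w ∈ G.returnMonomials S i, v + w = u := by
  simp [returnPairs, and_assoc]

theorem mem_avoidingMonomials_of_openSegment {ℓ : ℕ} (hi : i ∉ S)
    (h : (∃ k x, ∃ s : ℤ, k ∉ insert i S ∧ (s = 1 ∨ s = -1) ∧ G.Arrival S (insert i S) k ℓ x ∧
        v = x + s • vertMon H E k) ∨
      ∃ h ℓ' x, G.base h ∈ S ∧ G.Arrival S (insert i S) (G.base h) ℓ' x ∧ ℓ = ℓ' + 1 ∧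
        v = x + halfMon n E h) (hℓ : ℓ ≤ lengthBound S.card) : v ∈ G.avoidingMonomials S i := by
  have hsub := Finset.subset_insert i S
  have hle : ℓ ≤ lengthBound (insert i S).card := by
    rw [Finset.card_insert_of_notMem hi]
    have := two_mul_lengthBound_le S.card
    omega
  rw [mem_avoidingMonomials, mem_openMonomials]
  rcases h with ⟨k, x, s, hk, hs, hx, rfl⟩ | ⟨h, ℓ', x, hh, hx, rfl, rfl⟩
  · exact ⟨⟨ℓ, hle, Or.inl ⟨k, x, s, hk, hs, hx.mono hsub subset_rfl, rfl⟩⟩,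
      Or.inl ⟨k, x, s, ℓ, hk, hs, hx, rfl⟩⟩
  · exact ⟨⟨ℓ' + 1, hle, Or.inr ⟨h, ℓ', x, hsub hh, hx.mono hsub subset_rfl, rfl, rfl⟩⟩,
      Or.inr ⟨h, ℓ', x, hh, hx, rfl⟩⟩

open Classical in
/-- The open segments through `S` with respect to the variable `z` at `i`: those that do not touch
`i` are constant in `z`, those with one end at `i` are arrivals times `z` or `z⁻¹`, and those with
both ends at `i` are returns times `z²`, `z⁻²` or `1`. -/
theorem openMonomials_subset (hi : i ∉ S) : G.openMonomials S ⊆ G.avoidingMonomials S i ∪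
    (G.returnMonomials S i ∪
      (((G.arrivalMonomials S i).image (· + vertMon H E i) ∪
        (G.returnMonomials S i).image (· + 2 • vertMon H E i)) ∪
      ((G.arrivalMonomials S i).image (· - vertMon H E i) ∪
        (G.returnMonomials S i).image (· - 2 • vertMon H E i)))) := by
  intro v hv
  obtain ⟨L, hL, hv⟩ := mem_openMonomials.1 hv
  simp only [Finset.mem_union, Finset.mem_image]
  rcases hv.cases_insert (i := i) with h | ⟨x, s, hs, hx, rfl⟩ | ⟨x, s, hs, hx, rfl⟩
  · exact Or.inl (mem_avoidingMonomials_of_openSegment hi h hL)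
  · have hx := mem_arrivalMonomials.2 ⟨L, hL, hx⟩
    rcases hs with rfl | rfl
    · exact Or.inr (Or.inr (Or.inl (Or.inl ⟨x, hx, by simp⟩)))
    · exact Or.inr (Or.inr (Or.inr (Or.inl ⟨x, hx, by simp [sub_eq_add_neg]⟩)))
  · have hx := mem_returnMonomials.2 ⟨L, hL, hx⟩
    rcases hs with rfl | rfl | rfl
    · exact Or.inr (Or.inr (Or.inl (Or.inr ⟨x, hx, by rw [← natCast_zsmul]; rfl⟩)))
    · refine Or.inr (Or.inr (Or.inr (Or.inr ⟨x, hx, ?_⟩)))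
      rw [sub_eq_add_neg, ← natCast_zsmul, ← neg_zsmul]
      rfl
    · exact Or.inr (Or.inl (by simpa using hx))

/-- The product over the monomials attached to `S` divides the product of the part which does not
depend on the variable at `i`, of the factors which contain this variable, and of those which
contain its reciprocal. -/
theorem prod_openMonomials_dvd {R : Type*} [CommMonoid R] (P : Monomial n H E → R) (hi : i ∉ S) :
    (∏ v ∈ G.openMonomials S, P v) * ∏ v ∈ G.closedMonomials S, P v ∣
      ((∏ v ∈ G.avoidingMonomials S i, P v) * (∏ v ∈ G.returnMonomials S i, P v) *
        ∏ v ∈ G.closedMonomials S, P v) *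
      (((∏ v ∈ G.arrivalMonomials S i, P (v + vertMon H E i)) *
        ∏ v ∈ G.returnMonomials S i, P (v + 2 • vertMon H E i)) *
      ((∏ v ∈ G.arrivalMonomials S i, P (v - vertMon H E i)) *
        ∏ v ∈ G.returnMonomials S i, P (v - 2 • vertMon H E i))) := by
  classical
  have h := (Finset.prod_dvd_prod_of_subset _ _ P (openMonomials_subset (G := G) hi)).trans
    ((Finset.prod_union_dvd_mul _ _ P).trans (mul_dvd_mul_left _
      ((Finset.prod_union_dvd_mul _ _ P).trans (mul_dvd_mul_left _
        ((Finset.prod_union_dvd_mul _ _ P).trans (mul_dvd_mul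
          ((Finset.prod_union_dvd_mul _ _ P).trans (mul_dvd_mul
            (Finset.prod_image_dvd_prod _ _ P) (Finset.prod_image_dvd_prod _ _ P)))
          ((Finset.prod_union_dvd_mul _ _ P).trans (mul_dvd_mul
            (Finset.prod_image_dvd_prod _ _ P) (Finset.prod_image_dvd_prod _ _ P)))))))))
  refine (mul_dvd_mul_right h _).trans (dvd_of_eq ?_)
  ac_rfl

section Degrees

variable [Fintype H] [Fintype E]

theorem degAt_of_mem_avoidingMonomials (hi : i ∉ S) (hv : v ∈ G.avoidingMonomials S i) :
    G.degAt i v = 0 := by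
  classical
  rcases (mem_avoidingMonomials.1 hv).2 with ⟨k, y, s, ℓ, hk, hs, hy, rfl⟩ | ⟨h, ℓ, y, hh, hy, rfl⟩
  · have hki : k ≠ i := fun e => hk (e ▸ Finset.mem_insert_self i S)
    rw [map_add, map_zsmul, degAt_vertMon, smul_zero, add_zero,
      hy.degAt_eq hi (Finset.mem_insert_self i S), if_neg hki]
  · have hki : G.base h ≠ i := fun e => hi (e ▸ hh)
    rw [map_add, degAt_halfMon, hy.degAt_eq hi (Finset.mem_insert_self i S), if_neg hki, add_zero]

theorem degAt_of_mem_arrivalMonomials (hi : i ∉ S) (h : v ∈ G.arrivalMonomials S i) :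
    G.degAt i v = 1 := by
  obtain ⟨ℓ, -, h⟩ := mem_arrivalMonomials.1 h
  rw [h.degAt_eq hi (Finset.mem_insert_self i S), if_pos rfl]

theorem degAt_of_mem_returnMonomials (hi : i ∉ S) (h : v ∈ G.returnMonomials S i) :
    G.degAt i v = 2 := by
  obtain ⟨ℓ, -, h⟩ := mem_returnMonomials.1 h
  rw [h.degAt_eq hi, if_pos rfl]
  rfl

theorem degAt_of_mem_closedMonomials (hi : i ∉ S) (h : v ∈ G.closedMonomials S) :
    G.degAt i v = 0 := by
  obtain ⟨a, ha, ℓ, -, h⟩ := mem_closedMonomials.1 h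
  have : a ≠ i := fun e => hi (e ▸ ha)
  rw [h.degAt_eq hi, if_neg this, add_zero]

theorem one_le_labelDeg_of_mem_openMonomials (h : v ∈ G.openMonomials S) :
    1 ≤ labelDeg n H E v := by
  obtain ⟨L, -, h⟩ := mem_openMonomials.1 h
  have := h.one_le
  rw [h.labelDeg_eq]
  exact_mod_cast this

theorem one_le_labelDeg_of_mem_closedMonomials (h : v ∈ G.closedMonomials S) :
    1 ≤ labelDeg n H E v := by
  obtain ⟨a, -, L, -, h⟩ := mem_closedMonomials.1 h
  have := h.one_le
  rw [h.labelDeg_eq]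
  exact_mod_cast this

end Degrees

theorem avoidingMonomials_subset : G.avoidingMonomials S i ⊆ G.openMonomials (insert i S) :=
  fun _ h => (mem_avoidingMonomials.1 h).1

theorem arrivalPairs_subset (hi : i ∉ S) : G.arrivalPairs S i ⊆ G.openMonomials (insert i S) := by
  intro u hu
  obtain ⟨v, hv, w, hw, rfl⟩ := mem_arrivalPairs.1 hu
  obtain ⟨ℓ, hℓ, hv⟩ := mem_arrivalMonomials.1 hv
  obtain ⟨ℓ', hℓ', hw⟩ := mem_arrivalMonomials.1 hw
  have hsub := Finset.subset_insert i S
  refine mem_openMonomials.2 ⟨ℓ + ℓ', ?_, (hv.mono hsub subset_rfl).join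
    (Finset.mem_insert_self i S) (hw.mono hsub subset_rfl)⟩
  rw [Finset.card_insert_of_notMem hi]
  have := two_mul_lengthBound_le S.card
  omega

theorem arrivalReturnPairs_subset (hi : i ∉ S) :
    G.arrivalReturnPairs S i ⊆ G.openMonomials (insert i S) := by
  intro u hu
  obtain ⟨v, hv, w, hw, rfl⟩ := mem_arrivalReturnPairs.1 hu
  obtain ⟨ℓ, hℓ, hv⟩ := mem_arrivalMonomials.1 hv
  obtain ⟨ℓ', hℓ', hw⟩ := mem_returnMonomials.1 hw
  have hsub := Finset.subset_insert i S
  have hi' := Finset.mem_insert_self i S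
  have hv := hv.mono hsub subset_rfl
  refine mem_openMonomials.2 ⟨ℓ + ℓ' + ℓ, ?_, ?_⟩
  · rw [Finset.card_insert_of_notMem hi]
    have := three_mul_lengthBound_le (Finset.card_ne_zero.2 hw.nonempty_of_closed)
    omega
  · have := (hv.follow hi' (hw.mono hsub)).join hi' hv
    convert this using 1
    rw [two_nsmul]
    abel

theorem closedMonomials_subset : G.closedMonomials S ⊆ G.closedMonomials (insert i S) := by
  intro v hv
  obtain ⟨a, ha, ℓ, hℓ, hv⟩ := mem_closedMonomials.1 hv
  have hsub := Finset.subset_insert i S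
  refine mem_closedMonomials.2 ⟨a, hsub ha, ℓ, hℓ.trans ?_, hv.mono hsub⟩
  have := Finset.card_le_card hsub
  gcongr
  norm_num

theorem returnMonomials_subset (hi : i ∉ S) :
    G.returnMonomials S i ⊆ G.closedMonomials (insert i S) := by
  intro v hv
  obtain ⟨ℓ, hℓ, hv⟩ := mem_returnMonomials.1 hv
  refine mem_closedMonomials.2 ⟨i, Finset.mem_insert_self i S, ℓ, ?_,
    hv.mono (Finset.subset_insert i S)⟩
  rw [Finset.card_insert_of_notMem hi]
  have := two_mul_lengthBound_le_four (Finset.card_ne_zero.2 hv.nonempty_of_closed)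
  omega

theorem returnPairs_subset (hi : i ∉ S) : G.returnPairs S i ⊆ G.closedMonomials (insert i S) := by
  intro u hu
  obtain ⟨v, hv, w, hw, rfl⟩ := mem_returnPairs.1 hu
  obtain ⟨ℓ, hℓ, hv⟩ := mem_returnMonomials.1 hv
  obtain ⟨ℓ', hℓ', hw⟩ := mem_returnMonomials.1 hw
  have hsub := Finset.subset_insert i S
  have hi' := Finset.mem_insert_self i S
  refine mem_closedMonomials.2 ⟨i, hi', ℓ + ℓ', ?_, (hv.mono hsub).trans hi' (hw.mono hsub)⟩
  rw [Finset.card_insert_of_notMem hi]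
  have := two_mul_lengthBound_le_four (Finset.card_ne_zero.2 hv.nonempty_of_closed)
  omega

/-- The products of the monomials which are attached to `S` and do not contain the variable at `i`,
and of the monomials at which the contours for this variable are pinched. Their degrees at `i` are
`0` and `2`, `4`, so that no monomial is needed twice among the open paths, nor among the closed
ones. -/
theorem prod_dvd_prod_openMonomials_insert {R : Type*} [CommMonoid R] (P : Monomial n H E → R)
    (hi : i ∉ S) :
    ((∏ v ∈ G.avoidingMonomials S i, P v) * (∏ v ∈ G.returnMonomials S i, P v) *
        ∏ v ∈ G.closedMonomials S, P v) *
      ((∏ v ∈ G.arrivalPairs S i, P v) * (∏ v ∈ G.arrivalReturnPairs S i, P v) *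
        ∏ v ∈ G.returnPairs S i, P v) ∣
      (∏ v ∈ G.openMonomials (insert i S), P v) * ∏ v ∈ G.closedMonomials (insert i S), P v := by
  classical
  have := Fintype.ofFinite H
  have := Fintype.ofFinite E
  have d0 : ∀ v ∈ G.avoidingMonomials S i, G.degAt i v = 0 := fun v =>
    degAt_of_mem_avoidingMonomials hi
  have d0' : ∀ v ∈ G.closedMonomials S, G.degAt i v = 0 := fun v => degAt_of_mem_closedMonomials hi
  have d2 : ∀ v ∈ G.returnMonomials S i, G.degAt i v = 2 := fun v => degAt_of_mem_returnMonomials hi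
  have d1 : ∀ v ∈ G.arrivalMonomials S i, G.degAt i v = 1 := fun v =>
    degAt_of_mem_arrivalMonomials hi
  have dHH : ∀ v ∈ G.arrivalPairs S i, G.degAt i v = 2 := fun u hu => by
    obtain ⟨v, hv, w, hw, rfl⟩ := mem_arrivalPairs.1 hu
    rw [map_add, d1 v hv, d1 w hw]
    rfl
  have dHL : ∀ v ∈ G.arrivalReturnPairs S i, G.degAt i v = 4 := fun u hu => by
    obtain ⟨v, hv, w, hw, rfl⟩ := mem_arrivalReturnPairs.1 hu
    rw [map_add, map_nsmul, d1 v hv, d2 w hw]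
    rfl
  have dLL : ∀ v ∈ G.returnPairs S i, G.degAt i v = 4 := fun u hu => by
    obtain ⟨v, hv, w, hw, rfl⟩ := mem_returnPairs.1 hu
    rw [map_add, d2 v hv, d2 w hw]
    rfl
  have key : ∀ {A B : Finset (Monomial n H E)} {a b : ℤ}, (∀ v ∈ A, G.degAt i v = a) →
      (∀ v ∈ B, G.degAt i v = b) → a ≠ b → Disjoint A B := fun hA hB hab =>
    Finset.disjoint_left.2 fun v hv hv' => hab ((hA v hv).symm.trans (hB v hv'))
  have h1 : (∏ v ∈ G.avoidingMonomials S i, P v) * ((∏ v ∈ G.arrivalPairs S i, P v) *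
      ∏ v ∈ G.arrivalReturnPairs S i, P v) ∣ ∏ v ∈ G.openMonomials (insert i S), P v := by
    rw [← Finset.prod_union (key dHH dHL (by norm_num)), ← Finset.prod_union
      (Finset.disjoint_union_right.2 ⟨key d0 dHH (by norm_num), key d0 dHL (by norm_num)⟩)]
    exact Finset.prod_dvd_prod_of_subset _ _ _ (Finset.union_subset avoidingMonomials_subset
      (Finset.union_subset (arrivalPairs_subset hi) (arrivalReturnPairs_subset hi)))
  have h2 : (∏ v ∈ G.closedMonomials S, P v) * ((∏ v ∈ G.returnMonomials S i, P v) *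
      ∏ v ∈ G.returnPairs S i, P v) ∣ ∏ v ∈ G.closedMonomials (insert i S), P v := by
    rw [← Finset.prod_union (key d2 dLL (by norm_num)), ← Finset.prod_union
      (Finset.disjoint_union_right.2 ⟨key d0' d2 (by norm_num), key d0' dLL (by norm_num)⟩)]
    exact Finset.prod_dvd_prod_of_subset _ _ _ (Finset.union_subset closedMonomials_subset
      (Finset.union_subset (returnMonomials_subset hi) (returnPairs_subset hi)))
  refine (dvd_of_eq ?_).trans (mul_dvd_mul h1 h2)
  ac_rfl

/-- The monomials which do not touch `i` do not contain the variable at `i`. -/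
theorem apply_vert_of_mem_avoidingMonomials (h : v ∈ G.avoidingMonomials S i) :
    v (Sum.inr (Sum.inr i)) = 0 := by
  rcases (mem_avoidingMonomials.1 h).2 with ⟨k, y, s, ℓ, hk, hs, hy, rfl⟩ | ⟨h, ℓ, y, hh, hy, rfl⟩
  · have hki : i ≠ k := fun e => hk (e ▸ Finset.mem_insert_self i S)
    simp [vertMon_apply_vert, hki, hy.apply_vert (Finset.mem_insert_self i S)]
  · simp [halfMon_apply_vert, hy.apply_vert (Finset.mem_insert_self i S)]

theorem apply_vert_of_mem_arrivalMonomials (h : v ∈ G.arrivalMonomials S i) :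
    v (Sum.inr (Sum.inr i)) = 0 := by
  obtain ⟨ℓ, -, h⟩ := mem_arrivalMonomials.1 h
  exact h.apply_vert (Finset.mem_insert_self i S)

theorem apply_vert_of_mem_returnMonomials (h : v ∈ G.returnMonomials S i) (k : Fin n) :
    v (Sum.inr (Sum.inr k)) = 0 := by
  obtain ⟨ℓ, -, h⟩ := mem_returnMonomials.1 h
  exact h.apply_vert

theorem apply_vert_of_mem_closedMonomials (h : v ∈ G.closedMonomials S) (k : Fin n) :
    v (Sum.inr (Sum.inr k)) = 0 := by
  obtain ⟨a, -, ℓ, -, h⟩ := mem_closedMonomials.1 h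
  exact h.apply_vert

end HalfEdgeGraph

end MonomialSets

/-! ### Monomials as holomorphic functions -/

section GraphSystem

open Filter Topology Metric Set

theorem isOpen_paramDomain (H E : Type*) [Finite H] [Finite E] : IsOpen (paramDomain H E) := by
  have := Fintype.ofFinite H
  have := Fintype.ofFinite E
  have e : paramDomain H E = (({x | 0 < ‖x.1‖} ∩ {x | ‖x.1‖ < 1}) ∩
      ({x | 0 < ‖x.2.1‖} ∩ {x | ‖x.2.1‖ < 1})) ∩
      ((⋂ h, {x | x.2.2.1 h ≠ 0}) ∩ ⋂ e, {x | x.2.2.2 e ≠ 0}) := by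
    ext x
    simp only [paramDomain, mem_ofPred_eq, mem_inter_iff, mem_iInter]
    tauto
  rw [e]
  refine IsOpen.inter (IsOpen.inter (IsOpen.inter ?_ ?_) (IsOpen.inter ?_ ?_)) (IsOpen.inter ?_ ?_)
  · exact isOpen_lt (by fun_prop) (by fun_prop)
  · exact isOpen_lt (by fun_prop) (by fun_prop)
  · exact isOpen_lt (by fun_prop) (by fun_prop)
  · exact isOpen_lt (by fun_prop) (by fun_prop)
  · exact isOpen_iInter_of_finite fun h => isOpen_ne_fun (by fun_prop) (by fun_prop)
  · exact isOpen_iInter_of_finite fun h => isOpen_ne_fun (by fun_prop) (by fun_prop)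

theorem isOpen_forall_ne_zero (n : ℕ) : IsOpen {z : Fin n → ℂ | ∀ i, z i ≠ 0} := by
  have e : {z : Fin n → ℂ | ∀ i, z i ≠ 0} = ⋂ i, {z | z i ≠ 0} := by
    ext z
    simp
  rw [e]
  exact isOpen_iInter_of_finite fun h => isOpen_ne_fun (by fun_prop) (by fun_prop)

/-- Exponent vectors can be ordered lexicographically. -/
theorem exists_injective_lex (ι : Type*) [Finite ι] :
    ∃ (m : ℕ) (φ : (ι → ℤ) →+ Lex (Fin m → ℤ)), Function.Injective φ := by
  obtain ⟨m, ⟨e⟩⟩ := Finite.exists_equiv_fin ι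
  refine ⟨m, ⟨⟨fun v => toLex fun k => v (e.symm k), rfl⟩, fun v w => rfl⟩, fun v w h => ?_⟩
  funext k
  simpa using congrFun (toLex.injective h) (e k)

theorem zpow_sum_of_ne_zero {ι : Type*} {s : ℂ} (hs : s ≠ 0) (S : Finset ι) (f : ι → ℤ) :
    s ^ (∑ k ∈ S, f k) = ∏ k ∈ S, s ^ f k := by
  classical
  induction S using Finset.induction_on with
  | empty => simp
  | insert a S ha ih => rw [Finset.sum_insert ha, Finset.prod_insert ha, zpow_add₀ hs, ih]

namespace HalfEdgeGraph

/-- Both bounds agree for paths through `inner`: they differ only if `inner` is empty, when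
`2 * 3 ^ (0 - 1) = 2` while the path cannot be longer than `1`. -/
theorem length_le_lengthBound_iff {n : ℕ} {H E : Type*} {G : HalfEdgeGraph n H E}
    {inner : List (Fin n)} (hl : inner.Nodup) {l : List (E × Bool)}
    (h : ∀ d ∈ l, G.start d ∈ inner) :
    l.length + 1 ≤ 2 * 3 ^ (inner.length - 1) ↔ l.length + 1 ≤ lengthBound inner.toFinset.card := by
  rw [List.toFinset_card_of_nodup hl]
  rcases inner with _ | ⟨a, inner⟩
  · have : l = [] := List.eq_nil_iff_forall_not_mem.2 fun d hd => by simpa using h d hd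
    subst this
    simp [lengthBound]
  · rfl

variable {n : ℕ} {H E : Type*} [Fintype H] [Fintype E]

/-- The value of a formal monomial at given labels and variables. -/
noncomputable def evalMon (v : Monomial n H E) (y : (ℂ × ℂ × (H → ℂ) × (E → ℂ)) × (Fin n → ℂ)) :
    ℂ :=
  (∏ h, y.1.2.2.1 h ^ v (Sum.inl h)) * (∏ e, y.1.2.2.2 e ^ v (Sum.inr (Sum.inl e))) *
    ∏ k, y.2 k ^ v (Sum.inr (Sum.inr k))

/-- The formal monomials as functions of the parameters and the variables. -/
noncomputable def monomialSystem (n : ℕ) (H E : Type*) [Fintype H] [Fintype E] :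
    MonomialSystem ((ℂ × ℂ × (H → ℂ) × (E → ℂ)) × (Fin n → ℂ)) (Monomial n H E) where
  dom := paramDomain H E ×ˢ {z | ∀ i, z i ≠ 0}
  isOpen_dom := (isOpen_paramDomain H E).prod (isOpen_forall_ne_zero n)
  p y := y.1.1
  q y := y.1.2.1
  χ := evalMon
  differentiableOn_p := by fun_prop
  differentiableOn_q := by fun_prop
  differentiableOn_χ v := by
    have h1 : ∀ h : H, Differentiable ℂ
        fun y : (ℂ × ℂ × (H → ℂ) × (E → ℂ)) × (Fin n → ℂ) => y.1.2.2.1 h := fun h => by fun_prop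
    have h2 : ∀ e : E, Differentiable ℂ
        fun y : (ℂ × ℂ × (H → ℂ) × (E → ℂ)) × (Fin n → ℂ) => y.1.2.2.2 e := fun h => by fun_prop
    have h3 : ∀ k : Fin n, Differentiable ℂ
        fun y : (ℂ × ℂ × (H → ℂ) × (E → ℂ)) × (Fin n → ℂ) => y.2 k := fun h => by fun_prop
    refine DifferentiableOn.mul (DifferentiableOn.mul ?_ ?_) ?_ <;>
      refine differentiableOn_prod _ fun k _ => ?_
    · exact (h1 k).differentiableOn.zpow (Or.inl fun y hy => hy.1.2.2.1 k)
    · exact (h2 k).differentiableOn.zpow (Or.inl fun y hy => hy.1.2.2.2 k)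
    · exact (h3 k).differentiableOn.zpow (Or.inl fun y hy => hy.2 k)
  p_ne_zero y hy := norm_pos_iff.1 hy.1.1.1
  q_ne_zero y hy := norm_pos_iff.1 hy.1.2.1.1
  norm_p_lt_one y hy := hy.1.1.2
  norm_q_lt_one y hy := hy.1.2.1.2
  χ_ne_zero v y hy := by
    refine mul_ne_zero (mul_ne_zero ?_ ?_) ?_ <;> refine Finset.prod_ne_zero_iff.2 fun k _ => ?_
    · exact zpow_ne_zero _ (hy.1.2.2.1 k)
    · exact zpow_ne_zero _ (hy.1.2.2.2 k)
    · exact zpow_ne_zero _ (hy.2 k)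
  χ_add v w y hy := by
    have h1 : ∀ k, y.1.2.2.1 k ^ (v + w) (Sum.inl k) =
        y.1.2.2.1 k ^ v (Sum.inl k) * y.1.2.2.1 k ^ w (Sum.inl k) := fun k =>
      zpow_add₀ (hy.1.2.2.1 k) _ _
    have h2 : ∀ k, y.1.2.2.2 k ^ (v + w) (Sum.inr (Sum.inl k)) =
        y.1.2.2.2 k ^ v (Sum.inr (Sum.inl k)) * y.1.2.2.2 k ^ w (Sum.inr (Sum.inl k)) := fun k =>
      zpow_add₀ (hy.1.2.2.2 k) _ _
    have h3 : ∀ k, y.2 k ^ (v + w) (Sum.inr (Sum.inr k)) =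
        y.2 k ^ v (Sum.inr (Sum.inr k)) * y.2 k ^ w (Sum.inr (Sum.inr k)) := fun k =>
      zpow_add₀ (hy.2 k) _ _
    simp only [evalMon, h1, h2, h3, Finset.prod_mul_distrib]
    ring

variable {y : (ℂ × ℂ × (H → ℂ) × (E → ℂ)) × (Fin n → ℂ)} {v w : Monomial n H E} {i : Fin n}

theorem evalMon_add (hy : y ∈ (monomialSystem n H E).dom) :
    evalMon (v + w) y = evalMon v y * evalMon w y :=
  (monomialSystem n H E).χ_add v w y hy

theorem evalMon_zero : evalMon (0 : Monomial n H E) y = 1 := by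
  simp [evalMon]

theorem evalMon_zsmul (m : ℤ) : evalMon (m • v) y = evalMon v y ^ m := by
  have h : ∀ k, (m • v) k = v k * m := fun k => by rw [Pi.smul_apply, smul_eq_mul, mul_comm]
  simp only [evalMon, h, mul_zpow, zpow_mul, Finset.prod_zpow]

theorem evalMon_halfMon (h : H) : evalMon (halfMon n E h) y = y.1.2.2.1 h := by
  classical
  simp only [evalMon, halfMon, Pi.single_apply, Sum.inl.injEq, reduceCtorEq, if_false, zpow_zero,
    Finset.prod_const_one, mul_one]
  rw [Finset.prod_eq_single h (fun b _ hb => by simp [hb]) (by simp), if_pos rfl, zpow_one]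

theorem evalMon_edgeMon (e : E) : evalMon (edgeMon n H e) y = y.1.2.2.2 e := by
  classical
  simp only [evalMon, edgeMon, Pi.single_apply, Sum.inl.injEq, Sum.inr.injEq, reduceCtorEq,
    if_false, zpow_zero, Finset.prod_const_one, mul_one, one_mul]
  rw [Finset.prod_eq_single e (fun b _ hb => by simp [hb]) (by simp), if_pos rfl, zpow_one]

theorem evalMon_vertMon (k : Fin n) : evalMon (vertMon H E k) y = y.2 k := by
  classical
  simp only [evalMon, vertMon, Pi.single_apply, Sum.inr.injEq, reduceCtorEq,
    if_false, zpow_zero, Finset.prod_const_one, one_mul]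
  rw [Finset.prod_eq_single k (fun b _ hb => by simp [hb]) (by simp), if_pos rfl, zpow_one]

theorem evalMon_listMon (hy : y ∈ (monomialSystem n H E).dom) (l : List (E × Bool)) :
    evalMon (listMon n H l) y = weight y.1.2.2.2 l := by
  induction l with
  | nil => simp [listMon, weight, evalMon_zero]
  | cons d l ih =>
    have h1 : listMon n H (d :: l) = edgeMon n H d.1 + listMon n H l := by simp [listMon]
    have h2 : weight y.1.2.2.2 (d :: l) = y.1.2.2.2 d.1 * weight y.1.2.2.2 l := by simp [weight]
    rw [h1, h2, evalMon_add hy, evalMon_edgeMon, ih]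

/-- A monomial which does not contain the variable at `i` does not depend on it. -/
theorem evalMon_update (hv : v (Sum.inr (Sum.inr i)) = 0) (ζ : ℂ) :
    evalMon v (y.1, Function.update y.2 i ζ) = evalMon v y := by
  simp only [evalMon]
  congr 1
  refine Finset.prod_congr rfl fun k _ => ?_
  by_cases hk : k = i
  · subst hk
    simp [hv]
  · simp [hk]

theorem update_mem_dom (hy : y ∈ (monomialSystem n H E).dom) {ζ : ℂ} (hζ : ζ ≠ 0) (i : Fin n) :
    (y.1, Function.update y.2 i ζ) ∈ (monomialSystem n H E).dom := by
  refine ⟨hy.1, fun k => ?_⟩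
  by_cases hk : k = i
  · subst hk
    simpa using hζ
  · simpa [hk] using hy.2 k

theorem differentiable_update (i : Fin n) : Differentiable ℂ
    fun x : ((ℂ × ℂ × (H → ℂ) × (E → ℂ)) × (Fin n → ℂ)) × ℂ =>
      (x.1.1, Function.update x.1.2 i x.2) := by
  refine Differentiable.prodMk (by fun_prop) (differentiable_pi.2 fun k => ?_)
  by_cases hk : k = i
  · subst hk
    simp only [Function.update_self]
    exact differentiable_snd
  · simp only [Function.update_of_ne hk]
    fun_prop

/-- Multiplying all labels by a generic number makes finitely many Pochhammer symbols of monomials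
nonzero. -/
theorem dom_subset_closure {T : Finset (Monomial n H E)} (hT : ∀ v ∈ T, 1 ≤ labelDeg n H E v) :
    (monomialSystem n H E).dom ⊆ closure {y ∈ (monomialSystem n H E).dom |
      ∀ v ∈ T, (monomialSystem n H E).poch v y ≠ 0} := by
  intro y hy
  let φ : ℂ → (ℂ × ℂ × (H → ℂ) × (E → ℂ)) × (Fin n → ℂ) := fun s =>
    ((y.1.1, y.1.2.1, s • y.1.2.2.1, s • y.1.2.2.2), y.2)
  have hφ : Continuous φ := by fun_prop
  have hφ1 : φ 1 = y := by simp [φ]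
  have hdom : ∀ s ≠ 0, φ s ∈ (monomialSystem n H E).dom := fun s hs =>
    ⟨⟨hy.1.1, hy.1.2.1, fun h => mul_ne_zero hs (hy.1.2.2.1 h),
      fun e => mul_ne_zero hs (hy.1.2.2.2 e)⟩, hy.2⟩
  have hχ : ∀ v, ∀ s ≠ (0 : ℂ), evalMon v (φ s) = s ^ labelDeg n H E v * evalMon v y := by
    intro v s hs
    have h1 : ∀ h, (s • y.1.2.2.1) h ^ v (Sum.inl h) =
        s ^ v (Sum.inl h) * y.1.2.2.1 h ^ v (Sum.inl h) := fun h => mul_zpow _ _ _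
    have h2 : ∀ e, (s • y.1.2.2.2) e ^ v (Sum.inr (Sum.inl e)) =
        s ^ v (Sum.inr (Sum.inl e)) * y.1.2.2.2 e ^ v (Sum.inr (Sum.inl e)) := fun h =>
      mul_zpow _ _ _
    have h3 : s ^ labelDeg n H E v =
        (∏ h, s ^ v (Sum.inl h)) * ∏ e, s ^ v (Sum.inr (Sum.inl e)) := by
      rw [labelDeg, AddMonoidHom.coe_mk, ZeroHom.coe_mk, zpow_add₀ hs,
        zpow_sum_of_ne_zero hs, zpow_sum_of_ne_zero hs]
    rw [h3]
    simp only [evalMon, φ, h1, h2, Finset.prod_mul_distrib]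
    ring
  -- for every factor of the Pochhammer symbols only finitely many scaling factors are bad
  let bad : Set ℂ := {0} ∪ ⋃ v ∈ T, ⋃ k : ℕ × ℕ,
    {s | y.1.1 ^ k.1 * y.1.2.1 ^ k.2 * (s ^ labelDeg n H E v * evalMon v y) = 1}
  have hbad : bad.Countable := by
    refine (countable_singleton 0).union (T.countable_toSet.biUnion fun v hv =>
      countable_iUnion fun k => Set.Finite.countable ?_)
    obtain ⟨m, hm⟩ := Int.eq_ofNat_of_zero_le (zero_le_one.trans (hT v hv))
    have hm1 : m ≠ 0 := by
      have := hT v hv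
      omega
    let c := y.1.1 ^ k.1 * y.1.2.1 ^ k.2 * evalMon v y
    refine (Polynomial.finite_setOfPred_isRoot (p := Polynomial.C c * Polynomial.X ^ m - 1)
      ?_).subset ?_
    · intro h
      have := congrArg (Polynomial.eval 0) h
      simp [hm1] at this
    · intro s hs
      rw [mem_ofPred_eq, hm, zpow_natCast] at hs
      simp only [mem_ofPred_eq, Polynomial.IsRoot, Polynomial.eval_sub, Polynomial.eval_mul,
        Polynomial.eval_C, Polynomial.eval_pow, Polynomial.eval_X, Polynomial.eval_one, c]
      rw [← hs]
      ring
  have hdense : Dense badᶜ := hbad.dense_compl ℂ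
  have h1 := mem_closure_image hφ.continuousAt (hdense 1)
  rw [hφ1] at h1
  refine closure_mono ?_ h1
  rintro _ ⟨s, hs, rfl⟩
  have hs0 : s ≠ 0 := fun h => hs (Or.inl h)
  refine ⟨hdom s hs0, fun v hv => (MonomialSystem.poch_ne_zero_iff (hdom s hs0)).2 fun a b h => ?_⟩
  refine hs (Or.inr (mem_biUnion hv (mem_iUnion.2 ⟨(a, b), ?_⟩)))
  rw [mem_ofPred_eq, ← hχ v s hs0]
  exact h

section Poles

variable {G : HalfEdgeGraph n H E} {inner : List (Fin n)}

/-- The arrival weights are the values of the monomials of arrivals. -/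
theorem arrivalWeight_iff (hl : inner.Nodup) (hy : y ∈ (monomialSystem n H E).dom) {x : ℂ} :
    G.ArrivalWeight y.1.2.2.1 y.1.2.2.2 inner i y.2 x ↔
      ∃ v ∈ G.arrivalMonomials inner.toFinset i, x = evalMon v y := by
  have hmem : ∀ k, k ∈ inner.toFinset ↔ k ∈ inner := fun k => List.mem_toFinset
  constructor
  · rintro (⟨h, l, hp, hs, hlen, rfl⟩ | ⟨d, l, hdi, hd, hp, hs, hlen, hx⟩)
    · refine ⟨_, mem_arrivalMonomials.2 ⟨_, (length_le_lengthBound_iff hl hs).1 hlen,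
        arrival_iff.2 (Or.inl ⟨h, l, hp, by simpa only [hmem] using hs, rfl, rfl⟩)⟩, ?_⟩
      rw [evalMon_add hy, evalMon_halfMon, evalMon_listMon hy]
    · obtain ⟨s, hs1, hx⟩ : ∃ s : ℤ, (s = 1 ∨ s = -1) ∧
          x = y.2 (G.start d) ^ s * y.1.2.2.2 d.1 * weight y.1.2.2.2 l := by
        rcases hx with rfl | rfl
        · exact ⟨1, Or.inl rfl, by rw [zpow_one]⟩
        · exact ⟨-1, Or.inr rfl, by rw [zpow_neg_one]⟩
      refine ⟨_, mem_arrivalMonomials.2 ⟨_, (length_le_lengthBound_iff hl hs).1 hlen,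
        arrival_iff.2 (Or.inr ⟨d, l, s, hs1, by simp [hdi, hd], hp,
          by simpa only [hmem] using hs, rfl, rfl⟩)⟩, ?_⟩
      rw [evalMon_add hy, evalMon_add hy, evalMon_zsmul, evalMon_vertMon, evalMon_edgeMon,
        evalMon_listMon hy, hx]
  · rintro ⟨v, hv, rfl⟩
    obtain ⟨ℓ, hℓ, hv⟩ := mem_arrivalMonomials.1 hv
    rcases arrival_iff.1 hv with ⟨h, l, hp, hs, rfl, rfl⟩ | ⟨d, l, s, hs1, hd, hp, hs, rfl, rfl⟩
    · simp only [hmem] at hs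
      refine Or.inl ⟨h, l, hp, hs, (length_le_lengthBound_iff hl hs).2 hℓ, ?_⟩
      rw [evalMon_add hy, evalMon_halfMon, evalMon_listMon hy]
    · simp only [hmem] at hs
      simp only [Finset.mem_insert, hmem, not_or] at hd
      refine Or.inr ⟨d, l, hd.1, hd.2, hp, hs, (length_le_lengthBound_iff hl hs).2 hℓ, ?_⟩
      rw [evalMon_add hy, evalMon_add hy, evalMon_zsmul, evalMon_vertMon, evalMon_edgeMon,
        evalMon_listMon hy]
      rcases hs1 with rfl | rfl
      · exact Or.inl (by rw [zpow_one])
      · exact Or.inr (by rw [zpow_neg_one])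

theorem returnWeight_iff (hl : inner.Nodup) (hy : y ∈ (monomialSystem n H E).dom) {x : ℂ} :
    G.ReturnWeight y.1.2.2.2 inner i x ↔
      ∃ v ∈ G.returnMonomials inner.toFinset i, x = evalMon v y := by
  have hmem : ∀ k, k ∈ inner.toFinset ↔ k ∈ inner := fun k => List.mem_toFinset
  constructor
  · rintro ⟨d, l, hd, hp, hs, hlen, rfl⟩
    refine ⟨_, mem_returnMonomials.2 ⟨_, (length_le_lengthBound_iff hl hs).1 hlen,
      walk_iff.2 ⟨d, l, hd, hp, by simpa only [hmem] using hs, rfl, rfl⟩⟩, ?_⟩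
    rw [evalMon_add hy, evalMon_edgeMon, evalMon_listMon hy]
  · rintro ⟨v, hv, rfl⟩
    obtain ⟨ℓ, hℓ, hv⟩ := mem_returnMonomials.1 hv
    obtain ⟨d, l, hd, hp, hs, rfl, rfl⟩ := walk_iff.1 hv
    simp only [hmem] at hs
    refine ⟨d, l, hd, hp, hs, (length_le_lengthBound_iff hl hs).2 hℓ, ?_⟩
    rw [evalMon_add hy, evalMon_edgeMon, evalMon_listMon hy]

theorem innerPoles_eq_poleSet (hl : inner.Nodup) (hy : y ∈ (monomialSystem n H E).dom) :
    G.innerPoles y.1.1 y.1.2.1 y.1.2.2.1 y.1.2.2.2 inner i y.2 =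
      (monomialSystem n H E).poleSet (G.arrivalMonomials inner.toFinset i)
        (G.returnMonomials inner.toFinset i) y := by
  ext x
  simp only [innerPoles, MonomialSystem.poleSet, mem_ofPred_eq, arrivalWeight_iff hl hy,
    returnWeight_iff hl hy]
  constructor
  · rintro (⟨_, ⟨v, hv, rfl⟩, a, b, h⟩ | ⟨_, ⟨v, hv, rfl⟩, a, b, h⟩)
    · exact Or.inl ⟨v, hv, a, b, h⟩
    · exact Or.inr ⟨v, hv, a, b, h⟩
  · rintro (⟨v, hv, a, b, h⟩ | ⟨v, hv, a, b, h⟩)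
    · exact Or.inl ⟨_, ⟨v, hv, rfl⟩, a, b, h⟩
    · exact Or.inr ⟨_, ⟨v, hv, rfl⟩, a, b, h⟩

end Poles

end HalfEdgeGraph

end GraphSystem

/-! ### Iterated integrals over deformed contours -/

section IteratedIntegrals

open Filter Topology Metric Set

/-- Divisibility in the ring of holomorphic functions yields a holomorphic cofactor. -/
theorem exists_cofactor_of_dvd {Z : Type*} [NormedAddCommGroup Z] [NormedSpace ℂ Z] {s : Set Z}
    {f g : holomorphicSubring s} (h : f ∣ g) :
    ∃ c : Z → ℂ, DifferentiableOn ℂ c s ∧ ∀ x (hx : x ∈ s), g.1 ⟨x, hx⟩ = f.1 ⟨x, hx⟩ * c x := by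
  obtain ⟨⟨c, C, hC, hc⟩, rfl⟩ := h
  exact ⟨C, hC, fun x hx => by simp [hc]⟩

namespace MonomialSystem

variable {Y Λ : Type*} [NormedAddCommGroup Y] [NormedSpace ℂ Y] [AddCommGroup Λ]

/-- The Pochhammer symbol of a monomial as an element of the ring of holomorphic functions. -/
noncomputable def pochElt (M : MonomialSystem Y Λ) (v : Λ) : holomorphicSubring M.dom :=
  ⟨fun y => M.poch v y, M.poch v, differentiableOn_poch v, fun _ => rfl⟩

theorem pochElt_apply (M : MonomialSystem Y Λ) (v : Λ) (y : M.dom) :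
    (M.pochElt v).1 y = M.poch v y := rfl

end MonomialSystem

namespace HalfEdgeGraph

section Denominator

variable {n : ℕ} {H E : Type*} {G : HalfEdgeGraph n H E}

/-- The exponent `1` or `-1`. -/
def signExp (b : Bool) : ℤ := if b then 1 else -1

theorem signExp_eq (b : Bool) : signExp b = 1 ∨ signExp b = -1 := by
  cases b <;> simp [signExp]

theorem signExp_injective : Function.Injective signExp := by
  intro a b
  cases a <;> cases b <;> simp [signExp]

/-- The monomials of the factors of the denominator. -/
noncomputable def denominatorMon (G : HalfEdgeGraph n H E) :
    (H × Bool) ⊕ (E × Bool × Bool) → Monomial n H E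
  | Sum.inl x => halfMon n E x.1 + signExp x.2 • vertMon H E (G.base x.1)
  | Sum.inr x => (signExp x.2.1 • vertMon H E (G.src x.1) + edgeMon n H x.1) +
      signExp x.2.2 • vertMon H E (G.tgt x.1)

theorem denominatorMon_injective : Function.Injective G.denominatorMon := by
  classical
  rintro (⟨h, b⟩ | ⟨e, b, c⟩) (⟨h', b'⟩ | ⟨e', b', c'⟩) hxy
  · have h1 : h = h' := by
      have := congrFun hxy (Sum.inl h)
      by_contra hne
      simp [denominatorMon, halfMon, vertMon, hne] at this
    subst h1
    have h2 := congrFun hxy (Sum.inr (Sum.inr (G.base h)))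
    simp only [denominatorMon, halfMon, vertMon, Pi.add_apply, Pi.smul_apply, Pi.single_apply,
      if_true, reduceCtorEq, if_false, zero_add, smul_eq_mul, mul_one] at h2
    rw [signExp_injective h2]
  · have := congrFun hxy (Sum.inl h)
    simp [denominatorMon, halfMon, edgeMon, vertMon] at this
  · have := congrFun hxy (Sum.inl h')
    simp [denominatorMon, halfMon, edgeMon, vertMon] at this
  · have h1 : e = e' := by
      have := congrFun hxy (Sum.inr (Sum.inl e))
      by_contra hne
      simp [denominatorMon, edgeMon, vertMon, hne] at this
    subst h1
    have hst := G.src_ne_tgt e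
    have h2 := congrFun hxy (Sum.inr (Sum.inr (G.src e)))
    have h3 := congrFun hxy (Sum.inr (Sum.inr (G.tgt e)))
    simp only [denominatorMon, edgeMon, vertMon, Pi.add_apply, Pi.smul_apply, Pi.single_apply,
      if_true, reduceCtorEq, if_false, add_zero, zero_add, smul_eq_mul, mul_one, mul_zero,
      Sum.inr.injEq, hst, hst.symm] at h2 h3
    rw [signExp_injective h2, signExp_injective h3]

end Denominator

variable {n : ℕ} {H E : Type*} [Fintype H] [Fintype E] (G : HalfEdgeGraph n H E)

/-- The product of the Pochhammer symbols by which the integral over the variables at `S` has to be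
multiplied in order to become holomorphic. -/
noncomputable def attachedFactor (S : Finset (Fin n))
    (y : (ℂ × ℂ × (H → ℂ) × (E → ℂ)) × (Fin n → ℂ)) : ℂ :=
  (∏ v ∈ G.openMonomials S, (monomialSystem n H E).poch v y) *
    ∏ v ∈ G.closedMonomials S, (monomialSystem n H E).poch v y

/-- The part of `attachedFactor` which does not depend on the variable at `i`. -/
noncomputable def avoidingFactor (S : Finset (Fin n)) (i : Fin n)
    (y : (ℂ × ℂ × (H → ℂ) × (E → ℂ)) × (Fin n → ℂ)) : ℂ :=
  (∏ v ∈ G.avoidingMonomials S i, (monomialSystem n H E).poch v y) *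
    (∏ v ∈ G.returnMonomials S i, (monomialSystem n H E).poch v y) *
    ∏ v ∈ G.closedMonomials S, (monomialSystem n H E).poch v y

variable {G} {S : Finset (Fin n)} {i : Fin n} {y : (ℂ × ℂ × (H → ℂ) × (E → ℂ)) × (Fin n → ℂ)}

theorem poch_update {v : Monomial n H E} (hv : v (Sum.inr (Sum.inr i)) = 0) (ζ : ℂ) :
    (monomialSystem n H E).poch v (y.1, Function.update y.2 i ζ) =
      (monomialSystem n H E).poch v y :=
  congrArg (ellPoch y.1.1 y.1.2.1) (evalMon_update hv ζ)

theorem poch_add_zsmul_update {v : Monomial n H E} (hv : v (Sum.inr (Sum.inr i)) = 0)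
    (hy : y ∈ (monomialSystem n H E).dom) {ζ : ℂ} (hζ : ζ ≠ 0) (m : ℤ) :
    (monomialSystem n H E).poch (v + m • vertMon H E i) (y.1, Function.update y.2 i ζ) =
      ellPoch y.1.1 y.1.2.1 (evalMon v y * ζ ^ m) := by
  refine congrArg (ellPoch y.1.1 y.1.2.1) ?_
  change evalMon _ _ = _
  rw [evalMon_add (update_mem_dom hy hζ i), evalMon_update hv, evalMon_zsmul, evalMon_vertMon]
  simp only [Function.update_self]

theorem avoidingFactor_update (ζ : ℂ) :
    G.avoidingFactor S i (y.1, Function.update y.2 i ζ) = G.avoidingFactor S i y := by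
  unfold avoidingFactor
  congr 1
  · congr 1
    · exact Finset.prod_congr rfl fun v hv => poch_update (apply_vert_of_mem_avoidingMonomials hv) ζ
    · exact Finset.prod_congr rfl fun v hv => poch_update (apply_vert_of_mem_returnMonomials hv i) ζ
  · exact Finset.prod_congr rfl fun v hv => poch_update (apply_vert_of_mem_closedMonomials hv i) ζ

/-- As a function of the variable `ζ` at `i`, the factor attached to `S` divides the product of a
constant and the factors with poles at the pole set and its reciprocals. -/
theorem exists_attachedFactor_update_mul (hi : i ∉ S) :
    ∃ c : (ℂ × ℂ × (H → ℂ) × (E → ℂ)) × (Fin n → ℂ) → ℂ,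
      DifferentiableOn ℂ c (monomialSystem n H E).dom ∧
      ∀ y ∈ (monomialSystem n H E).dom, ∀ ζ ≠ 0, G.avoidingFactor S i y *
        ((monomialSystem n H E).factor (G.arrivalMonomials S i) (G.returnMonomials S i) y ζ *
          (monomialSystem n H E).factor (G.arrivalMonomials S i) (G.returnMonomials S i) y ζ⁻¹) =
        G.attachedFactor S (y.1, Function.update y.2 i ζ) *
          c (y.1, Function.update y.2 i ζ) := by
  obtain ⟨c, hc, h⟩ := exists_cofactor_of_dvd
    (prod_openMonomials_dvd (G := G) (monomialSystem n H E).pochElt hi)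
  refine ⟨c, hc, fun y hy ζ hζ => ?_⟩
  have := h _ (update_mem_dom hy hζ i)
  simp only [Subring.coe_mul, Pi.mul_apply, holomorphicSubring_prod_apply,
    MonomialSystem.pochElt_apply] at this
  refine Eq.trans ?_ this
  rw [← avoidingFactor_update ζ]
  unfold avoidingFactor MonomialSystem.factor
  congr 1
  congr 1 <;> congr 1 <;> refine Finset.prod_congr rfl fun v hv => ?_
  · have := poch_add_zsmul_update (apply_vert_of_mem_arrivalMonomials hv) hy hζ 1
    rw [one_smul, zpow_one] at this
    exact this.symm
  · have := poch_add_zsmul_update (apply_vert_of_mem_returnMonomials hv i) hy hζ 2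
    rw [show (2 : ℤ) • vertMon H E i = 2 • vertMon H E i from natCast_zsmul _ 2,
      show ζ ^ (2 : ℤ) = ζ ^ 2 from zpow_natCast _ 2] at this
    exact this.symm
  · have := poch_add_zsmul_update (apply_vert_of_mem_arrivalMonomials hv) hy hζ (-1)
    rw [neg_one_smul, zpow_neg_one, ← sub_eq_add_neg] at this
    exact this.symm
  · have := poch_add_zsmul_update (apply_vert_of_mem_returnMonomials hv i) hy hζ (-2)
    rw [neg_smul, show (2 : ℤ) • vertMon H E i = 2 • vertMon H E i from natCast_zsmul _ 2,
      zpow_neg, show ζ ^ (2 : ℤ) = ζ ^ 2 from zpow_natCast _ 2, ← inv_pow,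
      ← sub_eq_add_neg] at this
    exact this.symm

/-- The part of the factor attached to `S` that survives the integration over the variable at `i`,
together with the pinches that occur in this integration, divides the factor attached to
`insert i S`. -/
theorem exists_attachedFactor_insert (hi : i ∉ S) :
    ∃ c : (ℂ × ℂ × (H → ℂ) × (E → ℂ)) × (Fin n → ℂ) → ℂ,
      DifferentiableOn ℂ c (monomialSystem n H E).dom ∧
      ∀ y ∈ (monomialSystem n H E).dom, G.attachedFactor (insert i S) y =
        G.avoidingFactor S i y * (monomialSystem n H E).pinchFactor (G.arrivalPairs S i)
          (G.arrivalReturnPairs S i) (G.returnPairs S i) y * c y := by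
  obtain ⟨c, hc, h⟩ := exists_cofactor_of_dvd
    (prod_dvd_prod_openMonomials_insert (G := G) (monomialSystem n H E).pochElt hi)
  refine ⟨c, hc, fun y hy => ?_⟩
  have := h y hy
  simp only [Subring.coe_mul, Pi.mul_apply, holomorphicSubring_prod_apply,
    MonomialSystem.pochElt_apply] at this
  exact this

theorem dom_subset_closure_attachedFactor (S : Finset (Fin n)) : (monomialSystem n H E).dom ⊆
    closure {y ∈ (monomialSystem n H E).dom | G.attachedFactor S y ≠ 0} := by
  classical
  refine (dom_subset_closure (T := G.openMonomials S ∪ G.closedMonomials S) fun v hv => ?_).trans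
    (closure_mono fun y hy => ⟨hy.1, mul_ne_zero ?_ ?_⟩)
  · rcases Finset.mem_union.1 hv with hv | hv
    · exact one_le_labelDeg_of_mem_openMonomials hv
    · exact one_le_labelDeg_of_mem_closedMonomials hv
  · exact Finset.prod_ne_zero_iff.2 fun v hv => hy.2 v (Finset.mem_union_left _ hv)
  · exact Finset.prod_ne_zero_iff.2 fun v hv => hy.2 v (Finset.mem_union_right _ hv)

section Denominator

/-- A half-edge, and an edge regarded as two half-edges, are open segments of length one. -/
theorem denominatorMon_mem (x) : G.denominatorMon x ∈ G.openMonomials ∅ := by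
  refine mem_openMonomials.2 ⟨1, one_le_lengthBound _, Or.inl ?_⟩
  rcases x with ⟨h, b⟩ | ⟨e, b, b'⟩
  · exact ⟨_, _, signExp b, Finset.notMem_empty _, signExp_eq b, .half h, rfl⟩
  · exact ⟨_, _, signExp b', Finset.notMem_empty _, signExp_eq b',
      .edge (e, true) (signExp b) (signExp_eq b) (Finset.notMem_empty _), rfl⟩

theorem denominator_eq_prod (hy : y ∈ (monomialSystem n H E).dom) :
    G.denominator y.1.1 y.1.2.1 y.1.2.2.1 y.1.2.2.2 y.2 =
      ∏ x, (monomialSystem n H E).poch (G.denominatorMon x) y := by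
  have hp : ∀ v : Monomial n H E, (monomialSystem n H E).poch v y =
    ellPoch y.1.1 y.1.2.1 (evalMon v y) := fun v => rfl
  simp only [denominator, Fintype.prod_sum_type, Fintype.prod_prod_type, Fintype.prod_bool, hp,
    denominatorMon, evalMon_add hy, evalMon_zsmul, evalMon_halfMon, evalMon_edgeMon,
    evalMon_vertMon, signExp, if_true, Bool.false_eq_true, if_false, zpow_one, zpow_neg]
  congr 1
  refine Finset.prod_congr rfl fun e _ => ?_
  simp only [mul_assoc, mul_comm, mul_left_comm]

theorem exists_attachedFactor_empty (G : HalfEdgeGraph n H E) :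
    ∃ c : (ℂ × ℂ × (H → ℂ) × (E → ℂ)) × (Fin n → ℂ) → ℂ,
      DifferentiableOn ℂ c (monomialSystem n H E).dom ∧
      ∀ y ∈ (monomialSystem n H E).dom, G.attachedFactor ∅ y =
        G.denominator y.1.1 y.1.2.1 y.1.2.2.1 y.1.2.2.2 y.2 * c y := by
  classical
  have h1 : ∏ x, (monomialSystem n H E).pochElt (G.denominatorMon x) ∣
      (∏ v ∈ G.openMonomials ∅, (monomialSystem n H E).pochElt v) *
        ∏ v ∈ G.closedMonomials ∅, (monomialSystem n H E).pochElt v := by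
    rw [← Finset.prod_image (f := (monomialSystem n H E).pochElt) denominatorMon_injective.injOn]
    refine Dvd.dvd.mul_right (Finset.prod_dvd_prod_of_subset _ _ _ ?_) _
    intro v hv
    obtain ⟨x, -, rfl⟩ := Finset.mem_image.1 hv
    exact denominatorMon_mem x
  obtain ⟨c, hc, h⟩ := exists_cofactor_of_dvd h1
  refine ⟨c, hc, fun y hy => ?_⟩
  have := h y hy
  simp only [Subring.coe_mul, Pi.mul_apply, holomorphicSubring_prod_apply,
    MonomialSystem.pochElt_apply] at this
  rw [denominator_eq_prod hy]
  exact this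

end Denominator

/-- The iterated integrals over the variables of a list exist where the attached factor does not
vanish, they do not depend on the contours, and their product with the attached factor extends to a
holomorphic function of the parameters and the remaining variables. -/
theorem exists_isDeformedIntegral_iff (G : HalfEdgeGraph n H E)
    {F : ℂ → ℂ → (H → ℂ) → (E → ℂ) → (Fin n → ℂ) → ℂ}
    {hol : (ℂ × ℂ × (H → ℂ) × (E → ℂ)) × (Fin n → ℂ) → ℂ}
    (hhol : DifferentiableOn ℂ hol (monomialSystem n H E).dom)
    (hF : ∀ y ∈ (monomialSystem n H E).dom,
      G.denominator y.1.1 y.1.2.1 y.1.2.2.1 y.1.2.2.2 y.2 ≠ 0 →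
      F y.1.1 y.1.2.1 y.1.2.2.1 y.1.2.2.2 y.2 *
        G.denominator y.1.1 y.1.2.1 y.1.2.2.1 y.1.2.2.2 y.2 = hol y)
    {l : List (Fin n)} (hl : l.Nodup) :
    ∃ Φ : (ℂ × ℂ × (H → ℂ) × (E → ℂ)) × (Fin n → ℂ) → ℂ,
      DifferentiableOn ℂ Φ (monomialSystem n H E).dom ∧
      ∀ y ∈ (monomialSystem n H E).dom, G.attachedFactor l.toFinset y ≠ 0 → ∀ I,
        IsDeformedIntegral G y.1.1 y.1.2.1 y.1.2.2.1 y.1.2.2.2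
          (F y.1.1 y.1.2.1 y.1.2.2.1 y.1.2.2.2) l y.2 I ↔
        I = Φ y / G.attachedFactor l.toFinset y := by
  induction l with
  | nil =>
    obtain ⟨c, hc, hcd⟩ := exists_attachedFactor_empty G
    refine ⟨fun y => hol y * c y, hhol.mul hc, fun y hy hD I => ?_⟩
    rw [List.toFinset_nil] at hD ⊢
    rw [hcd y hy] at hD ⊢
    beta_reduce
    rw [IsDeformedIntegral, ← hF y hy (left_ne_zero_of_mul hD)]
    have h1 := left_ne_zero_of_mul hD
    have h2 := right_ne_zero_of_mul hD
    rw [mul_div_mul_right _ _ h2, mul_div_cancel_right₀ _ h1]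
  | cons i l ih =>
    obtain ⟨hil, hl⟩ := List.nodup_cons.1 hl
    obtain ⟨Φ', hΦ', hI⟩ := ih hl
    have hi : i ∉ l.toFinset := by simpa using hil
    obtain ⟨c, hc, hcd⟩ := exists_attachedFactor_update_mul (G := G) hi
    obtain ⟨c₂, hc₂, hcd₂⟩ := exists_attachedFactor_insert (G := G) hi
    rw [List.toFinset_cons]
    generalize hS : l.toFinset = S at *
    let M := monomialSystem n H E
    let U : (ℂ × ℂ × (H → ℂ) × (E → ℂ)) × (Fin n → ℂ) → ℂ →
      (ℂ × ℂ × (H → ℂ) × (E → ℂ)) × (Fin n → ℂ) := fun y ζ => (y.1, Function.update y.2 i ζ)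
    have hU : ∀ y ∈ M.dom, ∀ ζ ≠ 0, U y ζ ∈ M.dom := fun y hy ζ hζ => update_mem_dom hy hζ i
    have hUd : DifferentiableOn ℂ (Function.uncurry U) (M.dom ×ˢ {0}ᶜ) :=
      (differentiable_update i).differentiableOn
    have hUm : MapsTo (Function.uncurry U) (M.dom ×ˢ {0}ᶜ) M.dom := fun x hx => hU _ hx.1 _ hx.2
    obtain ⟨m, φ, hφ⟩ := exists_injective_lex (H ⊕ E ⊕ Fin n)
    have hHH : ∀ v ∈ G.arrivalMonomials S i, ∀ w ∈ G.arrivalMonomials S i,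
        v + w ∈ G.arrivalPairs S i := fun v hv w hw => mem_arrivalPairs.2 ⟨v, hv, w, hw, rfl⟩
    have hHL : ∀ v ∈ G.arrivalMonomials S i, ∀ w ∈ G.returnMonomials S i,
        2 • v + w ∈ G.arrivalReturnPairs S i := fun v hv w hw =>
      mem_arrivalReturnPairs.2 ⟨v, hv, w, hw, rfl⟩
    have hLL : ∀ v ∈ G.returnMonomials S i, ∀ w ∈ G.returnMonomials S i,
        v + w ∈ G.returnPairs S i := fun v hv w hw => mem_returnPairs.2 ⟨v, hv, w, hw, rfl⟩
    -- `Φ' (U y ζ) / attachedFactor S (U y ζ)` is the inner integral as a function of `ζ`; up to the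
    -- avoiding factor it is `Φ' * c` divided by the factors which contain `ζ` and `ζ⁻¹`
    obtain ⟨Ψ, hΨ, hΨI⟩ := MonomialSystem.exists_residueExtension hφ M hHH hHL hLL
      (h := fun y ζ => Φ' (U y ζ) * c (U y ζ)) ((hΦ'.comp hUd hUm).mul (hc.comp hUd hUm))
      ((dom_subset_closure_attachedFactor (G := G) (insert i S)).trans (closure_mono fun y hy =>
        ⟨hy.1, fun h => hy.2 (by rw [hcd₂ y hy.1, h, mul_zero, zero_mul])⟩))
    refine ⟨fun y => Ψ y * c₂ y, hΨ.mul hc₂, fun y hy hD I => ?_⟩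
    have hD' := hD
    rw [hcd₂ y hy] at hD'
    have hc₂0 := right_ne_zero_of_mul hD'
    have hav0 := left_ne_zero_of_mul (left_ne_zero_of_mul hD')
    have hpinch0 := right_ne_zero_of_mul (left_ne_zero_of_mul hD')
    have hpoles := innerPoles_eq_poleSet (G := G) (i := i) hl hy
    rw [hS] at hpoles
    have hne : ∀ Γ : Contour, Γ.Separates
        (M.poleSet (G.arrivalMonomials S i) (G.returnMonomials S i) y) → ∀ ζ ∈ Γ.trace,
        ζ ≠ 0 ∧ G.attachedFactor S (U y ζ) ≠ 0 ∧ c (U y ζ) ≠ 0 := by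
      intro Γ hΓ ζ hζ
      obtain ⟨h0, h1, h2⟩ := hΓ.inv_notMem hζ
      have h3 : G.attachedFactor S (U y ζ) * c (U y ζ) ≠ 0 := by
        rw [← hcd y hy ζ h0]
        exact mul_ne_zero hav0 (mul_ne_zero (MonomialSystem.factor_ne_zero hy h0 h2)
          (MonomialSystem.factor_ne_zero hy (inv_ne_zero h0) (by rwa [inv_inv])))
      exact ⟨h0, left_ne_zero_of_mul h3, right_ne_zero_of_mul h3⟩
    -- the value of the outer integral over an arbitrary separating contour
    have hvalue : ∀ (Γ : Contour) (g : ℂ → ℂ), Γ.Separates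
        (M.poleSet (G.arrivalMonomials S i) (G.returnMonomials S i) y) →
        (∀ ζ ∈ Γ.trace, g ζ = Φ' (U y ζ) / G.attachedFactor S (U y ζ)) →
        (2 * Real.pi * Complex.I)⁻¹ * (Γ.integral fun ζ => ζ⁻¹ * g ζ) =
          Ψ y * c₂ y / G.attachedFactor (insert i S) y := by
      intro Γ g hΓ hg
      have e : EqOn (fun ζ => ζ⁻¹ * g ζ) (fun ζ => (G.avoidingFactor S i y)⁻¹ *
          (ζ⁻¹ * (Φ' (U y ζ) * c (U y ζ) /
            (M.factor (G.arrivalMonomials S i) (G.returnMonomials S i) y ζ *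
              M.factor (G.arrivalMonomials S i) (G.returnMonomials S i) y ζ⁻¹)))) Γ.trace := by
        intro ζ hζ
        obtain ⟨h0, h1, h2⟩ := hne Γ hΓ ζ hζ
        have h3 := hcd y hy ζ h0
        change _ = G.attachedFactor S (U y ζ) * c (U y ζ) at h3
        have h4 : M.factor (G.arrivalMonomials S i) (G.returnMonomials S i) y ζ *
              M.factor (G.arrivalMonomials S i) (G.returnMonomials S i) y ζ⁻¹ ≠ 0 := fun h => by
          have h5 := mul_ne_zero h1 h2
          rw [← h3] at h5
          exact h5 (by rw [show _ * _ = (0 : ℂ) from h, mul_zero])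
        simp only
        rw [hg ζ hζ]
        change G.avoidingFactor S i y * (M.factor (G.arrivalMonomials S i) (G.returnMonomials S i)
          y ζ * M.factor (G.arrivalMonomials S i) (G.returnMonomials S i) y ζ⁻¹) = _ at h3
        generalize M.factor (G.arrivalMonomials S i) (G.returnMonomials S i) y ζ *
              M.factor (G.arrivalMonomials S i) (G.returnMonomials S i) y ζ⁻¹ = f at *
        field_simp
        linear_combination Φ' (U y ζ) * h3
      rw [Contour.integral_congr e, Contour.integral_const_mul, ← hΨI y hy hpinch0 Γ hΓ, hcd₂ y hy]
      have key : ∀ K P J c T : ℂ, K ≠ 0 → P ≠ 0 → c ≠ 0 →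
          T * (K⁻¹ * J) = P * (T * J) * c / (K * P * c) := by
        intro K P J c T hK hP hc
        field_simp
      exact key _ _ _ _ _ hav0 hpinch0 hc₂0
    rw [IsDeformedIntegral, hpoles]
    constructor
    · rintro ⟨Γ, g, hΓ, -, hg, rfl⟩
      exact hvalue Γ g hΓ fun ζ hζ => by
        obtain ⟨h0, h1, h2⟩ := hne Γ hΓ ζ hζ
        exact (hI (U y ζ) (hU y hy ζ h0) h1 _).1 (hg ζ hζ)
    · rintro rfl
      obtain ⟨R, hR, N, -, hyN, -, hA, -⟩ := MonomialSystem.exists_radius M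
        (G.arrivalMonomials S i) (G.returnMonomials S i) hy
      obtain ⟨Γ, hΓ, -⟩ := MonomialSystem.exists_separates_poleSet hy hHH hHL hLL hpinch0 hR
        (hA y hyN)
      refine ⟨Γ, fun ζ => Φ' (U y ζ) / G.attachedFactor S (U y ζ), hΓ, ?_, fun ζ hζ => ?_,
        (hvalue Γ _ hΓ fun ζ _ => rfl).symm⟩
      · have hUc : ContinuousOn (U y) Γ.trace := by
          refine Continuous.continuousOn ?_
          exact (differentiable_update i).continuous.comp (by fun_prop : Continuous fun ζ => (y, ζ))
        have hm : MapsTo (U y) Γ.trace M.dom := fun ζ hζ => hU y hy ζ (hne Γ hΓ ζ hζ).1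
        have hatt : DifferentiableOn ℂ (G.attachedFactor S) M.dom :=
          (differentiableOn_prod _ fun v _ => MonomialSystem.differentiableOn_poch v).mul
            (differentiableOn_prod _ fun v _ => MonomialSystem.differentiableOn_poch v)
        exact (hΦ'.continuousOn.comp hUc hm).div (hatt.continuousOn.comp hUc hm) fun ζ hζ =>
          (hne Γ hΓ ζ hζ).2.1
      · obtain ⟨h0, h1, h2⟩ := hne Γ hΓ ζ hζ
        exact (hI (U y ζ) (hU y hy ζ h0) h1 _).2 rfl

end HalfEdgeGraph

end IteratedIntegrals

/-! ### Integrals over the unit torus -/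

section UnitTorus

open Filter Topology Metric Set MeasureTheory

/-- The points all of whose coordinates lie on the unit circle. -/
def unitTorus (n : ℕ) : Set (Fin n → ℂ) := {z | ∀ k, ‖z k‖ = 1}

/-- The iterated integral over unit circles of `f` with respect to `dz / (2 π i z)` in the variables
of a list. -/
noncomputable def circleIter {n : ℕ} (f : (Fin n → ℂ) → ℂ) : List (Fin n) → (Fin n → ℂ) → ℂ
  | [], z => f z
  | i :: l, z => (2 * Real.pi * Complex.I)⁻¹ *
      ∮ ζ in C(0, 1), ζ⁻¹ * circleIter f l (Function.update z i ζ)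

variable {n : ℕ} {f : (Fin n → ℂ) → ℂ}

theorem update_mem_unitTorus {z : Fin n → ℂ} (hz : z ∈ unitTorus n) {ζ : ℂ} (hζ : ‖ζ‖ = 1)
    (i : Fin n) : Function.update z i ζ ∈ unitTorus n := by
  intro k
  by_cases hk : k = i
  · subst hk
    simpa using hζ
  · simpa [hk] using hz k

theorem norm_circleMap_zero_one (θ : ℝ) : ‖circleMap 0 1 θ‖ = 1 := by simp

theorem continuousOn_circleIter (hf : ContinuousOn f (unitTorus n)) (l : List (Fin n)) :
    ContinuousOn (circleIter f l) (unitTorus n) := by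
  induction l with
  | nil => exact hf
  | cons i l ih =>
    refine continuousOn_const.mul ?_
    rw [continuousOn_iff_continuous_domRestrict]
    refine intervalIntegral.continuous_parametric_intervalIntegral_of_continuous' ?_ _ _
    have h1 : Continuous fun x : unitTorus n × ℝ => circleMap 0 1 x.2 := by fun_prop
    have h2 : ∀ x : unitTorus n × ℝ, circleMap 0 1 x.2 ≠ 0 := fun x =>
      norm_ne_zero_iff.1 (by rw [norm_circleMap_zero_one]; exact one_ne_zero)
    have h3 : Continuous fun x : unitTorus n × ℝ =>
        circleIter f l (Function.update x.1.1 i (circleMap 0 1 x.2)) :=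
      ih.comp_continuous ((continuous_subtype_val.comp continuous_fst).update i h1) fun x =>
        update_mem_unitTorus x.1.2 (norm_circleMap_zero_one _) i
    simp only [Function.uncurry_def, deriv_circleMap, smul_eq_mul]
    exact (h1.mul continuous_const).mul ((h1.inv₀ h2).mul h3)

theorem norm_torusMap_apply (m : ℕ) (θ : Fin m → ℝ) (k : Fin m) :
    ‖torusMap (fun _ => 0) (fun _ => 1) θ k‖ = 1 := by
  simp [torusMap]

theorem extend_mem_unitTorus {m : ℕ} {τ : Fin m → Fin n} (hτ : Function.Injective τ)
    {z : Fin n → ℂ} (hz : z ∈ unitTorus n) {y : Fin m → ℂ} (hy : y ∈ unitTorus m) :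
    Function.extend τ y z ∈ unitTorus n := by
  intro k
  by_cases hk : ∃ j, τ j = k
  · obtain ⟨j, rfl⟩ := hk
    rw [hτ.extend_apply]
    exact hy j
  · rw [Function.extend_apply' _ _ _ hk]
    exact hz k

theorem continuous_extend {X : Type*} [TopologicalSpace X] {m : ℕ} {τ : Fin m → Fin n}
    (hτ : Function.Injective τ) {y : X → Fin m → ℂ} (hy : Continuous y) (z : Fin n → ℂ) :
    Continuous fun x => Function.extend τ (y x) z := by
  refine continuous_pi fun k => ?_
  by_cases hk : ∃ j, τ j = k
  · obtain ⟨j, rfl⟩ := hk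
    simp only [hτ.extend_apply]
    exact (continuous_apply j).comp hy
  · simp only [Function.extend_apply' _ _ _ hk]
    exact continuous_const

theorem continuous_torusMap (m : ℕ) (c : Fin m → ℂ) (R : Fin m → ℝ) :
    Continuous (torusMap c R) := by
  unfold torusMap
  fun_prop

theorem torusIntegrable_extend (hf : ContinuousOn f (unitTorus n)) {m : ℕ} {τ : Fin m → Fin n}
    (hτ : Function.Injective τ) {z : Fin n → ℂ} (hz : z ∈ unitTorus n) :
    TorusIntegrable (fun y => (∏ j, (y j)⁻¹) * f (Function.extend τ y z)) (fun _ => 0)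
      fun _ => 1 := by
  have hc := continuous_torusMap m (fun _ => 0) fun _ => 1
  refine Continuous.integrableOn_Icc (Continuous.mul ?_ ?_)
  · refine continuous_finsetProd _ fun j _ => Continuous.inv₀ ((continuous_apply j).comp hc) ?_
    exact fun θ => norm_ne_zero_iff.1 (by rw [norm_torusMap_apply]; exact one_ne_zero)
  · exact hf.comp_continuous (continuous_extend hτ hc z) fun θ =>
      extend_mem_unitTorus hτ hz (norm_torusMap_apply m θ)

/-- Splitting off the outermost variable. -/
theorem extend_cons {m : ℕ} {τ : Fin (m + 1) → Fin n} (hτ : Function.Injective τ) (ζ : ℂ)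
    (y : Fin m → ℂ) (z : Fin n → ℂ) :
    Function.extend τ (Fin.cons ζ y : Fin (m + 1) → ℂ) z =
      Function.extend (fun j => τ j.succ) y (Function.update z (τ 0) ζ) := by
  have hτ' : Function.Injective fun j : Fin m => τ j.succ :=
    fun a b h => Fin.succ_injective _ (hτ h)
  funext k
  by_cases hk : ∃ j : Fin m, τ j.succ = k
  · obtain ⟨j, rfl⟩ := hk
    rw [hτ.extend_apply, hτ'.extend_apply, Fin.cons_succ]
  · rw [Function.extend_apply' (f := fun j : Fin m => τ j.succ) _ _ _ hk]
    by_cases h0 : k = τ 0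
    · subst h0
      rw [hτ.extend_apply, Fin.cons_zero, Function.update_self]
    · rw [Function.update_of_ne h0, Function.extend_apply']
      rintro ⟨j, rfl⟩
      refine Fin.cases (fun h0 _ => h0 rfl) (fun j _ hk => hk ⟨j, rfl⟩) j h0 hk

/-- The iterated integral over unit circles is an integral over a torus. -/
theorem circleIter_ofFn (hf : ContinuousOn f (unitTorus n)) {m : ℕ} {τ : Fin m → Fin n}
    (hτ : Function.Injective τ) {z : Fin n → ℂ} (hz : z ∈ unitTorus n) :
    circleIter f (List.ofFn τ) z = ((2 * Real.pi * Complex.I) ^ m)⁻¹ *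
      torusIntegral (fun y => (∏ j, (y j)⁻¹) * f (Function.extend τ y z)) (fun _ => 0)
        fun _ => 1 := by
  induction m generalizing z with
  | zero =>
    rw [List.ofFn_zero, circleIter, torusIntegral_dim0, pow_zero, inv_one, one_mul,
      Fin.prod_univ_zero, one_mul]
    congr 1
    funext k
    rw [Function.extend_apply' _ _ _ (by rintro ⟨j, -⟩; exact j.elim0)]
  | succ m ih =>
    have hτ' : Function.Injective fun j : Fin m => τ j.succ :=
      fun a b h => Fin.succ_injective _ (hτ h)
    rw [List.ofFn_succ, circleIter, torusIntegral_succ (torusIntegrable_extend hf hτ hz)]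
    generalize 2 * (Real.pi : ℂ) * Complex.I = c at ih ⊢
    rw [pow_succ', mul_inv, mul_assoc]
    congr 1
    rw [← circleIntegral.integral_const_mul]
    refine circleIntegral.integral_congr zero_le_one fun ζ hζ => ?_
    have hζ1 : ‖ζ‖ = 1 := by simpa using hζ
    rw [ih hτ' (update_mem_unitTorus hz hζ1 (τ 0)), mul_left_comm]
    congr 1
    rw [← torusIntegral_const_mul ζ⁻¹]
    simp only [extend_cons hτ, Fin.prod_univ_succ, Fin.cons_zero, Fin.cons_succ, mul_assoc]
    rfl

/-- The integral over the unit torus does not depend on the names of the variables. -/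
theorem unitTorusIntegral_comp_perm (f : (Fin n → ℂ) → ℂ) (σ : Equiv.Perm (Fin n)) :
    unitTorusIntegral (fun y => f (y ∘ σ)) = unitTorusIntegral f := by
  unfold unitTorusIntegral torusIntegral
  congr 1
  have hmp := volume_measurePreserving_piCongrLeft (fun _ : Fin n => ℝ) σ
  have happ : ∀ (θ : Fin n → ℝ) (k : Fin n),
      MeasurableEquiv.piCongrLeft (fun _ : Fin n => ℝ) σ θ k = θ (σ.symm k) := by
    intro θ k
    have := Equiv.piCongrLeft_apply_apply (fun _ : Fin n => ℝ) σ θ (σ.symm k)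
    rwa [Equiv.apply_symm_apply] at this
  have hpre : (MeasurableEquiv.piCongrLeft (fun _ : Fin n => ℝ) σ) ⁻¹'
      (Icc (0 : Fin n → ℝ) fun _ => 2 * Real.pi) = Icc (0 : Fin n → ℝ) fun _ => 2 * Real.pi := by
    ext θ
    simp only [mem_preimage, mem_Icc, Pi.le_def, happ]
    exact ⟨fun h => ⟨fun k => by simpa using h.1 (σ k), fun k => by simpa using h.2 (σ k)⟩,
      fun h => ⟨fun k => h.1 (σ.symm k), fun k => h.2 (σ.symm k)⟩⟩
  rw [← hmp.setIntegral_preimage_emb (MeasurableEquiv.measurableEmbedding _), hpre]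
  refine setIntegral_congr_fun measurableSet_Icc fun θ _ => ?_
  have hmap : ∀ k, torusMap (fun _ => 0) (fun _ => 1)
      (MeasurableEquiv.piCongrLeft (fun _ : Fin n => ℝ) σ θ) k =
      torusMap (fun _ => 0) (fun _ => 1) θ (σ.symm k) := fun k => by simp only [torusMap, happ]
  simp only [happ, smul_eq_mul]
  congr 1
  · exact Equiv.prod_comp σ.symm fun k =>
      ((1 : ℝ) : ℂ) * Complex.exp (θ k * Complex.I) * Complex.I
  · congr 1
    · simp only [hmap]
      exact Equiv.prod_comp σ.symm fun k => (torusMap (fun _ => 0) (fun _ => 1) θ k)⁻¹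
    · congr 1
      funext k
      rw [Function.comp_apply, hmap, Equiv.symm_apply_apply]

/-- Fubini's theorem on the unit torus. -/
theorem circleIter_perm (hf : ContinuousOn f (unitTorus n)) (σ : Equiv.Perm (Fin n))
    {z : Fin n → ℂ} (hz : z ∈ unitTorus n) :
    circleIter f (List.ofFn σ) z = unitTorusIntegral f := by
  rw [circleIter_ofFn hf σ.injective hz, ← unitTorusIntegral_comp_perm f σ.symm, unitTorusIntegral]
  have h : ∀ y : Fin n → ℂ, Function.extend σ y z = y ∘ σ.symm := fun y => by
    funext k
    obtain ⟨j, rfl⟩ := σ.surjective k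
    rw [σ.injective.extend_apply, Function.comp_apply, Equiv.symm_apply_apply]
  simp only [h]

theorem Contour.separates_unit_circle {A : Set ℂ} (h0 : (0 : ℂ) ∉ A) (hA : ∀ x ∈ A, ‖x‖ < 1) :
    Contour.Separates [ClosedCurve.circle 0 1] A := by
  have ht : ∀ x : ℂ, ‖x‖ ≠ 1 → x ∉ Contour.trace [ClosedCurve.circle 0 1] := fun x hx h => by
    rw [Contour.trace_circle zero_le_one, mem_sphere_zero_iff_norm] at h
    exact hx h
  have hinv : ∀ x ∈ A, 1 < ‖x⁻¹‖ := fun x hx => by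
    have hx0 : x ≠ 0 := fun e => h0 (e ▸ hx)
    rw [norm_inv]
    exact (one_lt_inv₀ (norm_pos_iff.2 hx0)).2 (hA x hx)
  exact ⟨⟨ht 0 (by simp), Contour.winding_circle_of_lt (by simp)⟩, fun x hx =>
    ⟨⟨ht x (hA x hx).ne, Contour.winding_circle_of_lt (by simpa using hA x hx)⟩,
      ht _ (hinv x hx).ne', Contour.winding_circle_of_gt zero_le_one (by simpa using hinv x hx)⟩⟩

namespace HalfEdgeGraph

variable {H E : Type*} [Fintype H] [Fintype E] {G : HalfEdgeGraph n H E}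
  {y : (ℂ × ℂ × (H → ℂ) × (E → ℂ)) × (Fin n → ℂ)} {S T : Finset (Fin n)} {k a : Fin n} {ℓ : ℕ}
  {v w : Monomial n H E}

theorem mem_dom_of_mem_small (hy : y.1 ∈ smallParamDomain H E) (hz : y.2 ∈ unitTorus n) :
    y ∈ (monomialSystem n H E).dom :=
  ⟨hy.1, fun k => norm_ne_zero_iff.1 (by rw [hz k]; exact one_ne_zero)⟩

theorem norm_evalMon_zsmul_vertMon (hz : y.2 ∈ unitTorus n) (s : ℤ) (k : Fin n) :
    ‖evalMon (s • vertMon H E k) y‖ = 1 := by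
  rw [evalMon_zsmul, evalMon_vertMon, norm_zpow, hz k, one_zpow]

theorem Arrival.norm_evalMon_lt_one (h : G.Arrival S T k ℓ v) (hy : y.1 ∈ smallParamDomain H E)
    (hz : y.2 ∈ unitTorus n) : ‖evalMon v y‖ < 1 := by
  have hd := mem_dom_of_mem_small hy hz
  induction h with
  | half h =>
    rw [evalMon_halfMon]
    exact hy.2.1 h
  | edge d s hs hd' =>
    rw [evalMon_add hd, norm_mul, norm_evalMon_zsmul_vertMon hz, one_mul, evalMon_edgeMon]
    exact hy.2.2 d.1
  | step d _ hk hd' ih =>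
    rw [evalMon_add hd, norm_mul, evalMon_edgeMon]
    exact mul_lt_one_of_nonneg_of_lt_one_left (norm_nonneg _) ih (hy.2.2 d.1).le

theorem Walk.norm_evalMon_lt_one (h : G.Walk S a k ℓ w) (hy : y.1 ∈ smallParamDomain H E)
    (hz : y.2 ∈ unitTorus n) : ‖evalMon w y‖ < 1 := by
  have hd := mem_dom_of_mem_small hy hz
  induction h with
  | edge d hd' =>
    rw [evalMon_edgeMon]
    exact hy.2.2 d.1
  | step d _ hk hd' ih =>
    rw [evalMon_add hd, norm_mul, evalMon_edgeMon]
    exact mul_lt_one_of_nonneg_of_lt_one_left (norm_nonneg _) ih (hy.2.2 d.1).le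

theorem OpenSegment.norm_evalMon_lt_one (h : G.OpenSegment S ℓ v)
    (hy : y.1 ∈ smallParamDomain H E) (hz : y.2 ∈ unitTorus n) : ‖evalMon v y‖ < 1 := by
  have hd := mem_dom_of_mem_small hy hz
  rcases h with ⟨k, x, s, hk, hs, hx, rfl⟩ | ⟨h, ℓ', x, hh, hx, rfl, rfl⟩
  · rw [evalMon_add hd, norm_mul, norm_evalMon_zsmul_vertMon hz, mul_one]
    exact hx.norm_evalMon_lt_one hy hz
  · rw [evalMon_add hd, norm_mul, evalMon_halfMon]
    exact mul_lt_one_of_nonneg_of_lt_one_left (norm_nonneg _) (hx.norm_evalMon_lt_one hy hz)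
      (hy.2.1 h).le

theorem norm_pow_mul_pow_mul_lt_one (hy : y ∈ (monomialSystem n H E).dom) {x : ℂ} (hx : ‖x‖ < 1)
    (a b : ℕ) : ‖y.1.1 ^ a * y.1.2.1 ^ b * x‖ < 1 := by
  rw [norm_mul, norm_mul, norm_pow, norm_pow]
  have h1 := pow_le_one₀ (n := a) (norm_nonneg y.1.1) hy.1.1.2.le
  have h2 := pow_le_one₀ (n := b) (norm_nonneg y.1.2.1) hy.1.2.1.2.le
  exact (mul_le_of_le_one_left (norm_nonneg x)
    (mul_le_one₀ h1 (by positivity) h2)).trans_lt hx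

theorem poch_ne_zero_of_norm_lt_one (hy : y ∈ (monomialSystem n H E).dom)
    (hv : ‖evalMon v y‖ < 1) : (monomialSystem n H E).poch v y ≠ 0 := by
  refine (MonomialSystem.poch_ne_zero_iff hy).2 fun a b h => ?_
  have h1 := norm_pow_mul_pow_mul_lt_one hy hv a b
  have h2 : y.1.1 ^ a * y.1.2.1 ^ b * evalMon v y = 1 := h
  rw [h2, norm_one] at h1
  exact lt_irrefl _ h1

theorem attachedFactor_ne_zero_of_small (hy : y.1 ∈ smallParamDomain H E)
    (hz : y.2 ∈ unitTorus n) (S : Finset (Fin n)) : G.attachedFactor S y ≠ 0 := by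
  have hd := mem_dom_of_mem_small hy hz
  refine mul_ne_zero (Finset.prod_ne_zero_iff.2 fun v hv => ?_)
    (Finset.prod_ne_zero_iff.2 fun v hv => ?_) <;> refine poch_ne_zero_of_norm_lt_one hd ?_
  · obtain ⟨L, -, hv⟩ := mem_openMonomials.1 hv
    exact hv.norm_evalMon_lt_one hy hz
  · obtain ⟨a, -, L, -, hv⟩ := mem_closedMonomials.1 hv
    exact hv.norm_evalMon_lt_one hy hz

theorem denominator_ne_zero_of_small (hy : y.1 ∈ smallParamDomain H E)
    (hz : y.2 ∈ unitTorus n) : G.denominator y.1.1 y.1.2.1 y.1.2.2.1 y.1.2.2.2 y.2 ≠ 0 := by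
  obtain ⟨c, -, hc⟩ := exists_attachedFactor_empty G
  have := attachedFactor_ne_zero_of_small (G := G) hy hz ∅
  rw [hc y (mem_dom_of_mem_small hy hz)] at this
  exact left_ne_zero_of_mul this

theorem separates_innerPoles_of_small (hy : y.1 ∈ smallParamDomain H E) (hz : y.2 ∈ unitTorus n)
    {inner : List (Fin n)} (hl : inner.Nodup) (i : Fin n) :
    Contour.Separates [ClosedCurve.circle 0 1]
      (G.innerPoles y.1.1 y.1.2.1 y.1.2.2.1 y.1.2.2.2 inner i y.2) := by
  have hd := mem_dom_of_mem_small hy hz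
  rw [innerPoles_eq_poleSet hl hd]
  refine Contour.separates_unit_circle (MonomialSystem.zero_notMem_poleSet hd) ?_
  rintro x (⟨v, hv, a, b, rfl⟩ | ⟨v, hv, a, b, h⟩)
  · obtain ⟨L, -, hv⟩ := mem_arrivalMonomials.1 hv
    exact norm_pow_mul_pow_mul_lt_one hd (hv.norm_evalMon_lt_one hy hz) a b
  · obtain ⟨L, -, hv⟩ := mem_returnMonomials.1 hv
    have h1 := norm_pow_mul_pow_mul_lt_one hd (hv.norm_evalMon_lt_one hy hz) a b
    change x ^ 2 = y.1.1 ^ a * y.1.2.1 ^ b * evalMon v y at h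
    rw [← h, norm_pow] at h1
    exact (pow_lt_one_iff_of_nonneg (norm_nonneg x) two_ne_zero).1 h1

/-- If all labels are less than one in absolute value, then the unit circles are admissible
contours, since all monomials of paths are less than one in absolute value as well. -/
theorem isDeformedIntegral_circleIter {x : ℂ × ℂ × (H → ℂ) × (E → ℂ)}
    (hx : x ∈ smallParamDomain H E) (hf : ContinuousOn f (unitTorus n)) {l : List (Fin n)}
    (hl : l.Nodup) {z : Fin n → ℂ} (hz : z ∈ unitTorus n) :
    IsDeformedIntegral G x.1 x.2.1 x.2.2.1 x.2.2.2 f l z (circleIter f l z) := by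
  induction l generalizing z with
  | nil => rfl
  | cons i l ih =>
    obtain ⟨-, hl⟩ := List.nodup_cons.1 hl
    have ht : ∀ ζ ∈ Contour.trace [ClosedCurve.circle 0 1], ‖ζ‖ = 1 := fun ζ hζ => by
      rwa [Contour.trace_circle zero_le_one, mem_sphere_zero_iff_norm] at hζ
    refine ⟨[ClosedCurve.circle 0 1], fun ζ => circleIter f l (Function.update z i ζ),
      separates_innerPoles_of_small (y := (x, z)) hx hz hl i, ?_, fun ζ hζ =>
        ih hl (update_mem_unitTorus hz (ht ζ hζ) i), ?_⟩
    · have hu : Continuous fun ζ : ℂ => Function.update z i ζ :=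
        continuous_const.update i continuous_id
      exact (continuousOn_circleIter hf l).comp hu.continuousOn fun ζ hζ =>
        update_mem_unitTorus hz (ht ζ hζ) i
    · rw [circleIter, Contour.integral_circle]

end HalfEdgeGraph

end UnitTorus

/-! ### The prefactor -/

section Prefactor

open Filter Topology Metric Set

/-- Holomorphic functions of the parameters which agree for small labels are equal. -/
theorem eqOn_paramDomain_of_eqOn_small {H E : Type*} [Finite H] [Finite E]
    {f g : ℂ × ℂ × (H → ℂ) × (E → ℂ) → ℂ} (hf : DifferentiableOn ℂ f (paramDomain H E))
    (hg : DifferentiableOn ℂ g (paramDomain H E)) (h : EqOn f g (smallParamDomain H E)) :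
    EqOn f g (paramDomain H E) := by
  have := Fintype.ofFinite H
  have := Fintype.ofFinite E
  intro x hx
  -- join `x` to small labels by multiplying all labels by the same number
  let φ : ℂ → ℂ × ℂ × (H → ℂ) × (E → ℂ) := fun s => (x.1, x.2.1, s • x.2.2.1, s • x.2.2.2)
  have hφd : Differentiable ℂ φ := by fun_prop
  have hφ1 : φ 1 = x := by simp [φ]
  have hφm : MapsTo φ {0}ᶜ (paramDomain H E) := fun s hs =>
    ⟨hx.1, hx.2.1, fun h => mul_ne_zero hs (hx.2.2.1 h), fun e => mul_ne_zero hs (hx.2.2.2 e)⟩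
  have hfd : AnalyticOnNhd ℂ (f ∘ φ) {0}ᶜ :=
    (hf.comp hφd.differentiableOn hφm).analyticOnNhd isOpen_compl_singleton
  have hgd : AnalyticOnNhd ℂ (g ∘ φ) {0}ᶜ :=
    (hg.comp hφd.differentiableOn hφm).analyticOnNhd isOpen_compl_singleton
  have hconn : IsPreconnected ({0}ᶜ : Set ℂ) :=
    (isConnected_compl_singleton_of_one_lt_rank (by simp) 0).isPreconnected
  let V : Set ℂ := {s | (∀ h, ‖(φ s).2.2.1 h‖ < 1) ∧ ∀ e, ‖(φ s).2.2.2 e‖ < 1}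
  have hV : IsOpen V := by
    have e : V = (⋂ h, {s | ‖(φ s).2.2.1 h‖ < 1}) ∩ ⋂ e, {s | ‖(φ s).2.2.2 e‖ < 1} := by
      ext s
      simp [V]
    rw [e]
    refine IsOpen.inter ?_ ?_ <;>
      refine isOpen_iInter_of_finite fun k => isOpen_lt ?_ continuous_const <;> fun_prop
  have hV0 : (0 : ℂ) ∈ V := by simp [V, φ]
  obtain ⟨s, hsV, hs0⟩ : (V ∩ {0}ᶜ).Nonempty :=
    mem_closure_iff.1 (dense_compl_singleton (0 : ℂ) 0) V hV hV0
  have hev : f ∘ φ =ᶠ[𝓝 s] g ∘ φ := by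
    filter_upwards [hV.mem_nhds hsV, isOpen_compl_singleton.mem_nhds hs0] with s' h1 h2
    exact h ⟨hφm h2, h1⟩
  have := hfd.eqOn_of_preconnected_of_eventuallyEq hgd hconn hs0 hev
    (show (1 : ℂ) ∈ ({0}ᶜ : Set ℂ) from one_ne_zero)
  simpa [hφ1] using this

namespace HalfEdgeGraph

section Lists

variable {n : ℕ} {H E : Type*} [Finite H] [Finite E] {G : HalfEdgeGraph n H E}
  {v : Monomial n H E}

/-- When all variables are integrated, the open segments are paths between two half-edges. -/
theorem exists_path_of_mem_openMonomials (hv : v ∈ G.openMonomials Finset.univ) :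
    ∃ m < 2 * 3 ^ (n - 1) - 1, ∃ (h h' : H) (l : Fin m → E × Bool),
      G.IsPath (G.base h) (List.ofFn l) (G.base h') ∧
        v = halfMon n E h + listMon n H (List.ofFn l) + halfMon n E h' := by
  obtain ⟨L, hL, hv⟩ := mem_openMonomials.1 hv
  rcases hv with ⟨k, y, s, hk, -⟩ | ⟨h', ℓ, y, -, hy, rfl, rfl⟩
  · exact absurd (Finset.mem_univ k) hk
  · rcases arrival_iff.1 hy with ⟨h, l, hp, -, rfl, rfl⟩ | ⟨d, l, s, -, hd, -⟩
    · refine ⟨l.length, ?_, h, h', l.get, by rwa [List.ofFn_get], by rw [List.ofFn_get]⟩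
      rw [Finset.card_univ, Fintype.card_fin] at hL
      have hn : n ≠ 0 := fun e => by
        subst e
        exact (G.base h).elim0
      obtain ⟨m, rfl⟩ := Nat.exists_eq_succ_of_ne_zero hn
      simp only [lengthBound, Nat.succ_eq_add_one, Nat.add_sub_cancel] at hL ⊢
      omega
    · exact absurd (Finset.mem_univ _) hd

theorem exists_path_of_mem_closedMonomials (hv : v ∈ G.closedMonomials Finset.univ) :
    ∃ m ∈ Finset.Icc 1 (4 * 3 ^ (n - 2)), ∃ (i : Fin n) (l : Fin m → E × Bool),
      G.IsPath i (List.ofFn l) i ∧ v = listMon n H (List.ofFn l) := by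
  obtain ⟨a, -, L, hL, hv⟩ := mem_closedMonomials.1 hv
  obtain ⟨d, l, rfl, hp, -, rfl, rfl⟩ := walk_iff.1 hv
  rw [Finset.card_univ, Fintype.card_fin] at hL
  refine ⟨(d :: l).length, Finset.mem_Icc.2 ⟨by simp, by simpa using hL⟩, G.start d,
    (d :: l).get, ?_, ?_⟩
  · rw [List.ofFn_get]
    exact ⟨rfl, hp⟩
  · rw [List.ofFn_get]
    simp [listMon]

open Classical in
theorem prod_openMonomials_univ_dvd {R : Type*} [CommMonoid R] [Fintype H] [Fintype E]
    (P : Monomial n H E → R) : ∏ v ∈ G.openMonomials Finset.univ, P v ∣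
      ∏ m ∈ Finset.range (2 * 3 ^ (n - 1) - 1), ∏ h : H, ∏ h' : H, ∏ l : Fin m → E × Bool,
        if G.IsPath (G.base h) (List.ofFn l) (G.base h') then
          P (halfMon n E h + listMon n H (List.ofFn l) + halfMon n E h') else 1 := by
  let s : Finset (Σ m : ℕ, H × H × (Fin m → E × Bool)) :=
    (Finset.range (2 * 3 ^ (n - 1) - 1)).sigma fun _ => Finset.univ
  let good : (Σ m : ℕ, H × H × (Fin m → E × Bool)) → Prop := fun x =>
    G.IsPath (G.base x.2.1) (List.ofFn x.2.2.2) (G.base x.2.2.1)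
  let mon : (Σ m : ℕ, H × H × (Fin m → E × Bool)) → Monomial n H E := fun x =>
    halfMon n E x.2.1 + listMon n H (List.ofFn x.2.2.2) + halfMon n E x.2.2.1
  have h1 : G.openMonomials Finset.univ ⊆ (s.filter good).image mon := by
    intro v hv
    obtain ⟨m, hm, h, h', l, hl, rfl⟩ := exists_path_of_mem_openMonomials hv
    exact Finset.mem_image.2 ⟨⟨m, h, h', l⟩, Finset.mem_filter.2
      ⟨Finset.mem_sigma.2 ⟨Finset.mem_range.2 hm, Finset.mem_univ _⟩, hl⟩, rfl⟩
  refine ((Finset.prod_dvd_prod_of_subset _ _ P h1).trans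
    (Finset.prod_image_dvd_prod _ mon P)).trans (dvd_of_eq ?_)
  rw [Finset.prod_filter, Finset.prod_sigma]
  simp only [Fintype.prod_prod_type, good, mon]

open Classical in
theorem prod_closedMonomials_univ_dvd {R : Type*} [CommMonoid R] [Fintype E]
    (P : Monomial n H E → R) : ∏ v ∈ G.closedMonomials Finset.univ, P v ∣
      ∏ m ∈ Finset.Icc 1 (4 * 3 ^ (n - 2)), ∏ i : Fin n, ∏ l : Fin m → E × Bool,
        if G.IsPath i (List.ofFn l) i then P (listMon n H (List.ofFn l)) else 1 := by
  let s : Finset (Σ m : ℕ, Fin n × (Fin m → E × Bool)) :=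
    (Finset.Icc 1 (4 * 3 ^ (n - 2))).sigma fun _ => Finset.univ
  let good : (Σ m : ℕ, Fin n × (Fin m → E × Bool)) → Prop := fun x =>
    G.IsPath x.2.1 (List.ofFn x.2.2) x.2.1
  let mon : (Σ m : ℕ, Fin n × (Fin m → E × Bool)) → Monomial n H E := fun x =>
    listMon n H (List.ofFn x.2.2)
  have h1 : G.closedMonomials Finset.univ ⊆ (s.filter good).image mon := by
    intro v hv
    obtain ⟨m, hm, i, l, hl, rfl⟩ := exists_path_of_mem_closedMonomials hv
    exact Finset.mem_image.2 ⟨⟨m, i, l⟩, Finset.mem_filter.2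
      ⟨Finset.mem_sigma.2 ⟨hm, Finset.mem_univ _⟩, hl⟩, rfl⟩
  refine ((Finset.prod_dvd_prod_of_subset _ _ P h1).trans
    (Finset.prod_image_dvd_prod _ mon P)).trans (dvd_of_eq ?_)
  rw [Finset.prod_filter, Finset.prod_sigma]
  simp only [Fintype.prod_prod_type, good, mon]

end Lists

variable {n : ℕ} {H E : Type*} [Fintype H] [Fintype E]

/-- The part of the contribution of a closed path to the prefactor beyond one copy of the Pochhammer
symbol of its weight. -/
noncomputable def closedExtra (v : Monomial n H E)
    (y : (ℂ × ℂ × (H → ℂ) × (E → ℂ)) × (Fin n → ℂ)) : ℂ :=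
  (monomialSystem n H E).poch v y * (ellPoch y.1.1 y.1.2.1 (y.1.1 * evalMon v y) *
    ellPoch y.1.1 y.1.2.1 (y.1.2.1 * evalMon v y) *
    ellPoch y.1.1 y.1.2.1 (y.1.1 * y.1.2.1 * evalMon v y)) ^ 2

theorem differentiableOn_closedExtra (v : Monomial n H E) :
    DifferentiableOn ℂ (closedExtra v) (monomialSystem n H E).dom := by
  let M := monomialSystem n H E
  have hp := M.differentiableOn_p
  have hq := M.differentiableOn_q
  have hχ := M.differentiableOn_χ v
  have key : ∀ {f : (ℂ × ℂ × (H → ℂ) × (E → ℂ)) × (Fin n → ℂ) → ℂ}, DifferentiableOn ℂ f M.dom →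
      DifferentiableOn ℂ (fun y => ellPoch y.1.1 y.1.2.1 (f y * evalMon v y)) M.dom := fun hf =>
    differentiableOn_ellPoch_comp hp hq (hf.mul hχ) M.norm_p_lt_one M.norm_q_lt_one
  exact (MonomialSystem.differentiableOn_poch v).mul
    ((((key hp).mul (key hq)).mul (key (hp.mul hq))).pow 2)

/-- The factor attached to all vertices divides the prefactor. -/
theorem exists_prefactor_eq (G : HalfEdgeGraph n H E) :
    ∃ c : (ℂ × ℂ × (H → ℂ) × (E → ℂ)) × (Fin n → ℂ) → ℂ,
      DifferentiableOn ℂ c (monomialSystem n H E).dom ∧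
      ∀ y ∈ (monomialSystem n H E).dom, G.prefactor y.1.1 y.1.2.1 y.1.2.2.1 y.1.2.2.2 =
        G.attachedFactor Finset.univ y * c y := by
  classical
  let M := monomialSystem n H E
  let extra : Monomial n H E → holomorphicSubring M.dom := fun v =>
    ⟨fun y => closedExtra v y, closedExtra v, differentiableOn_closedExtra v, fun _ => rfl⟩
  have h1 := mul_dvd_mul (prod_openMonomials_univ_dvd (G := G) M.pochElt)
    ((Finset.prod_dvd_prod_of_dvd _ _ fun v _ => dvd_mul_right (M.pochElt v) (extra v)).trans
      (prod_closedMonomials_univ_dvd (G := G) fun v => M.pochElt v * extra v))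
  obtain ⟨c, hc, h⟩ := exists_cofactor_of_dvd h1
  refine ⟨c, hc, fun y hy => ?_⟩
  have h2 := h y hy
  have hite : ∀ (P : Prop) [Decidable P] (f : holomorphicSubring M.dom) (y : M.dom),
      (if P then f else 1 : holomorphicSubring M.dom).1 y = if P then f.1 y else 1 := by
    intro P _ f y
    split_ifs <;> rfl
  simp only [Subring.coe_mul, Pi.mul_apply, holomorphicSubring_prod_apply, hite,
    MonomialSystem.pochElt_apply] at h2
  refine Eq.trans ?_ h2
  unfold prefactor openPathFactor closedPathFactor
  congr 1
  · refine Finset.prod_congr rfl fun m _ => Finset.prod_congr rfl fun h _ =>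
      Finset.prod_congr rfl fun h' _ => Finset.prod_congr rfl fun l _ => ?_
    refine if_congr Iff.rfl (congrArg (ellPoch y.1.1 y.1.2.1) ?_) rfl
    change _ = evalMon _ y
    rw [evalMon_add hy, evalMon_add hy, evalMon_halfMon, evalMon_halfMon, evalMon_listMon hy]
  · refine Finset.prod_congr rfl fun m _ => Finset.prod_congr rfl fun i _ =>
      Finset.prod_congr rfl fun l _ => ?_
    refine if_congr Iff.rfl ?_ rfl
    change _ = ellPoch y.1.1 y.1.2.1 (evalMon _ y) * (ellPoch y.1.1 y.1.2.1 (evalMon _ y) * _)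
    rw [evalMon_listMon hy]
    ring

/-- Without resonances the prefactor does not vanish. -/
theorem NonResonant.prefactor_ne_zero {G : HalfEdgeGraph n H E} {p q : ℂ} {t : H → ℂ} {u : E → ℂ}
    (hx : (p, q, t, u) ∈ paramDomain H E) (h : G.NonResonant p q t u) :
    G.prefactor p q t u ≠ 0 := by
  classical
  have hp0 : p ≠ 0 := norm_pos_iff.1 hx.1.1
  have hq0 : q ≠ 0 := norm_pos_iff.1 hx.2.1.1
  have key : ∀ {w : ℂ}, (∀ a b : ℕ, w ≠ (p ^ a)⁻¹ * (q ^ b)⁻¹) → ∀ c d : ℕ,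
      ellPoch p q (p ^ c * q ^ d * w) ≠ 0 := by
    intro w hw c d
    refine (ellPoch_ne_zero_iff hx.1.2 hx.2.1.2).2 fun a b e => hw (a + c) (b + d) ?_
    have hne : p ^ (a + c) * q ^ (b + d) ≠ 0 := mul_ne_zero (pow_ne_zero _ hp0) (pow_ne_zero _ hq0)
    rw [← mul_inv]
    refine eq_inv_of_mul_eq_one_right ?_
    rw [← e]
    ring
  refine mul_ne_zero (Finset.prod_ne_zero_iff.2 fun m _ => Finset.prod_ne_zero_iff.2 fun a _ =>
    Finset.prod_ne_zero_iff.2 fun a' _ => Finset.prod_ne_zero_iff.2 fun l _ => ?_)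
    (Finset.prod_ne_zero_iff.2 fun m hm => Finset.prod_ne_zero_iff.2 fun i _ =>
      Finset.prod_ne_zero_iff.2 fun l _ => ?_)
  · split_ifs with hl
    · simpa using key (h.1 a a' _ hl) 0 0
    · exact one_ne_zero
  · split_ifs with hl
    · have hw := key (h.2 i (List.ofFn l) (fun e => by
        have h1 := congrArg List.length e
        have h2 := (Finset.mem_Icc.1 hm).1
        rw [List.length_ofFn, List.length_nil] at h1
        omega) hl)
      have h00 := hw 0 0
      have h10 := hw 1 0
      have h01 := hw 0 1
      have h11 := hw 1 1
      simp only [pow_zero, pow_one, one_mul, mul_one] at h00 h10 h01 h11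
      exact pow_ne_zero _ (mul_ne_zero (mul_ne_zero (mul_ne_zero h00 h10) h01) h11)
    · exact one_ne_zero

end HalfEdgeGraph

end Prefactor

/-! ### The extension of the integral -/

theorem mainTheorem6 {n : ℕ} {H E : Type*} [Fintype H] [Fintype E] (G : HalfEdgeGraph n H E)
    (F : ℂ → ℂ → (H → ℂ) → (E → ℂ) → (Fin n → ℂ) → ℂ)
    (hF : ∃ hol : (ℂ × ℂ × (H → ℂ) × (E → ℂ)) × (Fin n → ℂ) → ℂ,
      DifferentiableOn ℂ hol (paramDomain H E ×ˢ {z : Fin n → ℂ | ∀ i, z i ≠ 0}) ∧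
      ∀ (p q : ℂ) (t : H → ℂ) (u : E → ℂ) (z : Fin n → ℂ), (p, q, t, u) ∈ paramDomain H E →
        (∀ i, z i ≠ 0) → G.denominator p q t u z ≠ 0 →
        F p q t u z * G.denominator p q t u z = hol ((p, q, t, u), z)) :
    ∃ Φ : ℂ × ℂ × (H → ℂ) × (E → ℂ) → ℂ,
      -- the holomorphic extension
      DifferentiableOn ℂ Φ (paramDomain H E) ∧
      (∀ (p q : ℂ) (t : H → ℂ) (u : E → ℂ), (p, q, t, u) ∈ smallParamDomain H E →
        Φ (p, q, t, u) = G.prefactor p q t u * unitTorusIntegral (F p q t u)) ∧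
      -- its uniqueness
      (∀ Ψ : ℂ × ℂ × (H → ℂ) × (E → ℂ) → ℂ, DifferentiableOn ℂ Ψ (paramDomain H E) →
        (∀ (p q : ℂ) (t : H → ℂ) (u : E → ℂ), (p, q, t, u) ∈ smallParamDomain H E →
          Ψ (p, q, t, u) = G.prefactor p q t u * unitTorusIntegral (F p q t u)) →
        Set.EqOn Ψ Φ (paramDomain H E)) ∧
      -- away from the zeros of the prefactor it is given by integrals over deformed contours
      (∀ (p q : ℂ) (t : H → ℂ) (u : E → ℂ), (p, q, t, u) ∈ paramDomain H E →
        G.prefactor p q t u ≠ 0 → ∀ σ : Equiv.Perm (Fin n),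
          IsFullDeformedIntegral G p q t u (F p q t u) σ (Φ (p, q, t, u) / G.prefactor p q t u) ∧
          ∀ I, IsFullDeformedIntegral G p q t u (F p q t u) σ I →
            I = Φ (p, q, t, u) / G.prefactor p q t u) ∧
      -- the criterion for interchanging the order of integration
      (∀ (p q : ℂ) (t : H → ℂ) (u : E → ℂ), (p, q, t, u) ∈ paramDomain H E →
        G.NonResonant p q t u → G.prefactor p q t u ≠ 0 ∧
          ∃ I, ∀ (σ : Equiv.Perm (Fin n)) (J : ℂ),
            IsFullDeformedIntegral G p q t u (F p q t u) σ J ↔ J = I) := by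
  classical
  obtain ⟨hol, hhol, hF⟩ := hF
  have hF' : ∀ y ∈ (HalfEdgeGraph.monomialSystem n H E).dom,
      G.denominator y.1.1 y.1.2.1 y.1.2.2.1 y.1.2.2.2 y.2 ≠ 0 →
      F y.1.1 y.1.2.1 y.1.2.2.1 y.1.2.2.2 y.2 *
        G.denominator y.1.1 y.1.2.1 y.1.2.2.1 y.1.2.2.2 y.2 = hol y :=
    fun y hy h => hF _ _ _ _ _ hy.1 hy.2 h
  have hex := fun σ : Equiv.Perm (Fin n) =>
    HalfEdgeGraph.exists_isDeformedIntegral_iff G hhol hF' (List.nodup_ofFn.2 σ.injective)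
  have huniv : ∀ σ : Equiv.Perm (Fin n), (List.ofFn σ).toFinset = Finset.univ := fun σ => by
    ext k
    simpa [List.mem_ofFn] using σ.surjective k
  choose Φ hΦ hI using hex
  simp only [huniv] at hI
  obtain ⟨c, hc, hcD⟩ := HalfEdgeGraph.exists_prefactor_eq G
  -- the integration starts at the point all of whose coordinates are equal to one
  let y : ℂ × ℂ × (H → ℂ) × (E → ℂ) → (ℂ × ℂ × (H → ℂ) × (E → ℂ)) × (Fin n → ℂ) :=
    fun x => (x, fun _ => 1)
  have hy : Set.MapsTo y (paramDomain H E) (HalfEdgeGraph.monomialSystem n H E).dom :=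
    fun x hx => ⟨hx, fun _ => one_ne_zero⟩
  have hyd : Differentiable ℂ y := by fun_prop
  have h1 : (fun _ => 1 : Fin n → ℂ) ∈ unitTorus n := fun _ => norm_one
  have hcont : ∀ x ∈ smallParamDomain H E,
      ContinuousOn (F x.1 x.2.1 x.2.2.1 x.2.2.2) (unitTorus n) := by
    intro x hx
    have hm : Set.MapsTo (fun z : Fin n → ℂ => (x, z)) (unitTorus n)
        (HalfEdgeGraph.monomialSystem n H E).dom := fun z hz =>
      HalfEdgeGraph.mem_dom_of_mem_small (y := (x, z)) hx hz
    have hxz : ContinuousOn (fun z : Fin n → ℂ => (x, z)) (unitTorus n) := by fun_prop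
    have hden : ContinuousOn (fun z => ∏ k, (HalfEdgeGraph.monomialSystem n H E).poch
        (G.denominatorMon k) (x, z)) (unitTorus n) :=
      continuousOn_finsetProd _ fun k _ =>
        (MonomialSystem.differentiableOn_poch _).continuousOn.comp hxz hm
    have hnum : ContinuousOn (fun z => hol (x, z)) (unitTorus n) := hhol.continuousOn.comp hxz hm
    have h0 : ∀ z ∈ unitTorus n, G.denominator x.1 x.2.1 x.2.2.1 x.2.2.2 z ≠ 0 := fun z hz =>
      HalfEdgeGraph.denominator_ne_zero_of_small (y := (x, z)) hx hz
    have he : ∀ z ∈ unitTorus n, G.denominator x.1 x.2.1 x.2.2.1 x.2.2.2 z =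
        ∏ k, (HalfEdgeGraph.monomialSystem n H E).poch (G.denominatorMon k) (x, z) := fun z hz =>
      HalfEdgeGraph.denominator_eq_prod (y := (x, z)) (hm hz)
    refine (hnum.div hden fun z hz => (he z hz) ▸ h0 z hz).congr fun z hz => ?_
    rw [Pi.div_apply, ← he z hz, eq_div_iff (h0 z hz)]
    exact hF' (x, z) (hm hz) (h0 z hz)
  -- for small labels the unit circles are admissible, whatever the order of integration
  have hsmall : ∀ σ, ∀ x ∈ smallParamDomain H E, Φ σ (y x) = G.attachedFactor Finset.univ (y x) *
      unitTorusIntegral (F x.1 x.2.1 x.2.2.1 x.2.2.2) := by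
    intro σ x hx
    have hD := HalfEdgeGraph.attachedFactor_ne_zero_of_small (G := G) (y := y x) hx h1 Finset.univ
    have h2 := (hI σ (y x) (hy hx.1) hD _).1 (HalfEdgeGraph.isDeformedIntegral_circleIter hx
      (hcont x hx) (List.nodup_ofFn.2 σ.injective) h1)
    rw [circleIter_perm (hcont x hx) σ h1, eq_div_iff hD] at h2
    rw [← h2, mul_comm]
  have hΦd : ∀ σ, DifferentiableOn ℂ (fun x => Φ σ (y x)) (paramDomain H E) := fun σ =>
    (hΦ σ).comp hyd.differentiableOn hy
  -- hence, by analytic continuation, the extension does not depend on the order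
  have heq : ∀ σ, Set.EqOn (fun x => Φ σ (y x)) (fun x => Φ 1 (y x)) (paramDomain H E) := fun σ =>
    eqOn_paramDomain_of_eqOn_small (hΦd σ) (hΦd 1) fun x hx => by
      simp only [hsmall σ x hx, hsmall 1 x hx]
  have hpre : ∀ x ∈ paramDomain H E, G.prefactor x.1 x.2.1 x.2.2.1 x.2.2.2 =
      G.attachedFactor Finset.univ (y x) * c (y x) := fun x hx => hcD (y x) (hy hx)
  have hval : ∀ x ∈ paramDomain H E, G.prefactor x.1 x.2.1 x.2.2.1 x.2.2.2 ≠ 0 →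
      ∀ (σ : Equiv.Perm (Fin n)) (I : ℂ),
      IsFullDeformedIntegral G x.1 x.2.1 x.2.2.1 x.2.2.2 (F x.1 x.2.1 x.2.2.1 x.2.2.2) σ I ↔
        I = c (y x) * Φ 1 (y x) / G.prefactor x.1 x.2.1 x.2.2.1 x.2.2.2 := by
    intro x hx h0 σ I
    rw [hpre x hx] at h0 ⊢
    rw [mul_comm (c (y x)), mul_div_mul_right _ _ (right_ne_zero_of_mul h0),
      ← show Φ σ (y x) = Φ 1 (y x) from heq σ hx]
    exact hI σ (y x) (hy hx) (left_ne_zero_of_mul h0) I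
  have hmain : ∀ x ∈ smallParamDomain H E, c (y x) * Φ 1 (y x) =
      G.prefactor x.1 x.2.1 x.2.2.1 x.2.2.2 * unitTorusIntegral (F x.1 x.2.1 x.2.2.1 x.2.2.2) := by
    intro x hx
    rw [hsmall 1 x hx, hpre x hx.1]
    ring
  have hd : DifferentiableOn ℂ (fun x => c (y x) * Φ 1 (y x)) (paramDomain H E) :=
    (hc.comp hyd.differentiableOn hy).mul (hΦd 1)
  refine ⟨fun x => c (y x) * Φ 1 (y x), hd, fun p q t u hx => hmain _ hx, fun Ψ hΨ hΨs => ?_,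
    fun p q t u hx h0 σ => ?_, fun p q t u hx hres => ?_⟩
  · exact eqOn_paramDomain_of_eqOn_small hΨ hd fun x hx =>
      (hΨs x.1 x.2.1 x.2.2.1 x.2.2.2 hx).trans (hmain x hx).symm
  · have h := hval (p, q, t, u) hx h0 σ
    exact ⟨(h _).2 rfl, fun I => (h I).1⟩
  · have h0 := hres.prefactor_ne_zero hx
    exact ⟨h0, _, hval (p, q, t, u) hx h0⟩
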